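/- Setting. Let $A,B$ be finite-dimensional quantum systems with Hamiltonians (Hermitian matrices) $H_A,H_B$, let $H=H_A\otimes 1+1\otimes H_B$, and let $\beta>0$. For a density matrix $\rho$ put $E(\rho)=\mathrm{tr}[\rho H]$ (with $H_A$, $H_B$ for the marginals $\rho_A,\rho_B$), $S(\rho)=-\mathrm{tr}[\rho\log\rho]$, $F_\beta(\rho)=E(\rho)-S(\rho)/\beta$, $S(A|B)_\rho=S(\rho_{AB})-S(\rho_B)$, $S(B|A)_\rho=S(\rho_{AB})-S(\rho_A)$, and $\gamma(x)=e^{-xH}/\mathrm{tr}\,e^{-xH}$ for $x\in\mathbb R$. Separable states are the convex hull of the product states; the other states are entangled. Let $E_{\max},E_{\min}$ be the largest and smallest eigenvalues of $H$ and $g_{\max},g_{\min}$ their multiplicities. For a state $\rho=\rho_{AB}$ put $$F^\star=F^\star_\beta(\rho)=E(\rho_A)+E(\rho_B)-\beta^{-1}\max\{S(\rho_A),S(\rho_B)\},\qquad f(x,y)=y-F_\beta(\gamma(x)),$$ call $\beta_c^\star$ a zero $x\le\beta$ and $\beta_h^\star$ a zero $x\ge\beta$ of $x\mapsto f(x,F^\star)$,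 and for such a zero put $$Q^\star_{c/h}=\beta^{-1}\big[\max\{S(\rho_A),S(\rho_B)\}-S(\gamma(\beta^\star_{c/h}))\big].$$ A process for $\rho$ consists of a finite-dimensional memory $M$ (Hamiltonian $H_M$, initial state $\omega$), a finite-dimensional environment $E$ (Hamiltonian $H_E$, initial state $\gamma_E=e^{-\beta H_E}/\mathrm{tr}\,e^{-\beta H_E}$) and a unitary $U$ commuting with $H+H_M+H_E$, such that $\eta=U(\rho\otimes\omega\otimes\gamma_E)U^\dagger$ satisfies $\eta_M=\omega$. Its heat is $Q=\mathrm{tr}[H_E(\eta_E-\gamma_E)]$. Theorem. Let $\rho$ be a state of $AB$. 1. If $\rho$ is separable, then $S(A|B)_\rho\ge0$ and $S(B|A)_\rho\ge0$, hence $F_\beta(\rho)\le F^\star_\beta(\rho)$; and every process for $\rho$ satisfies $Q^\star_c\le Q$ for every zero $\beta_c^\star$ and $Q\le Q^\star_h$ for every zero $\beta_h^\star$. The free-energy bound is tight: every state $\sigma$ of $A$ is the marginal $\tau_A$ of a separable state $\tau$ with $F_\beta(\tau)=F^\star_\beta(\tau)$. 2. A zero $\beta_c^\star$ exists if $F^\star<E_{\max}-\beta^{-1}\log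 g_{\max}$, and a zero $\beta_h^\star$ exists if $F^\star<E_{\min}-\beta^{-1}\log g_{\min}$. In any case $E(\rho)-E_{\max}\le Q\le E(\rho)-E_{\min}$ for every process for $\rho$. 3. If some process for $\rho$ has $Q<Q^\star_c$ for a zero $\beta_c^\star$, or $Q>Q^\star_h$ for a zero $\beta_h^\star$, then $\rho$ is entangled. 4. If $\rho$ is pure and entangled, then $S(A|B)_\rho<0$, $S(B|A)_\rho<0$ and $F_\beta(\rho)>F^\star_\beta(\rho)$. Moreover, $\rho$ is detected: for every zero $\beta_c^\star$ there is a process for $\rho$ with $Q<Q_c^\star$, and for every zero $\beta_h^\star$ there is a process for $\rho$ with $Q>Q_h^\star$. If the highest level of $H$ is nondegenerate ($g_{\max}=1$), then a zero $\beta_c^\star$ exists, so that every pure entangled state is detected. -/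

import Mathlib

open scoped Matrix Kronecker ComplexOrder

noncomputable section

namespace HeatWitness

section General

variable {m n : Type*} [Fintype m] [DecidableEq m] [Fintype n] [DecidableEq n]

/-- Density matrices: positive semidefinite with unit trace. -/
def IsState (ρ : Matrix n n ℂ) : Prop := ρ.PosSemidef ∧ ρ.trace = 1

/-- A density matrix is pure if it is the projector on a unit vector. -/
def IsPure (ρ : Matrix n n ℂ) : Prop :=
  ∃ ψ : n → ℂ, star ψ ⬝ᵥ ψ = 1 ∧ ρ = Matrix.vecMulVec ψ (star ψ)

/-- Partial trace over the second factor. -/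
def traceRight (ρ : Matrix (m × n) (m × n) ℂ) : Matrix m m ℂ :=
  Matrix.of fun i j => ∑ k, ρ (i, k) (j, k)

/-- Partial trace over the first factor. -/
def traceLeft (ρ : Matrix (m × n) (m × n) ℂ) : Matrix n n ℂ :=
  Matrix.of fun i j => ∑ k, ρ (k, i) (k, j)

/-- Average energy `tr[ρ H]`. -/
def energy (H ρ : Matrix n n ℂ) : ℝ := (ρ * H).trace.re

/-- Von Neumann entropy `-tr[ρ log ρ]` (natural logarithm), with `log` applied by functional
calculus; since `Real.log 0 = 0`, the convention `0 log 0 = 0` holds. -/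
def entropy (ρ : Matrix n n ℂ) : ℝ := -(ρ * cfc Real.log ρ).trace.re

/-- Free energy `E(ρ) - S(ρ) / β`. -/
def freeEnergy (β : ℝ) (H ρ : Matrix n n ℂ) : ℝ := energy H ρ - entropy ρ / β

/-- Gibbs state `exp(-x H) / tr exp(-x H)` at an arbitrary real inverse temperature `x`. -/
def gibbs (H : Matrix n n ℂ) (x : ℝ) : Matrix n n ℂ :=
  (NormedSpace.exp (-(x : ℂ) • H)).trace⁻¹ • NormedSpace.exp (-(x : ℂ) • H)

/-- Hamiltonian `H₁ ⊗ 1 + 1 ⊗ H₂` of a pair of systems. -/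
def totalH (H₁ : Matrix m m ℂ) (H₂ : Matrix n n ℂ) : Matrix (m × n) (m × n) ℂ :=
  H₁ ⊗ₖ (1 : Matrix n n ℂ) + (1 : Matrix m m ℂ) ⊗ₖ H₂

/-- Separable states: the convex hull of the product states. -/
def Separable (ρ : Matrix (m × n) (m × n) ℂ) : Prop :=
  ρ ∈ convexHull ℝ {τ : Matrix (m × n) (m × n) ℂ |
    ∃ (σ₁ : Matrix m m ℂ) (σ₂ : Matrix n n ℂ), IsState σ₁ ∧ IsState σ₂ ∧ τ = σ₁ ⊗ₖ σ₂}

/-- `S(A|B) = S(ρ_AB) - S(ρ_B)`, where `A` is the first factor and `B` the second. -/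
def condEntropyAB (ρ : Matrix (m × n) (m × n) ℂ) : ℝ := entropy ρ - entropy (traceLeft ρ)

/-- `S(B|A) = S(ρ_AB) - S(ρ_A)`. -/
def condEntropyBA (ρ : Matrix (m × n) (m × n) ℂ) : ℝ := entropy ρ - entropy (traceRight ρ)

/-- Lowest energy level. -/
def minEnergy (H : Matrix n n ℂ) : ℝ := sInf (spectrum ℝ H)

/-- Highest energy level. -/
def maxEnergy (H : Matrix n n ℂ) : ℝ := sSup (spectrum ℝ H)

/-- Degeneracy of the energy level `E`. -/
def degeneracy (H : Matrix n n ℂ) (E : ℝ) : ℕ :=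
  Module.finrank ℂ (Module.End.eigenspace (Matrix.toLin' H) (E : ℂ))

end General

/-- A process in which the system (Hamiltonian `HS`, initial state `ρ`) interacts with a memory
(dimension `dM`) and with an environment (dimension `dE`) that is initially in its Gibbs state at
inverse temperature `β`: the evolution is an energy-preserving unitary, and the reduced state of
the memory is returned to its initial value. -/
structure HeatProcess {S : Type*} [Fintype S] [DecidableEq S]
    (β : ℝ) (HS ρ : Matrix S S ℂ) where
  dM : ℕ
  dE : ℕ
  HM : Matrix (Fin dM) (Fin dM) ℂ
  HE : Matrix (Fin dE) (Fin dE) ℂ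
  ω : Matrix (Fin dM) (Fin dM) ℂ
  U : Matrix (S × (Fin dM × Fin dE)) (S × (Fin dM × Fin dE)) ℂ
  HM_hermitian : HM.IsHermitian
  HE_hermitian : HE.IsHermitian
  ω_state : IsState ω
  U_unitary : U ∈ Matrix.unitaryGroup (S × (Fin dM × Fin dE)) ℂ
  U_energy : U * totalH HS (totalH HM HE) = totalH HS (totalH HM HE) * U
  memory_returned :
    traceRight (traceLeft (U * (ρ ⊗ₖ (ω ⊗ₖ gibbs HE β)) * Uᴴ)) = ω

namespace HeatProcess

variable {S : Type*} [Fintype S] [DecidableEq S] {β : ℝ} {HS ρ : Matrix S S ℂ}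

/-- Joint final state of system, memory and environment. -/
def final (P : HeatProcess β HS ρ) :
    Matrix (S × (Fin P.dM × Fin P.dE)) (S × (Fin P.dM × Fin P.dE)) ℂ :=
  P.U * (ρ ⊗ₖ (P.ω ⊗ₖ gibbs P.HE β)) * P.Uᴴ

/-- Heat received by the environment, `tr[H_E (η_E - γ_E)]`. -/
def heat (P : HeatProcess β HS ρ) : ℝ :=
  energy P.HE (traceLeft (traceLeft P.final) - gibbs P.HE β)

end HeatProcess

section Witness

variable {A B : Type*} [Fintype A] [DecidableEq A] [Fintype B] [DecidableEq B]

/-- The larger of the two local entropies. -/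
def maxLocalEntropy (ρ : Matrix (A × B) (A × B) ℂ) : ℝ :=
  max (entropy (traceRight ρ)) (entropy (traceLeft ρ))

/-- `F*_β = E(ρ_A) + E(ρ_B) - β⁻¹ max {S(ρ_A), S(ρ_B)}`; it depends only on the marginals. -/
def freeEnergyStar (β : ℝ) (HA : Matrix A A ℂ) (HB : Matrix B B ℂ)
    (ρ : Matrix (A × B) (A × B) ℂ) : ℝ :=
  energy HA (traceRight ρ) + energy HB (traceLeft ρ) - β⁻¹ * maxLocalEntropy ρ

/-- `f(x, y) = y - F_β(γ(x))` for the Hamiltonian `H`. -/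
def zeroFun {n : Type*} [Fintype n] [DecidableEq n] (β : ℝ) (H : Matrix n n ℂ) (x y : ℝ) : ℝ :=
  y - freeEnergy β H (gibbs H x)

/-- `x` is an inverse temperature `β_c*`: a zero of `f(·, F*_β)` on the side `x ≤ β`. -/
def IsColdTemp (β : ℝ) (HA : Matrix A A ℂ) (HB : Matrix B B ℂ)
    (ρ : Matrix (A × B) (A × B) ℂ) (x : ℝ) : Prop :=
  x ≤ β ∧ zeroFun β (totalH HA HB) x (freeEnergyStar β HA HB ρ) = 0

/-- `x` is an inverse temperature `β_h*`: a zero of `f(·, F*_β)` on the side `β ≤ x`. -/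
def IsHotTemp (β : ℝ) (HA : Matrix A A ℂ) (HB : Matrix B B ℂ)
    (ρ : Matrix (A × B) (A × B) ℂ) (x : ℝ) : Prop :=
  β ≤ x ∧ zeroFun β (totalH HA HB) x (freeEnergyStar β HA HB ρ) = 0

/-- `β⁻¹ [max {S(ρ_A), S(ρ_B)} - S(γ_AB(x))]`: this is `Q*_c` for `x = β_c*` and `Q*_h` for
`x = β_h*`. -/
def heatBound (β : ℝ) (HA : Matrix A A ℂ) (HB : Matrix B B ℂ)
    (ρ : Matrix (A × B) (A × B) ℂ) (x : ℝ) : ℝ :=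
  β⁻¹ * (maxLocalEntropy ρ - entropy (gibbs (totalH HA HB) x))

end Witness

end HeatWitness

end

/-!
The argument is an energy and entropy balance on one side and an explicit protocol on the other.

**Separable states.** A separable state satisfies the reduction criterion `ρ ≤ 1 ⊗ ρ_B` and
`ρ ≤ ρ_A ⊗ 1` (`Separable.one_kronecker_sub_posSemidef`, `Separable.kronecker_one_sub_posSemidef`).
The logarithm being operator monotone, `-tr[ρ log ρ] ≥ -tr[ρ log (1 ⊗ ρ_B)] = S(ρ_B)`
(`neg_sum_log_le_entropy`), so that the conditional entropies are nonnegative. This gives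
`F_β(ρ) ≤ F*`, with equality for the product of an arbitrary state with a pure one.

**Processes.** Because the memory is returned, energy conservation says that the heat is the energy
lost by the system (`HeatProcess.heat_eq`), and subadditivity of the entropy together with the
Gibbs variational principle for the environment says that the free energy of the system does not
increase (`HeatProcess.freeEnergy_final_le`). At a zero `x` of `f(·, F*)` the heat bound equals
`E(ρ) - E(γ(x))` (`heatBound_eq`). If `ρ` is separable, the final state `σ` of the system satisfies
`F_β(σ) ≤ F* = F_β(γ(x))`, and comparing `σ` with `γ(x)` through the variational principle at `x`
bounds `E(σ)` by `E(γ(x))`, from above if `x ≤ β` and from below if `x ≥ β`. Zeros exist by the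
intermediate value theorem: `F_β(γ(β)) ≤ F*`, as the product of the marginals shows, while
`F_β(γ(x))` tends to the free energies of the extreme levels as `x → ±∞`.

**Pure entangled states.** Such a state has entropy zero and mixed marginals, so `F* < F_β(ρ)`, and
also `F_β(γ(β)) < F*`, which makes `E(γ(·))` strictly monotone. It suffices to bring the system
close to `γ(y)` in energy for some `y` slightly beyond `x` with `F_β(γ(y)) < F_β(ρ)`
(`exists_heatProcess_near`). For `n` copies of `ρ` this is done by a single reflection that
exchanges the components of `ψ^{⊗n}` of definite letter count with the levels of an environment
(`partialSwap`). The environment has one level for each word of typical energy for `γ(y)` and one for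
each typical letter count of `ψ`. The second group is thermally empty: the ratio of the partition
sums is `exp(-nβ(F_β(ρ) - F_β(γ(y))))` up to factors that are polynomial in `n` or `exp(O(nδ))`,
where `δ` is the width of the typical energies. Hence the environment nearly always gains the energy
difference, up to `2δ` per copy, by Chebyshev's inequality (`exists_heatProcess_le`).

To turn this collective protocol into a process for a single copy with a memory that is returned
*exactly*, the memory consists of `n` slots and a clock: each run exchanges the system with the slot
shown by the clock, and the collective unitary acts when the clock wraps around. The uniform mixture
over the clock of the successive slot states is invariant, and the heat is that of the collective
protocol divided by `n` (`exists_heatProcess_of_collective`).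
-/

set_option linter.unusedSectionVars false

namespace HeatWitness

/-! ### Unitary diagonalization and entropy -/

section Diagonalization

variable {n : Type*} [Fintype n] [DecidableEq n]

/-- The matrix with eigenvectors the columns of `W` and real eigenvalues `e`; `W` is meant to be
unitary. -/
def spectralMatrix (W : Matrix n n ℂ) (e : n → ℝ) : Matrix n n ℂ :=
  W * Matrix.diagonal (fun i => (e i : ℂ)) * Wᴴ

theorem unitary_mul_conjTranspose {W : Matrix n n ℂ} (hW : W ∈ Matrix.unitaryGroup n ℂ) :
    W * Wᴴ = 1 := by
  simpa [Matrix.star_eq_conjTranspose] using Matrix.mem_unitaryGroup_iff.1 hW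

theorem unitary_conjTranspose_mul {W : Matrix n n ℂ} (hW : W ∈ Matrix.unitaryGroup n ℂ) :
    Wᴴ * W = 1 := by
  simpa [Matrix.star_eq_conjTranspose] using Matrix.mem_unitaryGroup_iff'.1 hW

theorem mem_unitary_of_mul {W : Matrix n n ℂ} (h : W * Wᴴ = 1) :
    W ∈ Matrix.unitaryGroup n ℂ := by
  rw [Matrix.mem_unitaryGroup_iff, Matrix.star_eq_conjTranspose, h]

theorem isHermitian_eq_spectralMatrix {ρ : Matrix n n ℂ} (h : ρ.IsHermitian) :
    ρ = spectralMatrix (h.eigenvectorUnitary : Matrix n n ℂ) h.eigenvalues := by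
  conv_lhs => rw [h.spectral_theorem, Unitary.conjStarAlgAut_apply]
  rfl

theorem exists_spectralMatrix {H : Matrix n n ℂ} (hH : H.IsHermitian) :
    ∃ W ∈ Matrix.unitaryGroup n ℂ, ∃ e : n → ℝ, H = spectralMatrix W e := by
  refine ⟨hH.eigenvectorUnitary, hH.eigenvectorUnitary.2, hH.eigenvalues, ?_⟩
  exact isHermitian_eq_spectralMatrix hH

theorem spectralMatrix_isHermitian (W : Matrix n n ℂ) (e : n → ℝ) :
    (spectralMatrix W e).IsHermitian := by
  have : (Matrix.diagonal fun i => (e i : ℂ)).IsHermitian := by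
    rw [Matrix.isHermitian_diagonal_iff]
    intro i
    simp [isSelfAdjoint_iff]
  exact Matrix.isHermitian_mul_mul_conjTranspose W this

theorem trace_spectralMatrix_mul (W : Matrix n n ℂ) (e : n → ℝ) (X : Matrix n n ℂ) :
    (spectralMatrix W e * X).trace = ∑ i, (e i : ℂ) * (Wᴴ * X * W) i i := by
  rw [spectralMatrix, Matrix.mul_assoc, Matrix.mul_assoc, Matrix.trace_mul_comm, Matrix.mul_assoc,
    Matrix.trace]
  simp [Matrix.diagonal_mul]

theorem trace_spectralMatrix {W : Matrix n n ℂ} (hW : W ∈ Matrix.unitaryGroup n ℂ) (e : n → ℝ) :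
    (spectralMatrix W e).trace = ∑ i, (e i : ℂ) := by
  have := trace_spectralMatrix_mul W e 1
  simpa [unitary_conjTranspose_mul hW] using this

open Polynomial in
/-- Mathlib's eigenvalues agree with `e` up to order, since both are the roots of the characteristic
polynomial. -/
theorem map_eigenvalues_spectralMatrix {W : Matrix n n ℂ} (hW : W ∈ Matrix.unitaryGroup n ℂ)
    (e : n → ℝ) (h : (spectralMatrix W e).IsHermitian) :
    Multiset.map h.eigenvalues Finset.univ.val = Multiset.map e Finset.univ.val := by
  have h1 := h.roots_charpoly_eq_eigenvalues
  have h2 : (spectralMatrix W e).charpoly = ∏ i, (X - C (e i : ℂ)) := by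
    rw [spectralMatrix, Matrix.charpoly_mul_comm, ← mul_assoc, unitary_conjTranspose_mul hW,
      one_mul, Matrix.charpoly_diagonal]
  rw [h2, Polynomial.roots_prod _ _ (by
    simp [Finset.prod_ne_zero_iff, Polynomial.X_sub_C_ne_zero])] at h1
  simp only [roots_X_sub_C, Multiset.bind_singleton] at h1
  have h3 := congrArg (Multiset.map Complex.re) h1
  simpa [Multiset.map_map, Function.comp_def] using h3.symm

theorem sum_eigenvalues_spectralMatrix {W : Matrix n n ℂ} (hW : W ∈ Matrix.unitaryGroup n ℂ)
    (e : n → ℝ) (h : (spectralMatrix W e).IsHermitian) (f : ℝ → ℝ) :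
    ∑ i, f (h.eigenvalues i) = ∑ i, f (e i) := by
  have := congrArg (fun s => (Multiset.map f s).sum) (map_eigenvalues_spectralMatrix hW e h)
  simpa [Multiset.map_map, Function.comp_def] using this

theorem cfc_isHermitian (f : ℝ → ℝ) {ρ : Matrix n n ℂ} (h : ρ.IsHermitian) :
    cfc f ρ =
      spectralMatrix (h.eigenvectorUnitary : Matrix n n ℂ) (fun i => f (h.eigenvalues i)) := by
  rw [h.cfc_eq, Matrix.IsHermitian.cfc, Unitary.conjStarAlgAut_apply]
  rfl

theorem spectralMatrix_mul_spectralMatrix {W : Matrix n n ℂ}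
    (hW : W ∈ Matrix.unitaryGroup n ℂ) (e f : n → ℝ) :
    spectralMatrix W e * spectralMatrix W f = spectralMatrix W (fun i => e i * f i) := by
  simp only [spectralMatrix]
  set D := Matrix.diagonal (fun i => (e i : ℂ))
  set D' := Matrix.diagonal (fun i => (f i : ℂ))
  rw [show W * D * Wᴴ * (W * D' * Wᴴ) = W * D * (Wᴴ * W) * D' * Wᴴ by
    simp only [Matrix.mul_assoc], unitary_conjTranspose_mul hW, Matrix.mul_one,
    Matrix.mul_assoc W, Matrix.diagonal_mul_diagonal]
  simp

theorem entropy_eq_sum_eigenvalues {ρ : Matrix n n ℂ} (h : ρ.IsHermitian) :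
    entropy ρ = ∑ i, Real.negMulLog (h.eigenvalues i) := by
  rw [entropy, cfc_isHermitian _ h]
  nth_rewrite 1 [isHermitian_eq_spectralMatrix h]
  rw [spectralMatrix_mul_spectralMatrix h.eigenvectorUnitary.2,
    trace_spectralMatrix h.eigenvectorUnitary.2, ← Complex.ofReal_sum, Complex.ofReal_re,
    ← Finset.sum_neg_distrib]
  simp [Real.negMulLog]

theorem entropy_spectralMatrix {W : Matrix n n ℂ} (hW : W ∈ Matrix.unitaryGroup n ℂ)
    (p : n → ℝ) : entropy (spectralMatrix W p) = ∑ i, Real.negMulLog (p i) := by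
  rw [entropy_eq_sum_eigenvalues (spectralMatrix_isHermitian W p)]
  exact sum_eigenvalues_spectralMatrix hW p _ _

theorem IsState.isHermitian {ρ : Matrix n n ℂ} (h : IsState ρ) : ρ.IsHermitian := h.1.isHermitian

theorem IsState.exists_spectralMatrix {ρ : Matrix n n ℂ} (h : IsState ρ) :
    ∃ W ∈ Matrix.unitaryGroup n ℂ, ∃ p : n → ℝ, (∀ i, 0 ≤ p i) ∧ ∑ i, p i = 1 ∧
      ρ = spectralMatrix W p := by
  refine ⟨h.isHermitian.eigenvectorUnitary, h.isHermitian.eigenvectorUnitary.2,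
    h.isHermitian.eigenvalues, h.1.eigenvalues_nonneg, ?_, isHermitian_eq_spectralMatrix _⟩
  have h2 := h.2
  rw [h.isHermitian.trace_eq_sum_eigenvalues] at h2
  have := congrArg Complex.re h2
  simpa using this

theorem IsState.nonempty {ρ : Matrix n n ℂ} (h : IsState ρ) : Nonempty n := by
  by_contra hn
  rw [not_nonempty_iff] at hn
  have := h.2
  simp [Matrix.trace] at this

theorem spectralMatrix_posSemidef (W : Matrix n n ℂ) {e : n → ℝ} (he : ∀ i, 0 ≤ e i) :
    (spectralMatrix W e).PosSemidef := by
  have : (Matrix.diagonal fun i => (e i : ℂ)).PosSemidef :=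
    Matrix.posSemidef_diagonal_iff.2 fun i => by exact_mod_cast he i
  exact this.mul_mul_conjTranspose_same W

theorem spectralMatrix_isState {W : Matrix n n ℂ} (hW : W ∈ Matrix.unitaryGroup n ℂ)
    {p : n → ℝ} (hp : ∀ i, 0 ≤ p i) (h1 : ∑ i, p i = 1) : IsState (spectralMatrix W p) := by
  refine ⟨spectralMatrix_posSemidef W hp, ?_⟩
  rw [trace_spectralMatrix hW, ← Complex.ofReal_sum, h1, Complex.ofReal_one]

theorem sum_normSq_row {X : Matrix n n ℂ} (hX : X ∈ Matrix.unitaryGroup n ℂ) (i : n) :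
    ∑ j, Complex.normSq (X i j) = 1 := by
  have := congrFun (congrFun (unitary_mul_conjTranspose hX) i) i
  simp only [Matrix.mul_apply, Matrix.conjTranspose_apply, Matrix.one_apply_eq] at this
  have h2 := congrArg Complex.re this
  simpa [Complex.normSq_apply] using h2

theorem sum_normSq_col {X : Matrix n n ℂ} (hX : X ∈ Matrix.unitaryGroup n ℂ) (j : n) :
    ∑ i, Complex.normSq (X i j) = 1 := by
  have := congrFun (congrFun (unitary_conjTranspose_mul hX) j) j
  simp only [Matrix.mul_apply, Matrix.conjTranspose_apply, Matrix.one_apply_eq] at this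
  have h2 := congrArg Complex.re this
  simpa [Complex.normSq_apply] using h2

theorem conjTranspose_mem_unitary {W : Matrix n n ℂ} (hW : W ∈ Matrix.unitaryGroup n ℂ) :
    Wᴴ ∈ Matrix.unitaryGroup n ℂ := by
  apply mem_unitary_of_mul
  rw [Matrix.conjTranspose_conjTranspose, unitary_conjTranspose_mul hW]

theorem conj_spectralMatrix (U W : Matrix n n ℂ) (e : n → ℝ) :
    U * spectralMatrix W e * Uᴴ = spectralMatrix (U * W) e := by
  simp [spectralMatrix, Matrix.mul_assoc]

theorem spectralMatrix_apply_diag (X : Matrix n n ℂ) (p : n → ℝ) (j : n) :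
    (spectralMatrix X p) j j = ((∑ i, Complex.normSq (X j i) * p i : ℝ) : ℂ) := by
  rw [spectralMatrix, Matrix.mul_apply]
  simp only [Matrix.mul_diagonal, Matrix.conjTranspose_apply]
  push_cast
  refine Finset.sum_congr rfl fun i _ => ?_
  rw [Complex.normSq_eq_conj_mul_self, mul_right_comm, mul_comm (X j i)]
  rfl

theorem entropy_unitary_conj {U : Matrix n n ℂ} (hU : U ∈ Matrix.unitaryGroup n ℂ)
    {ρ : Matrix n n ℂ} (hρ : ρ.IsHermitian) : entropy (U * ρ * Uᴴ) = entropy ρ := by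
  obtain ⟨W, hW, e, rfl⟩ := HeatWitness.exists_spectralMatrix hρ
  rw [conj_spectralMatrix, entropy_spectralMatrix (mul_mem hU hW), entropy_spectralMatrix hW]

/-- Dephasing in any orthonormal basis does not decrease the entropy: the diagonal of `ρ` in the
basis `W` arises from the spectrum by a doubly stochastic matrix, and `-x log x` is concave. -/
theorem entropy_le_sum_diag {ρ : Matrix n n ℂ} (hρ : IsState ρ) {W : Matrix n n ℂ}
    (hW : W ∈ Matrix.unitaryGroup n ℂ) :
    entropy ρ ≤ ∑ j, Real.negMulLog ((Wᴴ * ρ * W) j j).re := by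
  obtain ⟨V, hV, p, hp, -, rfl⟩ := hρ.exists_spectralMatrix
  have hX : Wᴴ * V ∈ Matrix.unitaryGroup n ℂ := mul_mem (conjTranspose_mem_unitary hW) hV
  have e1 : Wᴴ * spectralMatrix V p * W = spectralMatrix (Wᴴ * V) p := by
    simpa using conj_spectralMatrix Wᴴ V p
  rw [e1, entropy_spectralMatrix hV]
  have key : ∀ j, ∑ i, Complex.normSq ((Wᴴ * V) j i) * Real.negMulLog (p i) ≤
      Real.negMulLog ((spectralMatrix (Wᴴ * V) p) j j).re := by
    intro j
    rw [spectralMatrix_apply_diag, Complex.ofReal_re]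
    exact Real.concaveOn_negMulLog.le_map_sum (fun i _ => Complex.normSq_nonneg _)
      (sum_normSq_row hX j) (fun i _ => hp i)
  calc ∑ i, Real.negMulLog (p i)
      = ∑ i, (∑ j, Complex.normSq ((Wᴴ * V) j i)) * Real.negMulLog (p i) := by
        simp [sum_normSq_col hX]
    _ = ∑ j, ∑ i, Complex.normSq ((Wᴴ * V) j i) * Real.negMulLog (p i) := by
        simp_rw [Finset.sum_mul]
        exact Finset.sum_comm
    _ ≤ _ := Finset.sum_le_sum fun j _ => key j

theorem IsState.conj {ρ : Matrix n n ℂ} (hρ : IsState ρ) {U : Matrix n n ℂ}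
    (hU : U ∈ Matrix.unitaryGroup n ℂ) : IsState (U * ρ * Uᴴ) := by
  refine ⟨hρ.1.mul_mul_conjTranspose_same U, ?_⟩
  rw [Matrix.trace_mul_comm, ← Matrix.mul_assoc, unitary_conjTranspose_mul hU, Matrix.one_mul, hρ.2]

theorem IsState.conj' {ρ : Matrix n n ℂ} (hρ : IsState ρ) {U : Matrix n n ℂ}
    (hU : U ∈ Matrix.unitaryGroup n ℂ) : IsState (Uᴴ * ρ * U) := by
  simpa using hρ.conj (conjTranspose_mem_unitary hU)

theorem IsState.diag_nonneg {ρ : Matrix n n ℂ} (hρ : IsState ρ) (i : n) : 0 ≤ (ρ i i).re := by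
  have := hρ.1.diag_nonneg (i := i)
  exact (Complex.le_def.1 this).1

theorem IsState.sum_diag {ρ : Matrix n n ℂ} (hρ : IsState ρ) : ∑ i, (ρ i i).re = 1 := by
  have := congrArg Complex.re hρ.2
  simpa [Matrix.trace] using this

theorem entropy_nonneg {ρ : Matrix n n ℂ} (hρ : IsState ρ) : 0 ≤ entropy ρ := by
  obtain ⟨V, hV, p, hp, h1, rfl⟩ := hρ.exists_spectralMatrix
  rw [entropy_spectralMatrix hV]
  refine Finset.sum_nonneg fun i _ => Real.negMulLog_nonneg (hp i) ?_
  rw [← h1]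
  exact Finset.single_le_sum (fun j _ => hp j) (Finset.mem_univ i)

theorem energy_spectralMatrix (ρ W : Matrix n n ℂ) (e : n → ℝ) :
    energy (spectralMatrix W e) ρ = ∑ i, e i * ((Wᴴ * ρ * W) i i).re := by
  rw [energy, Matrix.trace_mul_comm, trace_spectralMatrix_mul]
  simp

end Diagonalization

/-! ### Partial traces -/

section PartialTrace

variable {m n : Type*} [Fintype m] [DecidableEq m] [Fintype n] [DecidableEq n]

theorem trace_traceRight (ρ : Matrix (m × n) (m × n) ℂ) : (traceRight ρ).trace = ρ.trace := by
  simp [Matrix.trace, traceRight, Fintype.sum_prod_type]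

theorem trace_traceLeft (ρ : Matrix (m × n) (m × n) ℂ) : (traceLeft ρ).trace = ρ.trace := by
  simp [Matrix.trace, traceLeft, Fintype.sum_prod_type_right]

theorem traceRight_posSemidef {ρ : Matrix (m × n) (m × n) ℂ} (h : ρ.PosSemidef) :
    (traceRight ρ).PosSemidef := by
  have : traceRight ρ = ∑ k, ρ.submatrix (fun i => (i, k)) (fun i => (i, k)) := by
    ext i j
    simp [traceRight, Matrix.sum_apply]
  rw [this]
  exact Matrix.posSemidef_sum _ fun k _ => h.submatrix _

theorem traceLeft_posSemidef {ρ : Matrix (m × n) (m × n) ℂ} (h : ρ.PosSemidef) :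
    (traceLeft ρ).PosSemidef := by
  have : traceLeft ρ = ∑ k, ρ.submatrix (fun i => (k, i)) (fun i => (k, i)) := by
    ext i j
    simp [traceLeft, Matrix.sum_apply]
  rw [this]
  exact Matrix.posSemidef_sum _ fun k _ => h.submatrix _

theorem IsState.traceRight {ρ : Matrix (m × n) (m × n) ℂ} (h : IsState ρ) :
    IsState (traceRight ρ) :=
  ⟨traceRight_posSemidef h.1, by rw [trace_traceRight, h.2]⟩

theorem IsState.traceLeft {ρ : Matrix (m × n) (m × n) ℂ} (h : IsState ρ) :
    IsState (traceLeft ρ) :=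
  ⟨traceLeft_posSemidef h.1, by rw [trace_traceLeft, h.2]⟩

theorem IsState.kronecker {σ : Matrix m m ℂ} {τ : Matrix n n ℂ} (hσ : IsState σ)
    (hτ : IsState τ) : IsState (σ ⊗ₖ τ) :=
  ⟨hσ.1.kronecker hτ.1, by rw [Matrix.trace_kronecker, hσ.2, hτ.2, one_mul]⟩

theorem traceRight_kronecker (σ : Matrix m m ℂ) (τ : Matrix n n ℂ) :
    traceRight (σ ⊗ₖ τ) = τ.trace • σ := by
  ext i j
  simp [traceRight, Matrix.trace, ← Finset.mul_sum, mul_comm]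

theorem traceLeft_kronecker (σ : Matrix m m ℂ) (τ : Matrix n n ℂ) :
    traceLeft (σ ⊗ₖ τ) = σ.trace • τ := by
  ext i j
  simp [traceLeft, Matrix.trace, ← Finset.sum_mul]

theorem trace_mul_kronecker_one (ρ : Matrix (m × n) (m × n) ℂ) (X : Matrix m m ℂ) :
    (ρ * (X ⊗ₖ (1 : Matrix n n ℂ))).trace = (traceRight ρ * X).trace := by
  simp only [Matrix.trace, Matrix.diag_apply, Matrix.mul_apply, traceRight, Matrix.of_apply,
    Fintype.sum_prod_type, Matrix.kroneckerMap_apply, Matrix.one_apply, mul_ite, mul_one, mul_zero,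
    Finset.sum_ite_eq', Finset.mem_univ, if_true, Finset.sum_mul]
  exact Finset.sum_congr rfl fun i _ => Finset.sum_comm

theorem trace_mul_one_kronecker (ρ : Matrix (m × n) (m × n) ℂ) (X : Matrix n n ℂ) :
    (ρ * ((1 : Matrix m m ℂ) ⊗ₖ X)).trace = (traceLeft ρ * X).trace := by
  simp only [Matrix.trace, Matrix.diag_apply, Matrix.mul_apply, traceLeft, Matrix.of_apply,
    Fintype.sum_prod_type, Matrix.kroneckerMap_apply, Matrix.one_apply, ite_mul, one_mul, zero_mul,
    Finset.sum_mul]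
  have : ∀ (x : m) (y : n), (∑ x' : m, ∑ y' : n,
      ρ (x, y) (x', y') * (if x' = x then X y' y else 0)) = ∑ y', ρ (x, y) (x, y') * X y' y := by
    intro x y
    rw [Finset.sum_comm]
    simp
  simp only [this]
  rw [Finset.sum_comm]
  exact Finset.sum_congr rfl fun i _ => Finset.sum_comm

theorem traceRight_mul_mul (ρ : Matrix (m × n) (m × n) ℂ) (A C : Matrix m m ℂ)
    (B D : Matrix n n ℂ) (h : D * B = 1) :
    traceRight ((A ⊗ₖ B) * ρ * (C ⊗ₖ D)) = A * traceRight ρ * C := by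
  rw [Matrix.ext_iff_trace_mul_right]
  intro Y
  rw [← trace_mul_kronecker_one, Matrix.mul_assoc, ← Matrix.mul_kronecker_mul, Matrix.mul_one,
    Matrix.mul_assoc, Matrix.trace_mul_comm, Matrix.mul_assoc, ← Matrix.mul_kronecker_mul, h,
    trace_mul_kronecker_one, Matrix.mul_assoc A, Matrix.mul_assoc A, Matrix.trace_mul_comm A]
  simp only [Matrix.mul_assoc]

theorem traceLeft_mul_mul (ρ : Matrix (m × n) (m × n) ℂ) (A C : Matrix m m ℂ)
    (B D : Matrix n n ℂ) (h : C * A = 1) :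
    traceLeft ((A ⊗ₖ B) * ρ * (C ⊗ₖ D)) = B * traceLeft ρ * D := by
  rw [Matrix.ext_iff_trace_mul_right]
  intro Y
  rw [← trace_mul_one_kronecker, Matrix.mul_assoc, ← Matrix.mul_kronecker_mul, Matrix.mul_one,
    Matrix.mul_assoc, Matrix.trace_mul_comm, Matrix.mul_assoc, ← Matrix.mul_kronecker_mul, h,
    trace_mul_one_kronecker, Matrix.mul_assoc B, Matrix.mul_assoc B, Matrix.trace_mul_comm B]
  simp only [Matrix.mul_assoc]

theorem energy_totalH (H₁ : Matrix m m ℂ) (H₂ : Matrix n n ℂ) (ρ : Matrix (m × n) (m × n) ℂ) :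
    energy (totalH H₁ H₂) ρ = energy H₁ (traceRight ρ) + energy H₂ (traceLeft ρ) := by
  rw [energy, totalH, Matrix.mul_add, Matrix.trace_add, trace_mul_kronecker_one,
    trace_mul_one_kronecker, Complex.add_re, energy, energy]

theorem totalH_isHermitian {H₁ : Matrix m m ℂ} {H₂ : Matrix n n ℂ} (h₁ : H₁.IsHermitian)
    (h₂ : H₂.IsHermitian) : (totalH H₁ H₂).IsHermitian := by
  have h1 : (H₁ ⊗ₖ (1 : Matrix n n ℂ)).IsHermitian := by
    rw [Matrix.IsHermitian, Matrix.conjTranspose_kronecker, h₁.eq, Matrix.conjTranspose_one]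
  have h2 : ((1 : Matrix m m ℂ) ⊗ₖ H₂).IsHermitian := by
    rw [Matrix.IsHermitian, Matrix.conjTranspose_kronecker, h₂.eq, Matrix.conjTranspose_one]
  exact h1.add h2

theorem kronecker_mem_unitary {U : Matrix m m ℂ} {V : Matrix n n ℂ}
    (hU : U ∈ Matrix.unitaryGroup m ℂ) (hV : V ∈ Matrix.unitaryGroup n ℂ) :
    U ⊗ₖ V ∈ Matrix.unitaryGroup (m × n) ℂ := by
  apply mem_unitary_of_mul
  rw [Matrix.conjTranspose_kronecker, ← Matrix.mul_kronecker_mul, unitary_mul_conjTranspose hU,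
    unitary_mul_conjTranspose hV, Matrix.one_kronecker_one]

theorem spectralMatrix_kronecker (U : Matrix m m ℂ) (V : Matrix n n ℂ) (p : m → ℝ) (q : n → ℝ) :
    spectralMatrix U p ⊗ₖ spectralMatrix V q =
      spectralMatrix (U ⊗ₖ V) (fun i => p i.1 * q i.2) := by
  simp only [spectralMatrix, Matrix.mul_kronecker_mul, Matrix.conjTranspose_kronecker,
    Matrix.diagonal_kronecker_diagonal, Complex.ofReal_mul]

end PartialTrace

/-! ### Subadditivity of the entropy and the Gibbs variational principle -/

section Entropy

variable {m n : Type*} [Fintype m] [DecidableEq m] [Fintype n] [DecidableEq n]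

/-- The scalar inequality behind the positivity of the relative entropy. -/
theorem negMulLog_le_neg_mul_log {p q : ℝ} (hp : 0 ≤ p) (hq : 0 ≤ q) (h : q = 0 → p = 0) :
    Real.negMulLog p ≤ -(p * Real.log q) + (q - p) := by
  rcases hp.eq_or_lt with rfl | hp
  · simpa using hq
  · have hq' : 0 < q := lt_of_le_of_ne hq fun h0 => hp.ne' (h h0.symm)
    have h1 := Real.log_le_sub_one_of_pos (div_pos hq' hp)
    rw [Real.log_div hq'.ne' hp.ne'] at h1
    have h2 := mul_le_mul_of_nonneg_left h1 hp.le
    have h3 : p * (q / p - 1) = q - p := by field_simp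
    rw [Real.negMulLog]
    nlinarith

/-- Subadditivity of the Shannon entropy. -/
theorem sum_negMulLog_prod_le {r : m × n → ℝ} (hr : ∀ i, 0 ≤ r i) (h1 : ∑ i, r i = 1) :
    ∑ i, Real.negMulLog (r i) ≤ ∑ i, Real.negMulLog (∑ j, r (i, j)) +
      ∑ j, Real.negMulLog (∑ i, r (i, j)) := by
  set a : m → ℝ := fun i => ∑ j, r (i, j) with ha
  set b : n → ℝ := fun j => ∑ i, r (i, j) with hb
  have ha0 : ∀ i, 0 ≤ a i := fun i => Finset.sum_nonneg fun j _ => hr _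
  have hb0 : ∀ j, 0 ≤ b j := fun j => Finset.sum_nonneg fun i _ => hr _
  have hra : ∀ i j, a i = 0 → r (i, j) = 0 := fun i j h =>
    (Finset.sum_eq_zero_iff_of_nonneg fun j _ => hr (i, j)).1 h j (Finset.mem_univ j)
  have hrb : ∀ i j, b j = 0 → r (i, j) = 0 := fun i j h =>
    (Finset.sum_eq_zero_iff_of_nonneg fun i _ => hr (i, j)).1 h i (Finset.mem_univ i)
  have hsa : ∑ i, a i = 1 := by rw [← h1, Fintype.sum_prod_type]
  have hsb : ∑ j, b j = 1 := by rw [← h1, Fintype.sum_prod_type_right]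
  have key : ∀ i j, Real.negMulLog (r (i, j)) ≤
      -(r (i, j) * Real.log (a i)) + -(r (i, j) * Real.log (b j)) + (a i * b j - r (i, j)) := by
    intro i j
    have h := negMulLog_le_neg_mul_log (hr (i, j)) (mul_nonneg (ha0 i) (hb0 j)) (by
      intro h
      rcases mul_eq_zero.1 h with h | h
      · exact hra i j h
      · exact hrb i j h)
    by_cases h0 : a i = 0 ∨ b j = 0
    · have : r (i, j) = 0 := h0.elim (hra i j) (hrb i j)
      rw [this] at h ⊢
      simpa using h
    · push Not at h0
      rw [Real.log_mul h0.1 h0.2] at h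
      linarith
  calc ∑ i, Real.negMulLog (r i) = ∑ i, ∑ j, Real.negMulLog (r (i, j)) := Fintype.sum_prod_type _
    _ ≤ ∑ i, ∑ j, (-(r (i, j) * Real.log (a i)) + -(r (i, j) * Real.log (b j))
          + (a i * b j - r (i, j))) :=
        Finset.sum_le_sum fun i _ => Finset.sum_le_sum fun j _ => key i j
    _ = ∑ i, ∑ j, -(r (i, j) * Real.log (a i)) + ∑ j, ∑ i, -(r (i, j) * Real.log (b j))
          + ((∑ i, a i) * (∑ j, b j) - ∑ i, r i) := by
        simp only [Finset.sum_add_distrib, Finset.sum_sub_distrib, Fintype.sum_prod_type,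
          Finset.sum_mul_sum]
        rw [Finset.sum_comm (f := fun j i => -(r (i, j) * Real.log (b j)))]
    _ = _ := by
        rw [hsa, hsb, h1]
        simp only [Finset.sum_neg_distrib, ← Finset.sum_mul, Real.negMulLog, ha, hb, neg_mul]
        ring

/-- Subadditivity of the von Neumann entropy. In the product of the eigenbases of the marginals
the diagonal of `ρ` is a joint distribution of the two spectra, so that dephasing reduces the claim
to the classical one. -/
theorem entropy_le_add {ρ : Matrix (m × n) (m × n) ℂ} (hρ : IsState ρ) :
    entropy ρ ≤ entropy (traceRight ρ) + entropy (traceLeft ρ) := by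
  obtain ⟨U, hU, p, -, -, hp⟩ := hρ.traceRight.exists_spectralMatrix
  obtain ⟨V, hV, q, -, -, hq⟩ := hρ.traceLeft.exists_spectralMatrix
  have hW := kronecker_mem_unitary hU hV
  set r : m × n → ℝ := fun i => (((U ⊗ₖ V)ᴴ * ρ * (U ⊗ₖ V)) i i).re with hr
  have hst := hρ.conj' hW
  have e1 : ∀ i, ∑ j, r (i, j) = p i := by
    intro i
    have h := traceRight_mul_mul ρ Uᴴ U Vᴴ V (unitary_mul_conjTranspose hV)
    rw [hp, spectralMatrix] at h
    rw [show Uᴴ * (U * Matrix.diagonal (fun i => (p i : ℂ)) * Uᴴ) * U =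
      (Uᴴ * U) * Matrix.diagonal (fun i => (p i : ℂ)) * (Uᴴ * U) by simp only [Matrix.mul_assoc],
      unitary_conjTranspose_mul hU, ← Matrix.conjTranspose_kronecker] at h
    have h2 := congrArg Complex.re (congrFun (congrFun h i) i)
    simpa [traceRight, hr] using h2
  have e2 : ∀ j, ∑ i, r (i, j) = q j := by
    intro j
    have h := traceLeft_mul_mul ρ Uᴴ U Vᴴ V (unitary_mul_conjTranspose hU)
    rw [hq, spectralMatrix] at h
    rw [show Vᴴ * (V * Matrix.diagonal (fun i => (q i : ℂ)) * Vᴴ) * V =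
      (Vᴴ * V) * Matrix.diagonal (fun i => (q i : ℂ)) * (Vᴴ * V) by simp only [Matrix.mul_assoc],
      unitary_conjTranspose_mul hV, ← Matrix.conjTranspose_kronecker] at h
    have h2 := congrArg Complex.re (congrFun (congrFun h j) j)
    simpa [traceLeft, hr] using h2
  have h := sum_negMulLog_prod_le (fun i => hst.diag_nonneg i) hst.sum_diag
  rw [hp, hq, entropy_spectralMatrix hU, entropy_spectralMatrix hV]
  simp only [← e1, ← e2]
  exact (entropy_le_sum_diag hρ hW).trans h

theorem entropy_kronecker {σ : Matrix m m ℂ} {τ : Matrix n n ℂ} (hσ : IsState σ)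
    (hτ : IsState τ) : entropy (σ ⊗ₖ τ) = entropy σ + entropy τ := by
  obtain ⟨U, hU, p, hp0, hp, rfl⟩ := hσ.exists_spectralMatrix
  obtain ⟨V, hV, q, hq0, hq, rfl⟩ := hτ.exists_spectralMatrix
  rw [spectralMatrix_kronecker, entropy_spectralMatrix (kronecker_mem_unitary hU hV),
    entropy_spectralMatrix hU, entropy_spectralMatrix hV, Fintype.sum_prod_type]
  simp only [Real.negMulLog_mul, Finset.sum_add_distrib]
  simp only [← Finset.sum_mul, ← Finset.mul_sum, hp, hq, one_mul]

/-- Partition function of a classical spectrum. -/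
noncomputable def partition (e : n → ℝ) (x : ℝ) : ℝ := ∑ i, Real.exp (-x * e i)

/-- Gibbs probabilities of a classical spectrum. -/
noncomputable def gibbsProb (e : n → ℝ) (x : ℝ) (i : n) : ℝ := Real.exp (-x * e i) / partition e x

variable (e : n → ℝ) (x : ℝ)

theorem partition_pos [Nonempty n] : 0 < partition e x :=
  Finset.sum_pos (fun _ _ => Real.exp_pos _) Finset.univ_nonempty

theorem gibbsProb_nonneg (i : n) : 0 ≤ gibbsProb e x i :=
  div_nonneg (Real.exp_pos _).le (Finset.sum_nonneg fun _ _ => (Real.exp_pos _).le)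

theorem gibbsProb_pos [Nonempty n] (i : n) : 0 < gibbsProb e x i :=
  div_pos (Real.exp_pos _) (partition_pos e x)

theorem sum_gibbsProb [Nonempty n] : ∑ i, gibbsProb e x i = 1 := by
  simp only [gibbsProb, ← Finset.sum_div]
  exact div_self (partition_pos e x).ne'

theorem log_gibbsProb [Nonempty n] (i : n) :
    Real.log (gibbsProb e x i) = -x * e i - Real.log (partition e x) := by
  rw [gibbsProb, Real.log_div (Real.exp_pos _).ne' (partition_pos e x).ne', Real.log_exp]

theorem sum_negMulLog_gibbsProb [Nonempty n] :
    ∑ i, Real.negMulLog (gibbsProb e x i) =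
      x * ∑ i, e i * gibbsProb e x i + Real.log (partition e x) := by
  have : ∀ i, Real.negMulLog (gibbsProb e x i) =
      x * (e i * gibbsProb e x i) + gibbsProb e x i * Real.log (partition e x) := by
    intro i
    rw [Real.negMulLog, log_gibbsProb]
    ring
  simp only [this, Finset.sum_add_distrib, ← Finset.mul_sum, ← Finset.sum_mul, sum_gibbsProb,
    one_mul]

/-- The Gibbs variational principle for probability vectors. -/
theorem sum_negMulLog_le [Nonempty n] {r : n → ℝ} (hr : ∀ i, 0 ≤ r i) (h1 : ∑ i, r i = 1) :
    ∑ i, Real.negMulLog (r i) ≤ x * ∑ i, e i * r i + Real.log (partition e x) := by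
  have : ∀ i, Real.negMulLog (r i) ≤
      x * (e i * r i) + r i * Real.log (partition e x) + (gibbsProb e x i - r i) := by
    intro i
    refine (negMulLog_le_neg_mul_log (hr i) (gibbsProb_nonneg e x i)
      fun h => absurd h (gibbsProb_pos e x i).ne').trans (le_of_eq ?_)
    rw [log_gibbsProb]
    ring
  refine (Finset.sum_le_sum fun i _ => this i).trans (le_of_eq ?_)
  simp only [Finset.sum_add_distrib, Finset.sum_sub_distrib, ← Finset.mul_sum, ← Finset.sum_mul,
    sum_gibbsProb, h1, one_mul]
  ring

theorem gibbs_spectralMatrix {W : Matrix n n ℂ} (hW : W ∈ Matrix.unitaryGroup n ℂ) :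
    gibbs (spectralMatrix W e) x = spectralMatrix W (gibbsProb e x) := by
  have hinv : W⁻¹ = Wᴴ := Matrix.inv_eq_right_inv (unitary_mul_conjTranspose hW)
  have hunit : IsUnit W := IsUnit.of_mul_eq_one _ (unitary_mul_conjTranspose hW)
  have hexp : NormedSpace.exp (-(x : ℂ) • spectralMatrix W e) =
      spectralMatrix W (fun i => Real.exp (-x * e i)) := by
    have h1 : -(x : ℂ) • spectralMatrix W e =
        W * Matrix.diagonal (fun i => ((-x * e i : ℝ) : ℂ)) * W⁻¹ := by
      rw [hinv, spectralMatrix, ← Matrix.smul_mul, ← Matrix.mul_smul, ← Matrix.diagonal_smul]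
      congr 3
      ext i
      simp
    rw [h1, Matrix.exp_conj _ _ hunit, Matrix.exp_diagonal, hinv, spectralMatrix]
    congr 3
    ext i
    rw [Pi.coe_exp, ← Complex.exp_eq_exp_ℂ, Complex.ofReal_exp]
  rw [gibbs, hexp, trace_spectralMatrix hW, ← Complex.ofReal_sum]
  rw [spectralMatrix, spectralMatrix, ← Matrix.smul_mul, ← Matrix.mul_smul, ← Matrix.diagonal_smul]
  congr 3
  ext i
  simp [gibbsProb, partition, div_eq_inv_mul]

theorem gibbs_isState [Nonempty n] {H : Matrix n n ℂ} (hH : H.IsHermitian) :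
    IsState (gibbs H x) := by
  obtain ⟨W, hW, e, rfl⟩ := exists_spectralMatrix hH
  rw [gibbs_spectralMatrix e x hW]
  exact spectralMatrix_isState hW (gibbsProb_nonneg e x) (sum_gibbsProb e x)

theorem spectralMatrix_conj_self {W : Matrix n n ℂ} (hW : W ∈ Matrix.unitaryGroup n ℂ)
    (p : n → ℝ) : Wᴴ * spectralMatrix W p * W = Matrix.diagonal (fun i => (p i : ℂ)) := by
  rw [spectralMatrix, show Wᴴ * (W * Matrix.diagonal (fun i => (p i : ℂ)) * Wᴴ) * W =
      (Wᴴ * W) * Matrix.diagonal (fun i => (p i : ℂ)) * (Wᴴ * W) by simp only [Matrix.mul_assoc],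
      unitary_conjTranspose_mul hW, Matrix.one_mul, Matrix.mul_one]

theorem energy_gibbs_spectralMatrix {W : Matrix n n ℂ} (hW : W ∈ Matrix.unitaryGroup n ℂ) :
    energy (spectralMatrix W e) (gibbs (spectralMatrix W e) x) = ∑ i, e i * gibbsProb e x i := by
  rw [gibbs_spectralMatrix e x hW, energy_spectralMatrix, spectralMatrix_conj_self hW]
  simp

theorem entropy_gibbs_spectralMatrix {W : Matrix n n ℂ} (hW : W ∈ Matrix.unitaryGroup n ℂ) :
    entropy (gibbs (spectralMatrix W e) x) = ∑ i, Real.negMulLog (gibbsProb e x i) := by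
  rw [gibbs_spectralMatrix e x hW, entropy_spectralMatrix hW]

/-- The Gibbs variational principle, at an arbitrary real inverse temperature. -/
theorem gibbs_variational {H : Matrix n n ℂ} (hH : H.IsHermitian) {ρ : Matrix n n ℂ}
    (hρ : IsState ρ) :
    x * energy H (gibbs H x) - entropy (gibbs H x) ≤ x * energy H ρ - entropy ρ := by
  have := hρ.nonempty
  obtain ⟨W, hW, e, rfl⟩ := exists_spectralMatrix hH
  rw [energy_gibbs_spectralMatrix e x hW, entropy_gibbs_spectralMatrix e x hW,
    sum_negMulLog_gibbsProb, energy_spectralMatrix]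
  have h1 := entropy_le_sum_diag hρ hW
  have h2 := sum_negMulLog_le e x (fun i => (hρ.conj' hW).diag_nonneg i) (hρ.conj' hW).sum_diag
  linarith

end Entropy

/-! ### Conditional entropies of separable states -/

section Separability

variable {m n : Type*} [Fintype m] [DecidableEq m] [Fintype n] [DecidableEq n]

/-- The functional calculus does not depend on the choice of the eigenbasis. -/
theorem spectralMatrix_comp_congr {U V : Matrix n n ℂ} (hU : U ∈ Matrix.unitaryGroup n ℂ)
    (hV : V ∈ Matrix.unitaryGroup n ℂ) {p q : n → ℝ} (h : spectralMatrix U p = spectralMatrix V q)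
    (f : ℝ → ℝ) : spectralMatrix U (fun i => f (p i)) = spectralMatrix V (fun i => f (q i)) := by
  -- the overlap matrix `Vᴴ * U` intertwines the two diagonal matrices, hence also their images
  have h1 : Matrix.diagonal (fun i => (q i : ℂ)) * (Vᴴ * U) =
      (Vᴴ * U) * Matrix.diagonal (fun i => (p i : ℂ)) := by
    have h2 := congrArg (fun X => Vᴴ * X * U) h
    simp only [spectralMatrix] at h2
    rw [show Vᴴ * (U * Matrix.diagonal (fun i => (p i : ℂ)) * Uᴴ) * U =
      Vᴴ * U * Matrix.diagonal (fun i => (p i : ℂ)) * (Uᴴ * U) by simp only [Matrix.mul_assoc],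
      show Vᴴ * (V * Matrix.diagonal (fun i => (q i : ℂ)) * Vᴴ) * U =
      (Vᴴ * V) * Matrix.diagonal (fun i => (q i : ℂ)) * (Vᴴ * U) by simp only [Matrix.mul_assoc],
      unitary_conjTranspose_mul hU, unitary_conjTranspose_mul hV, Matrix.mul_one,
      Matrix.one_mul] at h2
    exact h2.symm
  have h3 : Matrix.diagonal (fun i => (f (q i) : ℂ)) * (Vᴴ * U) =
      (Vᴴ * U) * Matrix.diagonal (fun i => (f (p i) : ℂ)) := by
    ext i j
    have h4 := congrFun (congrFun h1 i) j
    rw [Matrix.diagonal_mul, Matrix.mul_diagonal] at h4 ⊢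
    by_cases h0 : (Vᴴ * U) i j = 0
    · simp [h0]
    · rw [mul_comm] at h4
      have h5 : q i = p j := by exact_mod_cast mul_left_cancel₀ h0 h4
      rw [h5, mul_comm]
  calc spectralMatrix U (fun i => f (p i))
      = (V * Vᴴ) * U * Matrix.diagonal (fun i => (f (p i) : ℂ)) * Uᴴ := by
        rw [unitary_mul_conjTranspose hV, Matrix.one_mul, spectralMatrix]
    _ = V * ((Vᴴ * U) * Matrix.diagonal (fun i => (f (p i) : ℂ))) * Uᴴ := by
        simp only [Matrix.mul_assoc]
    _ = V * Matrix.diagonal (fun i => (f (q i) : ℂ)) * Vᴴ * (U * Uᴴ) := by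
        rw [← h3]
        simp only [Matrix.mul_assoc]
    _ = _ := by rw [unitary_mul_conjTranspose hU, Matrix.mul_one, spectralMatrix]

theorem cfc_spectralMatrix {V : Matrix n n ℂ} (hV : V ∈ Matrix.unitaryGroup n ℂ) (q : n → ℝ)
    (f : ℝ → ℝ) : cfc f (spectralMatrix V q) = spectralMatrix V (fun i => f (q i)) := by
  have h := spectralMatrix_isHermitian V q
  rw [cfc_isHermitian f h]
  exact spectralMatrix_comp_congr h.eigenvectorUnitary.2 hV (isHermitian_eq_spectralMatrix h).symm f

theorem spectralMatrix_add {V : Matrix n n ℂ} (p q : n → ℝ) :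
    spectralMatrix V p + spectralMatrix V q = spectralMatrix V (fun i => p i + q i) := by
  simp only [spectralMatrix, ← Matrix.add_mul, ← Matrix.mul_add, Matrix.diagonal_add,
    Complex.ofReal_add]

theorem spectralMatrix_const {V : Matrix n n ℂ} (hV : V ∈ Matrix.unitaryGroup n ℂ) (c : ℝ) :
    spectralMatrix V (fun _ => c) = (c : ℂ) • (1 : Matrix n n ℂ) := by
  rw [spectralMatrix, show (Matrix.diagonal fun _ : n => (c : ℂ)) = (c : ℂ) • (1 : Matrix n n ℂ) by
    rw [Matrix.smul_one_eq_diagonal], Matrix.mul_smul, Matrix.mul_one, Matrix.smul_mul,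
    unitary_mul_conjTranspose hV]

theorem spectralMatrix_posDef {V : Matrix n n ℂ} (hV : V ∈ Matrix.unitaryGroup n ℂ) {q : n → ℝ}
    (hq : ∀ i, 0 < q i) : (spectralMatrix V q).PosDef := by
  have h1 : (Matrix.diagonal fun i => (q i : ℂ)).PosDef :=
    Matrix.posDef_diagonal_iff.2 fun i => by exact_mod_cast hq i
  have hunit : IsUnit V := IsUnit.of_mul_eq_one _ (unitary_mul_conjTranspose hV)
  rw [(spectralMatrix_posSemidef V fun i => (hq i).le).posDef_iff_isUnit]
  exact (hunit.mul h1.isUnit).mul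
    (IsUnit.of_mul_eq_one _ (unitary_mul_conjTranspose (conjTranspose_mem_unitary hV)))

open scoped Matrix.Norms.L2Operator MatrixOrder in
/-- Operator monotonicity of the logarithm, for matrices in spectral form. -/
theorem spectralMatrix_log_le {U V : Matrix n n ℂ} (hU : U ∈ Matrix.unitaryGroup n ℂ)
    (hV : V ∈ Matrix.unitaryGroup n ℂ) {p q : n → ℝ} (hp : ∀ i, 0 < p i)
    (h : (spectralMatrix V q - spectralMatrix U p).PosSemidef) :
    (spectralMatrix V (fun i => Real.log (q i)) -
      spectralMatrix U (fun i => Real.log (p i))).PosSemidef := by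
  have h1 : spectralMatrix U p ≤ spectralMatrix V q := h
  have h2 : IsStrictlyPositive (spectralMatrix U p) :=
    Matrix.isStrictlyPositive_iff_posDef.2 (spectralMatrix_posDef hU hp)
  have h3 := CFC.log_le_log h1 h2
  rw [CFC.log, CFC.log, cfc_spectralMatrix hU, cfc_spectralMatrix hV] at h3
  exact h3

theorem re_trace_mul_nonneg {ρ X : Matrix n n ℂ} (hρ : ρ.PosSemidef) (hX : X.PosSemidef) :
    0 ≤ (ρ * X).trace.re := by
  have h := isHermitian_eq_spectralMatrix hρ.isHermitian
  rw [h, trace_spectralMatrix_mul, Complex.re_sum]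
  refine Finset.sum_nonneg fun i _ => ?_
  rw [Complex.re_ofReal_mul]
  refine mul_nonneg (hρ.eigenvalues_nonneg i) ?_
  exact (Complex.le_def.1 ((hX.conjTranspose_mul_mul_same _).diag_nonneg (i := i))).1

/-- The condition covers the junk value `Real.log 0 = 0`, where the logarithm is not continuous. -/
theorem tendsto_mul_log_add {r q : ℝ} (h : q = 0 → r = 0) :
    Filter.Tendsto (fun ε : ℝ => r * Real.log (q + ε)) (nhdsWithin 0 (Set.Ioi 0))
      (nhds (r * Real.log q)) := by
  by_cases hq : q = 0
  · simp [h hq]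
  · have : ContinuousAt (fun ε : ℝ => r * Real.log (q + ε)) 0 := by
      refine continuousAt_const.mul (ContinuousAt.log (by fun_prop) (by simpa using hq))
    have h2 := this.tendsto
    simp only [add_zero] at h2
    exact h2.mono_left nhdsWithin_le_nhds

/-- If `ρ ≤ σ` then `S(ρ) ≥ -tr[ρ log σ]`. The logarithm is applied to `ρ + ε` and `σ + ε`, where
it is operator monotone, and then `ε → 0`. -/
theorem neg_sum_log_le_entropy {ρ : Matrix n n ℂ} (hρ : IsState ρ) {V : Matrix n n ℂ}
    (hV : V ∈ Matrix.unitaryGroup n ℂ) {q : n → ℝ}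
    (h : (spectralMatrix V q - ρ).PosSemidef) :
    -∑ j, ((Vᴴ * ρ * V) j j).re * Real.log (q j) ≤ entropy ρ := by
  -- kernel directions of `σ` are kernel directions of `ρ`, which controls the limit of `log`
  have hle : ∀ j, ((Vᴴ * ρ * V) j j).re ≤ q j := by
    intro j
    have h1 := (h.conjTranspose_mul_mul_same V).diag_nonneg (i := j)
    rw [Matrix.mul_sub, Matrix.sub_mul, spectralMatrix_conj_self hV] at h1
    have h2 := (Complex.le_def.1 h1).1
    simpa using h2
  have hr0 := fun j => (hρ.conj' hV).diag_nonneg j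
  obtain ⟨U, hU, p, hp, hp1, hUp⟩ := hρ.exists_spectralMatrix
  have hε : ∀ ε : ℝ, 0 < ε → ∑ i, p i * Real.log (p i + ε) ≤
      ∑ j, ((Vᴴ * ρ * V) j j).re * Real.log (q j + ε) := by
    intro ε hε
    have h1 : (spectralMatrix V (fun i => q i + ε) -
        spectralMatrix U (fun i => p i + ε)).PosSemidef := by
      rw [← spectralMatrix_add, ← spectralMatrix_add, spectralMatrix_const hV,
        spectralMatrix_const hU, add_sub_add_right_eq_sub, ← hUp]
      exact h
    have h2 := re_trace_mul_nonneg hρ.1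
      (spectralMatrix_log_le hU hV (fun i => add_pos_of_nonneg_of_pos (hp i) hε) h1)
    rw [Matrix.mul_sub, Matrix.trace_sub, Complex.sub_re, Matrix.trace_mul_comm,
      trace_spectralMatrix_mul, Matrix.trace_mul_comm, trace_spectralMatrix_mul] at h2
    have h3 : (Uᴴ * ρ * U) = Matrix.diagonal (fun i => (p i : ℂ)) := by
      rw [hUp, spectralMatrix_conj_self hU]
    rw [h3] at h2
    simp only [Complex.re_sum, Complex.re_ofReal_mul, Matrix.diagonal_apply_eq,
      Complex.ofReal_re] at h2
    simp only [mul_comm (Real.log _)] at h2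
    linarith
  have hlim1 : Filter.Tendsto (fun ε : ℝ => ∑ i, p i * Real.log (p i + ε))
      (nhdsWithin 0 (Set.Ioi 0)) (nhds (∑ i, p i * Real.log (p i))) :=
    tendsto_finsetSum _ fun i _ => tendsto_mul_log_add fun h => h
  have hlim2 : Filter.Tendsto
      (fun ε : ℝ => ∑ j, ((Vᴴ * ρ * V) j j).re * Real.log (q j + ε))
      (nhdsWithin 0 (Set.Ioi 0)) (nhds (∑ j, ((Vᴴ * ρ * V) j j).re * Real.log (q j))) :=
    tendsto_finsetSum _ fun j _ => tendsto_mul_log_add fun h =>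
      le_antisymm ((hle j).trans h.le) (hr0 j)
  have := le_of_tendsto_of_tendsto hlim1 hlim2
    (Filter.eventually_of_mem self_mem_nhdsWithin fun ε h => hε ε h)
  have h4 : entropy ρ = -∑ i, p i * Real.log (p i) := by
    rw [hUp, entropy_spectralMatrix hU, ← Finset.sum_neg_distrib]
    simp [Real.negMulLog]
  rw [h4]
  linarith

theorem IsState.one_sub_posSemidef {σ : Matrix n n ℂ} (h : IsState σ) : (1 - σ).PosSemidef := by
  obtain ⟨U, hU, p, hp, hp1, rfl⟩ := h.exists_spectralMatrix
  have h1 : (1 : Matrix n n ℂ) - spectralMatrix U p = spectralMatrix U (fun i => 1 - p i) := by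
    rw [sub_eq_iff_eq_add, spectralMatrix_add]
    simp [spectralMatrix_const hU]
  rw [h1]
  refine spectralMatrix_posSemidef U fun i => sub_nonneg.2 ?_
  rw [← hp1]
  exact Finset.single_le_sum (fun j _ => hp j) (Finset.mem_univ i)

theorem traceLeft_add (ρ σ : Matrix (m × n) (m × n) ℂ) :
    traceLeft (ρ + σ) = traceLeft ρ + traceLeft σ := by
  ext i j
  simp [traceLeft, Finset.sum_add_distrib]

theorem traceRight_add (ρ σ : Matrix (m × n) (m × n) ℂ) :
    traceRight (ρ + σ) = traceRight ρ + traceRight σ := by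
  ext i j
  simp [traceRight, Finset.sum_add_distrib]

theorem traceLeft_smul (c : ℝ) (ρ : Matrix (m × n) (m × n) ℂ) :
    traceLeft (c • ρ) = c • traceLeft ρ := by
  ext i j
  simp [traceLeft, Finset.mul_sum]

theorem traceRight_smul (c : ℝ) (ρ : Matrix (m × n) (m × n) ℂ) :
    traceRight (c • ρ) = c • traceRight ρ := by
  ext i j
  simp [traceRight, Finset.mul_sum]

/-- The reduction criterion on the second factor. -/
theorem Separable.one_kronecker_sub_posSemidef {ρ : Matrix (m × n) (m × n) ℂ}
    (h : Separable ρ) : ((1 : Matrix m m ℂ) ⊗ₖ traceLeft ρ - ρ).PosSemidef := by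
  refine convexHull_min (t := {ρ : Matrix (m × n) (m × n) ℂ |
    ((1 : Matrix m m ℂ) ⊗ₖ traceLeft ρ - ρ).PosSemidef}) ?_ ?_ h
  · rintro _ ⟨σ, τ, hσ, hτ, rfl⟩
    rw [Set.mem_ofPred_eq, traceLeft_kronecker, hσ.2, one_smul]
    have h1 : (1 : Matrix m m ℂ) ⊗ₖ τ - σ ⊗ₖ τ = (1 - σ) ⊗ₖ τ := by
      ext i j
      simp [sub_mul]
    rw [h1]
    exact hσ.one_sub_posSemidef.kronecker hτ.1
  · intro x hx y hy a b ha hb _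
    rw [Set.mem_ofPred_eq, traceLeft_add, traceLeft_smul, traceLeft_smul]
    have h1 : (1 : Matrix m m ℂ) ⊗ₖ (a • traceLeft x + b • traceLeft y) - (a • x + b • y) =
        a • ((1 : Matrix m m ℂ) ⊗ₖ traceLeft x - x) +
          b • ((1 : Matrix m m ℂ) ⊗ₖ traceLeft y - y) := by
      rw [Matrix.kronecker_add, Matrix.kronecker_smul, Matrix.kronecker_smul, smul_sub, smul_sub]
      abel
    rw [h1]
    exact (hx.smul ha).add (hy.smul hb)

/-- The reduction criterion on the first factor. -/
theorem Separable.kronecker_one_sub_posSemidef {ρ : Matrix (m × n) (m × n) ℂ}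
    (h : Separable ρ) : (traceRight ρ ⊗ₖ (1 : Matrix n n ℂ) - ρ).PosSemidef := by
  refine convexHull_min (t := {ρ : Matrix (m × n) (m × n) ℂ |
    (traceRight ρ ⊗ₖ (1 : Matrix n n ℂ) - ρ).PosSemidef}) ?_ ?_ h
  · rintro _ ⟨σ, τ, hσ, hτ, rfl⟩
    rw [Set.mem_ofPred_eq, traceRight_kronecker, hτ.2, one_smul]
    have h1 : σ ⊗ₖ (1 : Matrix n n ℂ) - σ ⊗ₖ τ = σ ⊗ₖ (1 - τ) := by
      ext i j
      simp [mul_sub]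
    rw [h1]
    exact hσ.1.kronecker hτ.one_sub_posSemidef
  · intro x hx y hy a b ha hb _
    rw [Set.mem_ofPred_eq, traceRight_add, traceRight_smul, traceRight_smul]
    have h1 : (a • traceRight x + b • traceRight y) ⊗ₖ (1 : Matrix n n ℂ) - (a • x + b • y) =
        a • (traceRight x ⊗ₖ (1 : Matrix n n ℂ) - x) +
          b • (traceRight y ⊗ₖ (1 : Matrix n n ℂ) - y) := by
      rw [Matrix.add_kronecker, Matrix.smul_kronecker, Matrix.smul_kronecker, smul_sub, smul_sub]
      abel
    rw [h1]
    exact (hx.smul ha).add (hy.smul hb)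

/-- By the reduction criterion the entropy of `ρ` is at least `-tr[ρ log (1 ⊗ ρ_B)]`, which is the
entropy of `ρ_B`. -/
theorem Separable.entropy_traceLeft_le {ρ : Matrix (m × n) (m × n) ℂ} (hρ : IsState ρ)
    (h : Separable ρ) : entropy (traceLeft ρ) ≤ entropy ρ := by
  obtain ⟨V, hV, q, hq, hq1, hVq⟩ := hρ.traceLeft.exists_spectralMatrix
  have h1 : (1 : Matrix m m ℂ) ⊗ₖ traceLeft ρ =
      spectralMatrix ((1 : Matrix m m ℂ) ⊗ₖ V) (fun i => q i.2) := by
    have := spectralMatrix_kronecker (1 : Matrix m m ℂ) V (fun _ => 1) q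
    rw [spectralMatrix_const (one_mem _)] at this
    simpa [hVq] using this
  have h2 := h.one_kronecker_sub_posSemidef
  rw [h1] at h2
  refine le_trans (le_of_eq ?_)
    (neg_sum_log_le_entropy hρ (kronecker_mem_unitary (one_mem _) hV) h2)
  have h3 := traceLeft_mul_mul ρ (1 : Matrix m m ℂ) 1 Vᴴ V (one_mul _)
  rw [hVq, spectralMatrix_conj_self hV] at h3
  have h4 : ∀ j, ∑ i, ((((1 : Matrix m m ℂ) ⊗ₖ V)ᴴ * ρ * ((1 : Matrix m m ℂ) ⊗ₖ V))
      (i, j) (i, j)).re = q j := by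
    intro j
    have h5 := congrArg Complex.re (congrFun (congrFun h3 j) j)
    rw [Matrix.conjTranspose_kronecker, Matrix.conjTranspose_one]
    simpa [traceLeft] using h5
  rw [hVq, entropy_spectralMatrix hV, Fintype.sum_prod_type_right]
  simp only [← Finset.sum_mul, h4, ← Finset.sum_neg_distrib, Real.negMulLog, neg_mul]

theorem Separable.entropy_traceRight_le {ρ : Matrix (m × n) (m × n) ℂ} (hρ : IsState ρ)
    (h : Separable ρ) : entropy (traceRight ρ) ≤ entropy ρ := by
  obtain ⟨V, hV, q, hq, hq1, hVq⟩ := hρ.traceRight.exists_spectralMatrix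
  have h1 : traceRight ρ ⊗ₖ (1 : Matrix n n ℂ) =
      spectralMatrix (V ⊗ₖ (1 : Matrix n n ℂ)) (fun i => q i.1) := by
    have := spectralMatrix_kronecker V (1 : Matrix n n ℂ) q (fun _ => 1)
    rw [spectralMatrix_const (one_mem _)] at this
    simpa [hVq] using this
  have h2 := h.kronecker_one_sub_posSemidef
  rw [h1] at h2
  refine le_trans (le_of_eq ?_)
    (neg_sum_log_le_entropy hρ (kronecker_mem_unitary hV (one_mem _)) h2)
  have h3 := traceRight_mul_mul ρ Vᴴ V (1 : Matrix n n ℂ) 1 (one_mul _)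
  rw [hVq, spectralMatrix_conj_self hV] at h3
  have h4 : ∀ i, ∑ j, (((V ⊗ₖ (1 : Matrix n n ℂ))ᴴ * ρ * (V ⊗ₖ (1 : Matrix n n ℂ)))
      (i, j) (i, j)).re = q i := by
    intro j
    have h5 := congrArg Complex.re (congrFun (congrFun h3 j) j)
    rw [Matrix.conjTranspose_kronecker, Matrix.conjTranspose_one]
    simpa [traceRight] using h5
  rw [hVq, entropy_spectralMatrix hV, Fintype.sum_prod_type]
  simp only [← Finset.sum_mul, h4, ← Finset.sum_neg_distrib, Real.negMulLog, neg_mul]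

end Separability

/-! ### Entropy balance of a process -/

section Balance

theorem energy_sub {n : Type*} [Fintype n] (H ρ σ : Matrix n n ℂ) :
    energy H (ρ - σ) = energy H ρ - energy H σ := by
  simp [energy, Matrix.sub_mul, Matrix.trace_sub]

namespace HeatProcess

variable {S : Type*} [Fintype S] [DecidableEq S] {β : ℝ} {HS ρ : Matrix S S ℂ}

/-- The environment cannot be zero-dimensional, since otherwise the final state of the memory would
have trace zero. -/
theorem nonempty_environment (P : HeatProcess β HS ρ) : Nonempty (Fin P.dE) := by
  by_contra h
  rw [not_nonempty_iff] at h
  have h1 := congrArg Matrix.trace P.memory_returned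
  rw [P.ω_state.2, trace_traceRight, trace_traceLeft] at h1
  simp [Matrix.trace] at h1

theorem gibbs_isState (P : HeatProcess β HS ρ) : IsState (gibbs P.HE β) :=
  have := P.nonempty_environment
  HeatWitness.gibbs_isState β P.HE_hermitian

theorem final_isState (P : HeatProcess β HS ρ) (hρ : IsState ρ) : IsState P.final :=
  (hρ.kronecker (P.ω_state.kronecker P.gibbs_isState)).conj P.U_unitary

theorem energy_final (P : HeatProcess β HS ρ) :
    energy (totalH HS (totalH P.HM P.HE)) P.final =
      energy (totalH HS (totalH P.HM P.HE)) (ρ ⊗ₖ (P.ω ⊗ₖ gibbs P.HE β)) := by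
  rw [energy, energy, final, Matrix.mul_assoc, Matrix.trace_mul_comm, ← Matrix.mul_assoc,
    Matrix.mul_assoc P.Uᴴ, ← P.U_energy, ← Matrix.mul_assoc, unitary_conjTranspose_mul P.U_unitary,
    Matrix.one_mul, Matrix.trace_mul_comm]

/-- Energy conservation: the environment receives the energy that the system loses. -/
theorem heat_eq (P : HeatProcess β HS ρ) (hρ : IsState ρ) :
    P.heat = energy HS ρ - energy HS (traceRight P.final) := by
  have h := P.energy_final
  have hM : traceRight (traceLeft P.final) = P.ω := P.memory_returned
  rw [energy_totalH, energy_totalH, energy_totalH, energy_totalH, hM, traceRight_kronecker,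
    traceLeft_kronecker, hρ.2, one_smul, traceRight_kronecker, traceLeft_kronecker,
    Matrix.trace_kronecker, P.gibbs_isState.2, P.ω_state.2, mul_one, one_smul, one_smul,
    one_smul] at h
  rw [heat, energy_sub]
  linarith

/-- The second law for processes with a returned memory: the free energy of the system does not
increase. Correlations built up between the subsystems only help, by subadditivity. -/
theorem freeEnergy_final_le (P : HeatProcess β HS ρ) (hβ : 0 < β) (hρ : IsState ρ) :
    freeEnergy β HS (traceRight P.final) ≤ freeEnergy β HS ρ := by
  have hf := P.final_isState hρ
  have hM : traceRight (traceLeft P.final) = P.ω := P.memory_returned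
  have h1 : entropy P.final = entropy ρ + (entropy P.ω + entropy (gibbs P.HE β)) := by
    rw [final, entropy_unitary_conj P.U_unitary
      (hρ.kronecker (P.ω_state.kronecker P.gibbs_isState)).isHermitian,
      entropy_kronecker hρ (P.ω_state.kronecker P.gibbs_isState),
      entropy_kronecker P.ω_state P.gibbs_isState]
  have h2 := entropy_le_add hf
  have h3 := entropy_le_add hf.traceLeft
  rw [hM] at h3
  have h4 := gibbs_variational β P.HE_hermitian hf.traceLeft.traceLeft
  have h5 := P.heat_eq hρ
  rw [heat, energy_sub] at h5
  have h6 : energy P.HE (traceLeft (traceLeft P.final)) =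
      energy P.HE (gibbs P.HE β) + (energy HS ρ - energy HS (traceRight P.final)) := by linarith
  rw [h6] at h4
  have h7 : β * energy HS (traceRight P.final) - entropy (traceRight P.final) ≤
      β * energy HS ρ - entropy ρ := by linarith
  have h8 : ∀ E T : ℝ, E - T / β = (β * E - T) / β := fun E T => by field_simp
  rw [freeEnergy, freeEnergy, h8, h8]
  exact div_le_div_of_nonneg_right h7 hβ.le

end HeatProcess

end Balance

/-! ### Comparison of a state with Gibbs states -/

section Comparison

variable {n : Type*} [Fintype n] [DecidableEq n]

theorem continuous_gibbsProb [Nonempty n] (e : n → ℝ) (i : n) :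
    Continuous fun x => gibbsProb e x i := by
  unfold gibbsProb partition
  refine Continuous.div (by fun_prop) (by fun_prop) fun x => ?_
  exact (partition_pos e x).ne'

theorem continuous_energy_gibbs [Nonempty n] {H : Matrix n n ℂ} (hH : H.IsHermitian) :
    Continuous fun x => energy H (gibbs H x) := by
  obtain ⟨W, hW, e, rfl⟩ := exists_spectralMatrix hH
  simp only [energy_gibbs_spectralMatrix e _ hW]
  exact continuous_finsetSum _ fun i _ => continuous_const.mul (continuous_gibbsProb e i)

theorem continuous_freeEnergy_gibbs [Nonempty n] {H : Matrix n n ℂ} (hH : H.IsHermitian) (β : ℝ) :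
    Continuous fun x => freeEnergy β H (gibbs H x) := by
  refine (continuous_energy_gibbs hH).sub (Continuous.div_const ?_ β)
  obtain ⟨W, hW, e, rfl⟩ := exists_spectralMatrix hH
  simp only [entropy_gibbs_spectralMatrix e _ hW]
  exact continuous_finsetSum _ fun i _ =>
    Real.continuous_negMulLog.comp (continuous_gibbsProb e i)

variable {H : Matrix n n ℂ} {σ : Matrix n n ℂ} {β x : ℝ}

theorem freeEnergy_le_iff (hβ : 0 < β) (ρ : Matrix n n ℂ) :
    freeEnergy β H σ ≤ freeEnergy β H ρ ↔
      β * energy H σ - entropy σ ≤ β * energy H ρ - entropy ρ := by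
  have h8 : ∀ E T : ℝ, E - T / β = (β * E - T) / β := fun E T => by field_simp
  rw [freeEnergy, freeEnergy, h8, h8, div_le_div_iff_of_pos_right hβ]

theorem freeEnergy_gibbs_le (hH : H.IsHermitian) (hβ : 0 < β) (hσ : IsState σ) :
    freeEnergy β H (gibbs H β) ≤ freeEnergy β H σ :=
  (freeEnergy_le_iff hβ _).2 (gibbs_variational β hH hσ)

/-- A state whose free energy is minimal has the energy of the Gibbs state: perturbing the inverse
temperature in the variational principle bounds its energy from both sides. -/
theorem energy_eq_of_freeEnergy_le_gibbs (hH : H.IsHermitian) (hβ : 0 < β) (hσ : IsState σ)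
    (h : freeEnergy β H σ ≤ freeEnergy β H (gibbs H β)) :
    energy H σ = energy H (gibbs H β) := by
  have := hσ.nonempty
  rw [freeEnergy_le_iff hβ] at h
  have key : ∀ y, (y - β) * energy H (gibbs H y) ≤ (y - β) * energy H σ := by
    intro y
    have h1 := gibbs_variational y hH hσ
    have h2 := gibbs_variational β hH (gibbs_isState y hH)
    linarith
  -- dividing by `y - β` bounds the energy on one side, and then `y → β`
  have hc := (continuous_energy_gibbs hH).tendsto β
  apply le_antisymm
  · refine ge_of_tendsto (hc.mono_left (nhdsWithin_le_nhds (s := Set.Iio β))) ?_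
    filter_upwards [self_mem_nhdsWithin] with y hy
    exact (mul_le_mul_left_of_neg (sub_neg.2 hy)).1 (key y)
  · refine le_of_tendsto (hc.mono_left (nhdsWithin_le_nhds (s := Set.Ioi β))) ?_
    filter_upwards [self_mem_nhdsWithin] with y hy
    exact le_of_mul_le_mul_left (key y) (sub_pos.2 hy)

/-- A state with no more free energy than a Gibbs state hotter than `β` has no more energy. The
variational principle at `x` is `x E - S ≥ x E_x - S_x`; subtracting it from the hypothesis leaves
`(β - x) E ≤ (β - x) E_x`. -/
theorem energy_le_of_freeEnergy_le (hH : H.IsHermitian) (hβ : 0 < β) (hσ : IsState σ)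
    (hx : x ≤ β) (h : freeEnergy β H σ ≤ freeEnergy β H (gibbs H x)) :
    energy H σ ≤ energy H (gibbs H x) := by
  rcases hx.eq_or_lt with rfl | hx
  · exact (energy_eq_of_freeEnergy_le_gibbs hH hβ hσ h).le
  · rw [freeEnergy_le_iff hβ] at h
    have h1 := gibbs_variational x hH hσ
    have h2 : (β - x) * energy H σ ≤ (β - x) * energy H (gibbs H x) := by linarith
    exact le_of_mul_le_mul_left h2 (sub_pos.2 hx)

theorem le_energy_of_freeEnergy_le (hH : H.IsHermitian) (hβ : 0 < β) (hσ : IsState σ)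
    (hx : β ≤ x) (h : freeEnergy β H σ ≤ freeEnergy β H (gibbs H x)) :
    energy H (gibbs H x) ≤ energy H σ := by
  rcases hx.eq_or_lt with rfl | hx
  · exact (energy_eq_of_freeEnergy_le_gibbs hH hβ hσ h).ge
  · rw [freeEnergy_le_iff hβ] at h
    have h1 := gibbs_variational x hH hσ
    have h2 : (x - β) * energy H (gibbs H x) ≤ (x - β) * energy H σ := by linarith
    exact le_of_mul_le_mul_left h2 (sub_pos.2 hx)

end Comparison

/-! ### Energy levels and the limits of infinite inverse temperature -/

section Levels

variable {n : Type*} [Fintype n] [DecidableEq n]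

theorem energy_mem_Icc {H : Matrix n n ℂ} (hH : H.IsHermitian) {σ : Matrix n n ℂ}
    (hσ : IsState σ) : energy H σ ∈ Set.Icc (minEnergy H) (maxEnergy H) := by
  have hs : spectrum ℝ H = Set.range hH.eigenvalues := hH.spectrum_real_eq_range_eigenvalues
  have hfin : (Set.range hH.eigenvalues).Finite := Set.finite_range _
  rw [minEnergy, maxEnergy, hs]
  have hW := hH.eigenvectorUnitary.2
  have hst := hσ.conj' hW
  have hE : energy H σ = ∑ i, hH.eigenvalues i *
      (((hH.eigenvectorUnitary : Matrix n n ℂ)ᴴ * σ * hH.eigenvectorUnitary) i i).re := by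
    conv_lhs => rw [isHermitian_eq_spectralMatrix hH]
    exact energy_spectralMatrix _ _ _
  rw [hE]
  constructor
  · rw [← mul_one (sInf _), ← hst.sum_diag, Finset.mul_sum]
    exact Finset.sum_le_sum fun i _ => mul_le_mul_of_nonneg_right
      (csInf_le hfin.bddBelow (Set.mem_range_self i)) (hst.diag_nonneg i)
  · rw [← mul_one (sSup _), ← hst.sum_diag, Finset.mul_sum]
    exact Finset.sum_le_sum fun i _ => mul_le_mul_of_nonneg_right
      (le_csSup hfin.bddAbove (Set.mem_range_self i)) (hst.diag_nonneg i)

theorem degeneracy_spectralMatrix {W : Matrix n n ℂ} (hW : W ∈ Matrix.unitaryGroup n ℂ)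
    (e : n → ℝ) (E : ℝ) : degeneracy (spectralMatrix W e) E = Fintype.card {i // e i = E} := by
  have h1 : Matrix.toLin' (spectralMatrix W e) - (E : ℂ) • 1 =
      Matrix.toLin' (spectralMatrix W (fun i => e i - E)) := by
    have : spectralMatrix W (fun i => e i - E) = spectralMatrix W e - (E : ℂ) • 1 := by
      rw [eq_sub_iff_add_eq, ← spectralMatrix_const hW, spectralMatrix_add]
      simp
    rw [this, map_sub, map_smul, Matrix.toLin'_one]
    rfl
  have hdet : IsUnit W.det :=
    (Matrix.isUnit_iff_isUnit_det W).1 (IsUnit.of_mul_eq_one _ (unitary_mul_conjTranspose hW))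
  have hdet' : IsUnit Wᴴ.det := (Matrix.isUnit_iff_isUnit_det _).1
    (IsUnit.of_mul_eq_one _ (unitary_mul_conjTranspose (conjTranspose_mem_unitary hW)))
  have h2 : (spectralMatrix W (fun i => e i - E)).rank =
      Fintype.card {i // ((e i - E : ℝ) : ℂ) ≠ 0} := by
    rw [spectralMatrix, Matrix.rank_mul_eq_left_of_isUnit_det _ _ hdet',
      Matrix.rank_mul_eq_right_of_isUnit_det _ _ hdet, Matrix.rank_diagonal]
  have h3 := LinearMap.finrank_range_add_finrank_ker
    (Matrix.toLin' (spectralMatrix W (fun i => e i - E)))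
  rw [degeneracy, Module.End.eigenspace_def, h1]
  have h4 : Module.finrank ℂ (LinearMap.range
      (Matrix.toLin' (spectralMatrix W (fun i => e i - E)))) =
      (spectralMatrix W (fun i => e i - E)).rank := rfl
  rw [h4, h2, Module.finrank_fintype_fun_eq_card] at h3
  have h5 := Fintype.card_subtype_compl (fun i => e i = E)
  have h6 : Fintype.card {i // ((e i - E : ℝ) : ℂ) ≠ 0} = Fintype.card {i // ¬ e i = E} := by
    refine Fintype.card_congr (Equiv.subtypeEquivRight fun i => ?_)
    rw [ne_eq, Complex.ofReal_eq_zero, sub_eq_zero]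
  have h7 := Fintype.card_subtype_le (fun i => e i = E)
  omega

/-- At low temperature the Gibbs distribution tends to the uniform one on the ground level. -/
theorem tendsto_gibbsProb_atTop (e : n → ℝ) {M : ℝ} (hM : ∀ i, M ≤ e i) (hM' : ∃ i, e i = M)
    (i : n) : Filter.Tendsto (fun x => gibbsProb e x i) Filter.atTop
      (nhds (if e i = M then ((Fintype.card {i // e i = M} : ℝ))⁻¹ else 0)) := by
  have h1 : ∀ j, Filter.Tendsto (fun x => Real.exp (-x * (e j - M))) Filter.atTop
      (nhds (if e j = M then 1 else 0)) := by
    intro j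
    split_ifs with h
    · simp [h]
    · have h2 : 0 < e j - M := sub_pos.2 (lt_of_le_of_ne (hM j) (Ne.symm h))
      refine Real.tendsto_exp_atBot.comp ?_
      exact Filter.Tendsto.atBot_mul_const h2 Filter.tendsto_neg_atTop_atBot
  have h3 : ∀ x, gibbsProb e x i =
      Real.exp (-x * (e i - M)) / ∑ j, Real.exp (-x * (e j - M)) := by
    intro x
    have : ∀ j, Real.exp (-x * (e j - M)) = Real.exp (-x * e j) * Real.exp (x * M) := by
      intro j
      rw [← Real.exp_add]
      ring_nf
    simp only [this, ← Finset.sum_mul]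
    rw [mul_div_mul_right _ _ (Real.exp_pos _).ne', gibbsProb, partition]
  simp only [h3]
  have h4 : (∑ j, if e j = M then (1 : ℝ) else 0) = Fintype.card {i // e i = M} := by
    rw [Fintype.card_subtype, Finset.sum_boole]
  have h5 := (h1 i).div (tendsto_finsetSum Finset.univ fun j _ => h1 j) (by
    rw [h4]
    obtain ⟨i, hi⟩ := hM'
    have : Nonempty {i // e i = M} := ⟨⟨i, hi⟩⟩
    exact_mod_cast Fintype.card_ne_zero)
  rw [h4] at h5
  have h6 : (if e i = M then (1 : ℝ) else 0) / (Fintype.card {i // e i = M} : ℝ) =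
      if e i = M then (Fintype.card {i // e i = M} : ℝ)⁻¹ else 0 := by
    split_ifs <;> simp
  rw [h6] at h5
  exact h5

/-- If a distribution tends to the uniform one on the level `M`, its free energy tends to `M` minus
the temperature times the logarithm of the degeneracy. -/
theorem tendsto_freeEnergy_of_tendsto_uniform {l : Filter ℝ} (p : ℝ → n → ℝ) (e : n → ℝ) (β M : ℝ)
    (hM' : ∃ i, e i = M)
    (hp : ∀ i, Filter.Tendsto (fun x => p x i) l
      (nhds (if e i = M then ((Fintype.card {i // e i = M} : ℝ))⁻¹ else 0))) :
    Filter.Tendsto (fun x => ∑ i, e i * p x i - (∑ i, Real.negMulLog (p x i)) / β) l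
      (nhds (M - β⁻¹ * Real.log (Fintype.card {i // e i = M}))) := by
  have hg : (Fintype.card {i // e i = M} : ℝ) ≠ 0 := by
    obtain ⟨i, hi⟩ := hM'
    have : Nonempty {i // e i = M} := ⟨⟨i, hi⟩⟩
    exact_mod_cast Fintype.card_ne_zero
  set g : ℝ := (Fintype.card {i // e i = M} : ℝ) with hgdef
  have h4 : ∀ c : ℝ, (∑ j, if e j = M then c else 0) = g * c := by
    intro c
    rw [hgdef, Fintype.card_subtype, ← Finset.sum_filter, Finset.sum_const, nsmul_eq_mul]
  have h1 := (tendsto_finsetSum Finset.univ fun i _ => (hp i).const_mul (e i)).sub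
    ((tendsto_finsetSum Finset.univ fun i _ =>
      (Real.continuous_negMulLog.tendsto _).comp (hp i)).div_const β)
  have e1 : ∑ i, e i * (if e i = M then g⁻¹ else 0) = M := by
    have : ∀ i, e i * (if e i = M then g⁻¹ else 0) = if e i = M then M * g⁻¹ else 0 := by
      intro i
      split_ifs with h <;> simp [h]
    simp only [this, h4]
    field_simp
  have e2 : ∑ i, Real.negMulLog (if e i = M then g⁻¹ else 0) = Real.log g := by
    have : ∀ i, Real.negMulLog (if e i = M then g⁻¹ else 0) =
        if e i = M then Real.negMulLog g⁻¹ else 0 := by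
      intro i
      split_ifs <;> simp
    rw [Finset.sum_congr rfl fun i _ => this i, h4, Real.negMulLog, Real.log_inv]
    field_simp
  rw [e1, e2, div_eq_inv_mul] at h1
  exact h1

theorem freeEnergy_gibbs_eq {H : Matrix n n ℂ} (hH : H.IsHermitian) (β x : ℝ) :
    freeEnergy β H (gibbs H x) = ∑ i, hH.eigenvalues i * gibbsProb hH.eigenvalues x i -
      (∑ i, Real.negMulLog (gibbsProb hH.eigenvalues x i)) / β := by
  have h := isHermitian_eq_spectralMatrix hH
  have h1 := energy_gibbs_spectralMatrix hH.eigenvalues x hH.eigenvectorUnitary.2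
  have h2 := entropy_gibbs_spectralMatrix hH.eigenvalues x hH.eigenvectorUnitary.2
  rw [← h] at h1 h2
  rw [freeEnergy, h1, h2]

theorem degeneracy_eq_card {H : Matrix n n ℂ} (hH : H.IsHermitian) (E : ℝ) :
    degeneracy H E = Fintype.card {i // hH.eigenvalues i = E} := by
  conv_lhs => rw [isHermitian_eq_spectralMatrix hH]
  exact degeneracy_spectralMatrix hH.eigenvectorUnitary.2 _ _

theorem tendsto_freeEnergy_gibbs_atTop [Nonempty n] {H : Matrix n n ℂ} (hH : H.IsHermitian)
    (β : ℝ) : Filter.Tendsto (fun x => freeEnergy β H (gibbs H x)) Filter.atTop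
      (nhds (minEnergy H - β⁻¹ * Real.log (degeneracy H (minEnergy H)))) := by
  simp only [freeEnergy_gibbs_eq hH, degeneracy_eq_card hH]
  have hs : spectrum ℝ H = Set.range hH.eigenvalues := hH.spectrum_real_eq_range_eigenvalues
  have hfin : (Set.range hH.eigenvalues).Finite := Set.finite_range _
  have hmem : ∃ i, hH.eigenvalues i = minEnergy H := by
    rw [minEnergy, hs]
    exact (Set.range_nonempty _).csInf_mem hfin
  refine tendsto_freeEnergy_of_tendsto_uniform _ _ _ _ hmem fun i => ?_
  refine tendsto_gibbsProb_atTop _ (fun i => ?_) hmem i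
  rw [minEnergy, hs]
  exact csInf_le hfin.bddBelow (Set.mem_range_self i)

theorem tendsto_freeEnergy_gibbs_atBot [Nonempty n] {H : Matrix n n ℂ} (hH : H.IsHermitian)
    (β : ℝ) : Filter.Tendsto (fun x => freeEnergy β H (gibbs H x)) Filter.atBot
      (nhds (maxEnergy H - β⁻¹ * Real.log (degeneracy H (maxEnergy H)))) := by
  simp only [freeEnergy_gibbs_eq hH, degeneracy_eq_card hH]
  have hs : spectrum ℝ H = Set.range hH.eigenvalues := hH.spectrum_real_eq_range_eigenvalues
  have hfin : (Set.range hH.eigenvalues).Finite := Set.finite_range _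
  obtain ⟨k, hk⟩ : ∃ i, hH.eigenvalues i = maxEnergy H := by
    rw [maxEnergy, hs]
    exact (Set.range_nonempty _).csSup_mem hfin
  refine tendsto_freeEnergy_of_tendsto_uniform _ _ _ _ ⟨k, hk⟩ fun i => ?_
  -- negative inverse temperatures are positive ones for the reversed spectrum
  have h1 : ∀ x, gibbsProb hH.eigenvalues x i = gibbsProb (fun i => -hH.eigenvalues i) (-x) i := by
    intro x
    simp [gibbsProb, partition]
  simp only [h1]
  have h2 := (tendsto_gibbsProb_atTop (fun i => -hH.eigenvalues i) (M := -maxEnergy H)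
    (fun i => by
      rw [neg_le_neg_iff, maxEnergy, hs]
      exact le_csSup hfin.bddAbove (Set.mem_range_self i)) ⟨k, by rw [hk]⟩ i).comp
    Filter.tendsto_neg_atBot_atTop
  simp only [neg_inj] at h2
  exact h2

end Levels

/-! ### The heat bounds for separable states -/

section Bounds

variable {A B : Type*} [Fintype A] [DecidableEq A] [Fintype B] [DecidableEq B]
  {HA : Matrix A A ℂ} {HB : Matrix B B ℂ} {β : ℝ} {ρ : Matrix (A × B) (A × B) ℂ}

theorem freeEnergyStar_eq (β : ℝ) (HA : Matrix A A ℂ) (HB : Matrix B B ℂ)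
    (ρ : Matrix (A × B) (A × B) ℂ) :
    freeEnergyStar β HA HB ρ = energy (totalH HA HB) ρ - β⁻¹ * maxLocalEntropy ρ := by
  rw [freeEnergyStar, energy_totalH]

theorem Separable.freeEnergy_le (hβ : 0 < β) (hρ : IsState ρ) (h : Separable ρ) :
    freeEnergy β (totalH HA HB) ρ ≤ freeEnergyStar β HA HB ρ := by
  have h1 : maxLocalEntropy ρ ≤ entropy ρ :=
    max_le (h.entropy_traceRight_le hρ) (h.entropy_traceLeft_le hρ)
  rw [freeEnergyStar_eq, freeEnergy, div_eq_inv_mul]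
  have := mul_le_mul_of_nonneg_left h1 (inv_nonneg.2 hβ.le)
  linarith

/-- The defining equation of the zero trades the entropies in the heat bound for energies. -/
theorem heatBound_eq {x : ℝ} (hx : zeroFun β (totalH HA HB) x (freeEnergyStar β HA HB ρ) = 0) :
    heatBound β HA HB ρ x =
      energy (totalH HA HB) ρ - energy (totalH HA HB) (gibbs (totalH HA HB) x) := by
  rw [zeroFun, freeEnergyStar_eq, freeEnergy, div_eq_inv_mul] at hx
  rw [heatBound, mul_sub]
  linarith

theorem heatBound_le_heat (hHA : HA.IsHermitian) (hHB : HB.IsHermitian) (hβ : 0 < β)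
    (hρ : IsState ρ) (h : Separable ρ) (P : HeatProcess β (totalH HA HB) ρ) {x : ℝ}
    (hx : IsColdTemp β HA HB ρ x) : heatBound β HA HB ρ x ≤ P.heat := by
  have h0 := hx.2
  rw [zeroFun] at h0
  rw [heatBound_eq hx.2, P.heat_eq hρ]
  have := energy_le_of_freeEnergy_le (totalH_isHermitian hHA hHB) hβ
    (P.final_isState hρ).traceRight hx.1
    ((P.freeEnergy_final_le hβ hρ).trans ((h.freeEnergy_le hβ hρ).trans (by linarith)))
  linarith

theorem heat_le_heatBound (hHA : HA.IsHermitian) (hHB : HB.IsHermitian) (hβ : 0 < β)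
    (hρ : IsState ρ) (h : Separable ρ) (P : HeatProcess β (totalH HA HB) ρ) {x : ℝ}
    (hx : IsHotTemp β HA HB ρ x) : P.heat ≤ heatBound β HA HB ρ x := by
  have h0 := hx.2
  rw [zeroFun] at h0
  rw [heatBound_eq hx.2, P.heat_eq hρ]
  have := le_energy_of_freeEnergy_le (totalH_isHermitian hHA hHB) hβ
    (P.final_isState hρ).traceRight hx.1
    ((P.freeEnergy_final_le hβ hρ).trans ((h.freeEnergy_le hβ hρ).trans (by linarith)))
  linarith

/-- The product of the marginals shows that `F*` is never below the equilibrium free energy, with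
room to spare if both marginals are mixed. -/
theorem freeEnergy_gibbs_add_le (hHA : HA.IsHermitian) (hHB : HB.IsHermitian) (hβ : 0 < β)
    (hρ : IsState ρ) :
    freeEnergy β (totalH HA HB) (gibbs (totalH HA HB) β) +
      β⁻¹ * min (entropy (traceRight ρ)) (entropy (traceLeft ρ)) ≤ freeEnergyStar β HA HB ρ := by
  have h1 := freeEnergy_gibbs_le (totalH_isHermitian hHA hHB) hβ
    (hρ.traceRight.kronecker hρ.traceLeft)
  have h0 : freeEnergy β (totalH HA HB) (traceRight ρ ⊗ₖ traceLeft ρ) =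
    energy (totalH HA HB) (traceRight ρ ⊗ₖ traceLeft ρ) -
      entropy (traceRight ρ ⊗ₖ traceLeft ρ) / β := rfl
  rw [h0, energy_totalH, traceRight_kronecker,
    traceLeft_kronecker, hρ.traceRight.2, hρ.traceLeft.2, one_smul, one_smul,
    entropy_kronecker hρ.traceRight hρ.traceLeft,
    ← min_add_max (entropy (traceRight ρ)) (entropy (traceLeft ρ)), div_eq_inv_mul, mul_add] at h1
  rw [freeEnergyStar, maxLocalEntropy]
  linarith

theorem freeEnergy_gibbs_le_star (hHA : HA.IsHermitian) (hHB : HB.IsHermitian) (hβ : 0 < β)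
    (hρ : IsState ρ) :
    freeEnergy β (totalH HA HB) (gibbs (totalH HA HB) β) ≤ freeEnergyStar β HA HB ρ := by
  have h1 := freeEnergy_gibbs_add_le hHA hHB hβ hρ
  have h2 : 0 ≤ β⁻¹ * min (entropy (traceRight ρ)) (entropy (traceLeft ρ)) :=
    mul_nonneg (inv_nonneg.2 hβ.le)
      (le_min (entropy_nonneg hρ.traceRight) (entropy_nonneg hρ.traceLeft))
  linarith

theorem exists_isColdTemp (hHA : HA.IsHermitian) (hHB : HB.IsHermitian) (hβ : 0 < β)
    (hρ : IsState ρ) (h : freeEnergyStar β HA HB ρ < maxEnergy (totalH HA HB) -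
      β⁻¹ * Real.log (degeneracy (totalH HA HB) (maxEnergy (totalH HA HB)))) :
    ∃ x, IsColdTemp β HA HB ρ x := by
  have := hρ.nonempty
  have hH := totalH_isHermitian hHA hHB
  have h1 := (tendsto_freeEnergy_gibbs_atBot hH β).eventually_const_le h
  obtain ⟨y, hy, hyβ⟩ := (h1.and (Filter.eventually_le_atBot β)).exists
  obtain ⟨x, hx, hx'⟩ := intermediate_value_Icc' hyβ
    (continuous_freeEnergy_gibbs hH β).continuousOn
    ⟨freeEnergy_gibbs_le_star hHA hHB hβ hρ, hy⟩
  exact ⟨x, hx.2, by rw [zeroFun]; exact sub_eq_zero.2 hx'.symm⟩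

theorem exists_isHotTemp (hHA : HA.IsHermitian) (hHB : HB.IsHermitian) (hβ : 0 < β)
    (hρ : IsState ρ) (h : freeEnergyStar β HA HB ρ < minEnergy (totalH HA HB) -
      β⁻¹ * Real.log (degeneracy (totalH HA HB) (minEnergy (totalH HA HB)))) :
    ∃ x, IsHotTemp β HA HB ρ x := by
  have := hρ.nonempty
  have hH := totalH_isHermitian hHA hHB
  have h1 := (tendsto_freeEnergy_gibbs_atTop hH β).eventually_const_le h
  obtain ⟨y, hy, hyβ⟩ := (h1.and (Filter.eventually_ge_atTop β)).exists
  obtain ⟨x, hx, hx'⟩ := intermediate_value_Icc hyβ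
    (continuous_freeEnergy_gibbs hH β).continuousOn
    ⟨freeEnergy_gibbs_le_star hHA hHB hβ hρ, hy⟩
  exact ⟨x, hx.1, by rw [zeroFun]; exact sub_eq_zero.2 hx'.symm⟩

end Bounds

/-! ### Pure states -/

section Pure

variable {m n : Type*} [Fintype m] [DecidableEq m] [Fintype n] [DecidableEq n]

theorem star_dotProduct_self (ψ : n → ℂ) :
    star ψ ⬝ᵥ ψ = ((∑ i, Complex.normSq (ψ i) : ℝ) : ℂ) := by
  rw [dotProduct, Complex.ofReal_sum]
  exact Finset.sum_congr rfl fun i _ => (Complex.normSq_eq_conj_mul_self).symm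

theorem vecMulVec_isState {ψ : n → ℂ} (h : ∑ i, Complex.normSq (ψ i) = 1) :
    IsState (Matrix.vecMulVec ψ (star ψ)) := by
  refine ⟨Matrix.posSemidef_vecMulVec_self_star ψ, ?_⟩
  rw [Matrix.trace_vecMulVec, dotProduct_comm, star_dotProduct_self, h, Complex.ofReal_one]

theorem IsPure.entropy_eq_zero {ρ : Matrix n n ℂ} (h : IsPure ρ) : entropy ρ = 0 := by
  obtain ⟨ψ, hψ, rfl⟩ := h
  have h1 : ∑ i, Complex.normSq (ψ i) = 1 := by
    rw [star_dotProduct_self] at hψ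
    exact_mod_cast hψ
  have h2 : Matrix.vecMulVec ψ (star ψ) * Matrix.vecMulVec ψ (star ψ) =
      Matrix.vecMulVec ψ (star ψ) := by
    rw [Matrix.vecMulVec_mul_vecMulVec, hψ, one_smul]
  obtain ⟨W, hW, p, hp, hp1, hWp⟩ := (vecMulVec_isState h1).exists_spectralMatrix
  rw [hWp] at h2 ⊢
  rw [spectralMatrix_mul_spectralMatrix hW] at h2
  have h3 := congrArg (fun X => Wᴴ * X * W) h2
  simp only [spectralMatrix_conj_self hW] at h3
  rw [entropy_spectralMatrix hW]
  refine Finset.sum_eq_zero fun i _ => ?_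
  have h4 : p i * p i = p i := by
    have := congrFun (congrFun h3 i) i
    simp only [Matrix.diagonal_apply_eq] at this
    exact_mod_cast this
  have h5 : p i = 0 ∨ p i = 1 := by
    rcases eq_or_ne (p i) 0 with h0 | h0
    · exact Or.inl h0
    · exact Or.inr (mul_left_cancel₀ h0 (by rw [h4, mul_one]))
  rcases h5 with h5 | h5 <;> simp [h5]

/-- A state of zero entropy has an eigenvector of eigenvalue one. -/
theorem exists_unit_of_entropy_eq_zero {σ : Matrix n n ℂ} (hσ : IsState σ) (h : entropy σ = 0) :
    ∃ b : n → ℂ, ∑ k, Complex.normSq (b k) = 1 ∧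
      (∑ k, ∑ l, star (b k) * σ k l * b l) = 1 := by
  obtain ⟨W, hW, p, hp, hp1, rfl⟩ := hσ.exists_spectralMatrix
  rw [entropy_spectralMatrix hW] at h
  have hle : ∀ i, p i ≤ 1 := fun i => by
    rw [← hp1]
    exact Finset.single_le_sum (fun j _ => hp j) (Finset.mem_univ i)
  have h0 := (Finset.sum_eq_zero_iff_of_nonneg
    fun i _ => Real.negMulLog_nonneg (hp i) (hle i)).1 h
  obtain ⟨j, hj⟩ : ∃ j, p j ≠ 0 := by
    by_contra hcon
    push Not at hcon
    simp [hcon] at hp1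
  have hj1 : p j = 1 := by
    have := h0 j (Finset.mem_univ j)
    rw [Real.negMulLog, neg_mul, neg_eq_zero, mul_eq_zero] at this
    have h2 := (this.resolve_left hj)
    exact Real.eq_one_of_pos_of_log_eq_zero (lt_of_le_of_ne (hp j) (Ne.symm hj)) h2
  refine ⟨fun k => W k j, sum_normSq_col hW j, ?_⟩
  have h3 := congrFun (congrFun (spectralMatrix_conj_self hW p) j) j
  rw [Matrix.diagonal_apply_eq, hj1, Complex.ofReal_one, Matrix.mul_apply] at h3
  rw [← h3, Finset.sum_comm]
  refine Finset.sum_congr rfl fun l _ => ?_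
  rw [Matrix.mul_apply, Finset.sum_mul]
  rfl

/-- Pythagoras for the projection of `v` onto the line of `b`. -/
theorem sum_normSq_sub_proj (v b : n → ℂ) (hb : ∑ k, Complex.normSq (b k) = 1) :
    ∑ k, Complex.normSq (v k - (∑ l, star (b l) * v l) * b k) =
      ∑ k, Complex.normSq (v k) - Complex.normSq (∑ l, star (b l) * v l) := by
  set a := ∑ l, star (b l) * v l with ha
  have h1 : ∑ k, (v k * (starRingEnd ℂ) (a * b k)).re = Complex.normSq a := by
    rw [← Complex.re_sum]
    have : ∑ k, v k * (starRingEnd ℂ) (a * b k) = (starRingEnd ℂ) a * a := by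
      rw [show (starRingEnd ℂ) a * a = (starRingEnd ℂ) a * ∑ l, star (b l) * v l from rfl,
        Finset.mul_sum]
      refine Finset.sum_congr rfl fun k _ => ?_
      rw [map_mul, Complex.star_def]
      ring
    rw [this, ← Complex.normSq_eq_conj_mul_self, Complex.ofReal_re]
  simp only [Complex.normSq_sub, Complex.normSq_mul, Finset.sum_add_distrib,
    Finset.sum_sub_distrib, ← Finset.mul_sum, h1, hb]
  ring

/-- A unit vector of a tensor product whose reduced state fixes a unit vector `b` is a product
vector: its rows are multiples of `b`. -/
theorem eq_mul_of_sum_normSq_eq_one (ψ : m → n → ℂ) (b : n → ℂ)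
    (hψ : ∑ i, ∑ k, Complex.normSq (ψ i k) = 1) (hb : ∑ k, Complex.normSq (b k) = 1)
    (h : ∑ i, Complex.normSq (∑ l, star (b l) * ψ i l) = 1) (i : m) (k : n) :
    ψ i k = (∑ l, star (b l) * ψ i l) * b k := by
  have h1 : ∑ i, ∑ k, Complex.normSq (ψ i k - (∑ l, star (b l) * ψ i l) * b k) = 0 := by
    simp only [sum_normSq_sub_proj _ b hb, Finset.sum_sub_distrib, hψ, h, sub_self]
  have h2 := (Finset.sum_eq_zero_iff_of_nonneg fun i _ =>
    Finset.sum_nonneg fun k _ => Complex.normSq_nonneg _).1 h1 i (Finset.mem_univ i)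
  have h3 := (Finset.sum_eq_zero_iff_of_nonneg fun k _ => Complex.normSq_nonneg _).1 h2 k
    (Finset.mem_univ k)
  exact sub_eq_zero.1 (Complex.normSq_eq_zero.1 h3)

theorem separable_of_eq_mul {ψ : m × n → ℂ} {a : m → ℂ} {b : n → ℂ}
    (ha : ∑ i, Complex.normSq (a i) = 1) (hb : ∑ k, Complex.normSq (b k) = 1)
    (h : ∀ i k, ψ (i, k) = a i * b k) : Separable (Matrix.vecMulVec ψ (star ψ)) := by
  refine subset_convexHull ℝ _ ⟨_, _, vecMulVec_isState ha, vecMulVec_isState hb, ?_⟩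
  ext ⟨i, k⟩ ⟨j, l⟩
  simp only [Matrix.vecMulVec_apply, Matrix.kroneckerMap_apply, Pi.star_apply, h, star_mul']
  ring

/-- The expectation of the reduced state `σ` of `ψ` in `b` is the squared norm of the contraction of
`ψ` with `b`. -/
theorem sum_normSq_contraction (ψ : m → n → ℂ) (b : n → ℂ) (σ : Matrix n n ℂ)
    (hσ : ∀ k l, σ k l = ∑ i, ψ i k * star (ψ i l))
    (h : (∑ k, ∑ l, star (b k) * σ k l * b l) = 1) :
    ∑ i, Complex.normSq (∑ l, star (b l) * ψ i l) = 1 := by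
  have h1 : ((∑ i, Complex.normSq (∑ l, star (b l) * ψ i l) : ℝ) : ℂ) = 1 := by
    rw [← h, Complex.ofReal_sum]
    have : ∀ i, (Complex.normSq (∑ l, star (b l) * ψ i l) : ℂ) =
        ∑ k, ∑ l, star (b k) * (ψ i k * star (ψ i l)) * b l := by
      intro i
      rw [Complex.normSq_eq_conj_mul_self, mul_comm, map_sum, Finset.sum_mul_sum]
      refine Finset.sum_congr rfl fun k _ => Finset.sum_congr rfl fun l _ => ?_
      simp only [map_mul, Complex.star_def, Complex.conj_conj]
      ring
    simp only [this, hσ, Finset.mul_sum, Finset.sum_mul]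
    rw [Finset.sum_comm]
    refine Finset.sum_congr rfl fun k _ => Finset.sum_comm
  exact_mod_cast h1

/-- A pure state one of whose marginals is pure is a product state. -/
theorem entropy_traceLeft_pos {ρ : Matrix (m × n) (m × n) ℂ} (hρ : IsState ρ) (hp : IsPure ρ)
    (hs : ¬ Separable ρ) : 0 < entropy (traceLeft ρ) := by
  refine lt_of_le_of_ne (entropy_nonneg hρ.traceLeft) fun h0 => hs ?_
  obtain ⟨ψ, hψ, rfl⟩ := hp
  have h1 : ∑ i, Complex.normSq (ψ i) = 1 := by
    rw [star_dotProduct_self] at hψ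
    exact_mod_cast hψ
  obtain ⟨b, hb, hb1⟩ := exists_unit_of_entropy_eq_zero hρ.traceLeft h0.symm
  have h2 := sum_normSq_contraction (fun i k => ψ (i, k)) b _ (fun k l => rfl) hb1
  rw [Fintype.sum_prod_type] at h1
  exact separable_of_eq_mul h2 hb
    (eq_mul_of_sum_normSq_eq_one (fun i k => ψ (i, k)) b h1 hb h2)

theorem entropy_traceRight_pos {ρ : Matrix (m × n) (m × n) ℂ} (hρ : IsState ρ) (hp : IsPure ρ)
    (hs : ¬ Separable ρ) : 0 < entropy (traceRight ρ) := by
  refine lt_of_le_of_ne (entropy_nonneg hρ.traceRight) fun h0 => hs ?_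
  obtain ⟨ψ, hψ, rfl⟩ := hp
  have h1 : ∑ i, Complex.normSq (ψ i) = 1 := by
    rw [star_dotProduct_self] at hψ
    exact_mod_cast hψ
  obtain ⟨b, hb, hb1⟩ := exists_unit_of_entropy_eq_zero hρ.traceRight h0.symm
  have h2 := sum_normSq_contraction (fun k i => ψ (i, k)) b _ (fun k l => rfl) hb1
  rw [Fintype.sum_prod_type_right] at h1
  refine separable_of_eq_mul hb h2 fun i k => ?_
  rw [eq_mul_of_sum_normSq_eq_one (fun k i => ψ (i, k)) b h1 hb h2 k i, mul_comm]

/-- The free-energy bound is attained by the product of `σ` with a pure state. -/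
theorem exists_separable_freeEnergy_eq (HA : Matrix m m ℂ) (HB : Matrix n n ℂ) (β : ℝ) (b : n)
    {σ : Matrix m m ℂ} (hσ : IsState σ) :
    ∃ τ : Matrix (m × n) (m × n) ℂ, Separable τ ∧ traceRight τ = σ ∧
      freeEnergy β (totalH HA HB) τ = freeEnergyStar β HA HB τ := by
  set ψ : n → ℂ := Pi.single b 1 with hψ
  have h1 : ∑ i, Complex.normSq (ψ i) = 1 := by
    rw [Finset.sum_eq_single b] <;> simp +contextual [hψ]
  have hst := vecMulVec_isState h1
  have hpure : IsPure (Matrix.vecMulVec ψ (star ψ)) :=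
    ⟨ψ, by rw [star_dotProduct_self, h1, Complex.ofReal_one], rfl⟩
  refine ⟨σ ⊗ₖ Matrix.vecMulVec ψ (star ψ), subset_convexHull ℝ _ ⟨_, _, hσ, hst, rfl⟩, ?_, ?_⟩
  · rw [traceRight_kronecker, hst.2, one_smul]
  · rw [freeEnergyStar_eq, maxLocalEntropy, traceRight_kronecker, traceLeft_kronecker, hst.2, hσ.2,
      one_smul, one_smul, hpure.entropy_eq_zero, max_eq_left (entropy_nonneg hσ)]
    have h2 : freeEnergy β (totalH HA HB) (σ ⊗ₖ Matrix.vecMulVec ψ (star ψ)) =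
      energy (totalH HA HB) (σ ⊗ₖ Matrix.vecMulVec ψ (star ψ)) -
        entropy (σ ⊗ₖ Matrix.vecMulVec ψ (star ψ)) / β := rfl
    rw [h2, entropy_kronecker hσ hst, hpure.entropy_eq_zero, add_zero, div_eq_inv_mul]

end Pure

/-! ### Processes on arbitrary finite index types -/

section Builder

theorem mul_diagonal_comm_iff {n : Type*} [Fintype n] [DecidableEq n] (A : Matrix n n ℂ)
    (d : n → ℝ) : A * Matrix.diagonal (fun i => (d i : ℂ)) =
      Matrix.diagonal (fun i => (d i : ℂ)) * A ↔ ∀ i j, A i j ≠ 0 → d i = d j := by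
  constructor
  · intro h i j hij
    have h1 := congrFun (congrFun h i) j
    rw [Matrix.mul_diagonal, Matrix.diagonal_mul, mul_comm] at h1
    exact_mod_cast (mul_right_cancel₀ hij h1).symm
  · intro h
    ext i j
    rw [Matrix.mul_diagonal, Matrix.diagonal_mul, mul_comm]
    by_cases h0 : A i j = 0
    · simp [h0]
    · rw [h i j h0]

variable {m n : Type*} [Fintype m] [DecidableEq m] [Fintype n] [DecidableEq n]

theorem totalH_spectralMatrix {U : Matrix m m ℂ} {V : Matrix n n ℂ}
    (hU : U ∈ Matrix.unitaryGroup m ℂ) (hV : V ∈ Matrix.unitaryGroup n ℂ) (p : m → ℝ)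
    (q : n → ℝ) : totalH (spectralMatrix U p) (spectralMatrix V q) =
      spectralMatrix (U ⊗ₖ V) (fun i => p i.1 + q i.2) := by
  have h1 := spectralMatrix_kronecker U V p (fun _ => 1)
  have h2 := spectralMatrix_kronecker U V (fun _ => 1) q
  rw [spectralMatrix_const hV, Complex.ofReal_one, one_smul] at h1
  rw [spectralMatrix_const hU, Complex.ofReal_one, one_smul] at h2
  rw [totalH, h1, h2, spectralMatrix_add]
  simp

theorem spectralMatrix_one (p : n → ℝ) :
    spectralMatrix 1 p = Matrix.diagonal (fun i => (p i : ℂ)) := by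
  simp [spectralMatrix]

theorem gibbs_diagonal (e : n → ℝ) (x : ℝ) :
    gibbs (Matrix.diagonal (fun i => (e i : ℂ))) x =
      Matrix.diagonal (fun i => (gibbsProb e x i : ℂ)) := by
  rw [← spectralMatrix_one, gibbs_spectralMatrix e x (one_mem _), spectralMatrix_one]

theorem gibbsProb_comp_equiv (e : n → ℝ) (x : ℝ) (φ : m ≃ n) (i : m) :
    gibbsProb (fun i => e (φ i)) x i = gibbsProb e x (φ i) := by
  rw [gibbsProb, gibbsProb, partition, partition, φ.sum_comp (fun i => Real.exp (-x * e i))]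

theorem energy_diagonal (e : n → ℝ) (ρ : Matrix n n ℂ) :
    energy (Matrix.diagonal (fun i => (e i : ℂ))) ρ = ∑ i, e i * (ρ i i).re := by
  rw [← spectralMatrix_one, energy_spectralMatrix]
  simp

/-- A process may be specified in an eigenbasis `W` of the system Hamiltonian, with a memory and an
environment on arbitrary finite index types and with diagonal Hamiltonians. -/
theorem exists_heatProcess_of_diagonal {S M E : Type*} [Fintype S] [DecidableEq S] [Fintype M]
    [DecidableEq M] [Fintype E] [DecidableEq E] {W : Matrix S S ℂ}
    (hW : W ∈ Matrix.unitaryGroup S ℂ) (ε : S → ℝ) (ρ : Matrix S S ℂ) (β : ℝ)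
    (hM : M → ℝ) (hE : E → ℝ) {ω : Matrix M M ℂ} (hω : IsState ω)
    {U : Matrix (S × (M × E)) (S × (M × E)) ℂ} (hU : U ∈ Matrix.unitaryGroup (S × (M × E)) ℂ)
    (hUE : ∀ i j, U i j ≠ 0 → ε i.1 + (hM i.2.1 + hE i.2.2) = ε j.1 + (hM j.2.1 + hE j.2.2))
    {X : Matrix (S × (M × E)) (S × (M × E)) ℂ}
    (hX : X = U * (ρ ⊗ₖ (ω ⊗ₖ Matrix.diagonal (fun e => (gibbsProb hE β e : ℂ)))) * Uᴴ)
    (hret : traceRight (traceLeft X) = ω) :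
    ∃ P : HeatProcess β (spectralMatrix W ε) (W * ρ * Wᴴ),
      P.heat = ∑ e, hE e * ((traceLeft (traceLeft X) e e).re - gibbsProb hE β e) := by
  -- the process is `U` in the basis `W` of the system, with memory and environment reindexed by `Fin`
  set φ := Fintype.equivFin M
  set χ := Fintype.equivFin E
  set κ : S × (Fin (Fintype.card M) × Fin (Fintype.card E)) ≃ S × (M × E) :=
    Equiv.prodCongr (Equiv.refl S) (Equiv.prodCongr φ.symm χ.symm) with hκ
  have h1 : (1 : Matrix (Fin (Fintype.card M) × Fin (Fintype.card E)) _ ℂ) ∈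
    Matrix.unitaryGroup _ ℂ := one_mem _
  have hW1 := kronecker_mem_unitary hW h1
  set W1 := W ⊗ₖ (1 : Matrix (Fin (Fintype.card M) × Fin (Fintype.card E))
    (Fin (Fintype.card M) × Fin (Fintype.card E)) ℂ) with hW1def
  set HM : Matrix (Fin (Fintype.card M)) (Fin (Fintype.card M)) ℂ :=
    Matrix.diagonal (fun i => (hM (φ.symm i) : ℂ)) with hHM
  set HE : Matrix (Fin (Fintype.card E)) (Fin (Fintype.card E)) ℂ :=
    Matrix.diagonal (fun i => (hE (χ.symm i) : ℂ)) with hHE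
  have hUκ : U.submatrix κ κ ∈ Matrix.unitaryGroup _ ℂ := by
    apply mem_unitary_of_mul
    rw [Matrix.conjTranspose_submatrix, Matrix.submatrix_mul_equiv, unitary_mul_conjTranspose hU,
      Matrix.submatrix_one_equiv]
  have hUE' : U.submatrix κ κ * Matrix.diagonal
      (fun i => ((ε i.1 + (hM (φ.symm i.2.1) + hE (χ.symm i.2.2)) : ℝ) : ℂ)) =
      Matrix.diagonal (fun i => ((ε i.1 + (hM (φ.symm i.2.1) + hE (χ.symm i.2.2)) : ℝ) : ℂ)) *
        U.submatrix κ κ :=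
    (mul_diagonal_comm_iff _ _).2 fun i j hij => hUE (κ i) (κ j) hij
  have hH : totalH (spectralMatrix W ε) (totalH HM HE) =
      W1 * Matrix.diagonal
        (fun i => ((ε i.1 + (hM (φ.symm i.2.1) + hE (χ.symm i.2.2)) : ℝ) : ℂ)) * W1ᴴ := by
    rw [hHM, hHE, ← spectralMatrix_one, ← spectralMatrix_one,
      totalH_spectralMatrix (one_mem _) (one_mem _), Matrix.one_kronecker_one,
      totalH_spectralMatrix hW (one_mem _), spectralMatrix]
  have hγ : gibbs HE β = (Matrix.diagonal (fun e => (gibbsProb hE β e : ℂ))).submatrix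
      χ.symm χ.symm := by
    rw [hHE, gibbs_diagonal, Matrix.submatrix_diagonal_equiv]
    congr 1
    ext i
    exact congrArg _ (gibbsProb_comp_equiv hE β χ.symm i)
  have hin : (W * ρ * Wᴴ) ⊗ₖ (ω.submatrix φ.symm φ.symm ⊗ₖ gibbs HE β) =
      W1 * (ρ ⊗ₖ (ω ⊗ₖ Matrix.diagonal (fun e => (gibbsProb hE β e : ℂ)))).submatrix κ κ *
        W1ᴴ := by
    rw [hγ]
    have : (ρ ⊗ₖ (ω ⊗ₖ Matrix.diagonal (fun e => (gibbsProb hE β e : ℂ)))).submatrix κ κ =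
        ρ ⊗ₖ (ω.submatrix φ.symm φ.symm ⊗ₖ
          (Matrix.diagonal (fun e => (gibbsProb hE β e : ℂ))).submatrix χ.symm χ.symm) := rfl
    rw [this, hW1def, Matrix.conjTranspose_kronecker, ← Matrix.mul_kronecker_mul,
      ← Matrix.mul_kronecker_mul, Matrix.conjTranspose_one, Matrix.one_mul, Matrix.mul_one]
  have hc := unitary_conjTranspose_mul hW1
  have hfin : (W1 * U.submatrix κ κ * W1ᴴ) *
      ((W * ρ * Wᴴ) ⊗ₖ (ω.submatrix φ.symm φ.symm ⊗ₖ gibbs HE β)) *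
      (W1 * U.submatrix κ κ * W1ᴴ)ᴴ = W1 * X.submatrix κ κ * W1ᴴ := by
    have h2 : X.submatrix κ κ = U.submatrix κ κ *
        (ρ ⊗ₖ (ω ⊗ₖ Matrix.diagonal (fun e => (gibbsProb hE β e : ℂ)))).submatrix κ κ *
        (U.submatrix κ κ)ᴴ := by
      rw [hX, Matrix.conjTranspose_submatrix, Matrix.submatrix_mul_equiv,
        Matrix.submatrix_mul_equiv]
    rw [hin, h2]
    set Z := (ρ ⊗ₖ (ω ⊗ₖ Matrix.diagonal (fun e => (gibbsProb hE β e : ℂ)))).submatrix κ κ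
    set V := U.submatrix κ κ
    rw [Matrix.conjTranspose_mul, Matrix.conjTranspose_mul, Matrix.conjTranspose_conjTranspose,
      show W1 * V * W1ᴴ * (W1 * Z * W1ᴴ) * (W1 * (Vᴴ * W1ᴴ)) =
        W1 * V * (W1ᴴ * W1) * Z * (W1ᴴ * W1) * Vᴴ * W1ᴴ by simp only [Matrix.mul_assoc], hc]
    simp only [Matrix.mul_assoc, Matrix.one_mul]
  have hleft : traceLeft (W1 * X.submatrix κ κ * W1ᴴ) =
      (traceLeft X).submatrix (Equiv.prodCongr φ.symm χ.symm) (Equiv.prodCongr φ.symm χ.symm) := by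
    rw [hW1def, Matrix.conjTranspose_kronecker, traceLeft_mul_mul _ _ _ _ _
      (unitary_conjTranspose_mul hW), Matrix.conjTranspose_one, Matrix.one_mul, Matrix.mul_one]
    rfl
  have hright : traceRight (traceLeft (W1 * X.submatrix κ κ * W1ᴴ)) =
      (traceRight (traceLeft X)).submatrix φ.symm φ.symm := by
    rw [hleft]
    ext i j
    exact χ.symm.sum_comp (fun k => traceLeft X (φ.symm i, k) (φ.symm j, k))
  have hleft2 : traceLeft (traceLeft (W1 * X.submatrix κ κ * W1ᴴ)) =
      (traceLeft (traceLeft X)).submatrix χ.symm χ.symm := by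
    rw [hleft]
    ext i j
    exact φ.symm.sum_comp (fun k => traceLeft X (k, χ.symm i) (k, χ.symm j))
  have hω' : IsState (ω.submatrix φ.symm φ.symm) := by
    refine ⟨hω.1.submatrix _, ?_⟩
    rw [← hω.2]
    exact φ.symm.sum_comp (fun k => ω k k)
  have hheat : energy HE (traceLeft (traceLeft ((W1 * U.submatrix κ κ * W1ᴴ) *
      ((W * ρ * Wᴴ) ⊗ₖ (ω.submatrix φ.symm φ.symm ⊗ₖ gibbs HE β)) *
      (W1 * U.submatrix κ κ * W1ᴴ)ᴴ)) - gibbs HE β) =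
      ∑ e, hE e * ((traceLeft (traceLeft X) e e).re - gibbsProb hE β e) := by
    rw [hfin, hleft2, energy_sub, hγ, hHE, energy_diagonal, energy_diagonal,
      ← Finset.sum_sub_distrib]
    simp only [Matrix.submatrix_apply, Matrix.diagonal_apply_eq, Complex.ofReal_re, ← mul_sub]
    exact χ.symm.sum_comp
      (fun e => hE e * ((traceLeft (traceLeft X) e e).re - gibbsProb hE β e))
  refine ⟨{
    dM := Fintype.card M
    dE := Fintype.card E
    HM := HM
    HE := HE
    ω := ω.submatrix φ.symm φ.symm
    U := W1 * U.submatrix κ κ * W1ᴴ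
    HM_hermitian := by
      rw [hHM, ← spectralMatrix_one]
      exact spectralMatrix_isHermitian _ _
    HE_hermitian := by
      rw [hHE, ← spectralMatrix_one]
      exact spectralMatrix_isHermitian _ _
    ω_state := hω'
    U_unitary := mul_mem (mul_mem hW1 hUκ) (conjTranspose_mem_unitary hW1)
    U_energy := by
      rw [hH]
      set D : Matrix (S × (Fin (Fintype.card M) × Fin (Fintype.card E))) _ ℂ := Matrix.diagonal
        (fun i => ((ε i.1 + (hM (φ.symm i.2.1) + hE (χ.symm i.2.2)) : ℝ) : ℂ))
      set V := U.submatrix κ κ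
      rw [show W1 * V * W1ᴴ * (W1 * D * W1ᴴ) = W1 * V * (W1ᴴ * W1) * D * W1ᴴ by
          simp only [Matrix.mul_assoc],
        show W1 * D * W1ᴴ * (W1 * V * W1ᴴ) = W1 * D * (W1ᴴ * W1) * V * W1ᴴ by
          simp only [Matrix.mul_assoc], hc, Matrix.mul_one, Matrix.mul_one, Matrix.mul_assoc W1 V D,
        hUE', Matrix.mul_assoc W1 D V]
    memory_returned := by rw [hfin, hright, hret] }, ?_⟩
  exact hheat

end Builder

/-! ### From collective protocols to a returned memory -/

section Catalyst

variable {S : Type*} [Fintype S] [DecidableEq S] {n : ℕ}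

/-- The tensor product `X 0 ⊗ ⋯ ⊗ X (n - 1)`, on the index type of words of length `n`. -/
def tensorProduct (X : Fin n → Matrix S S ℂ) : Matrix (Fin n → S) (Fin n → S) ℂ :=
  Matrix.of fun f g => ∏ i, X i (f i) (g i)

/-- Resetting slot `k` of `n` systems to the state `ρ`. -/
def resetSlot (ρ : Matrix S S ℂ) (k : Fin n) :
    Matrix (Fin n → S) (Fin n → S) ℂ →ₗ[ℂ] Matrix (Fin n → S) (Fin n → S) ℂ where
  toFun Y := Matrix.of fun f g =>
    ρ (f k) (g k) * ∑ s, Y (Function.update f k s) (Function.update g k s)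
  map_add' X Y := by
    ext f g
    simp [Finset.sum_add_distrib, mul_add]
  map_smul' c X := by
    ext f g
    simp [Finset.mul_sum, mul_left_comm]

theorem resetSlot_tensorProduct (ρ : Matrix S S ℂ) (k : Fin n) (X : Fin n → Matrix S S ℂ) :
    resetSlot ρ k (tensorProduct X) = tensorProduct (Function.update X k ((X k).trace • ρ)) := by
  ext f g
  have h1 : ∀ s, ∏ i, X i (Function.update f k s i) (Function.update g k s i) =
      X k s s * ∏ i ∈ Finset.univ.erase k, X i (f i) (g i) := by
    intro s
    rw [← Finset.mul_prod_erase _ _ (Finset.mem_univ k)]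
    congr 1
    · simp
    · refine Finset.prod_congr rfl fun i hi => ?_
      simp [Finset.ne_of_mem_erase hi]
  have h2 : ∏ i, Function.update X k ((X k).trace • ρ) i (f i) (g i) =
      ((X k).trace * ρ (f k) (g k)) * ∏ i ∈ Finset.univ.erase k, X i (f i) (g i) := by
    rw [← Finset.mul_prod_erase _ _ (Finset.mem_univ k)]
    congr 1
    · simp
    · refine Finset.prod_congr rfl fun i hi => ?_
      simp [Finset.ne_of_mem_erase hi]
  simp only [resetSlot, tensorProduct, LinearMap.coe_mk, AddHom.coe_mk, Matrix.of_apply, h1, h2,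
    ← Finset.sum_mul]
  rw [Matrix.trace]
  simp only [Matrix.diag_apply]
  ring

/-- The word obtained from `f` by exchanging its letter `k` with `s`, together with the removed
letter. -/
def swapSlot (k : Fin n) : S × (Fin n → S) ≃ S × (Fin n → S) where
  toFun x := (x.2 k, Function.update x.2 k x.1)
  invFun x := (x.2 k, Function.update x.2 k x.1)
  left_inv x := by simp
  right_inv x := by simp

/-- A slot is reset by exchanging it with a fresh system in the state `ρ`. -/
theorem resetSlot_eq_traceLeft (ρ : Matrix S S ℂ) (k : Fin n)
    (Y : Matrix (Fin n → S) (Fin n → S) ℂ) :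
    resetSlot ρ k Y = traceLeft ((ρ ⊗ₖ Y).submatrix (swapSlot k) (swapSlot k)) := by
  ext f g
  simp [resetSlot, traceLeft, swapSlot, Finset.mul_sum]

theorem IsState.resetSlot {ρ : Matrix S S ℂ} (hρ : IsState ρ) (k : Fin n)
    {Y : Matrix (Fin n → S) (Fin n → S) ℂ} (hY : IsState Y) : IsState (resetSlot ρ k Y) := by
  rw [resetSlot_eq_traceLeft]
  refine IsState.traceLeft ⟨(hρ.kronecker hY).1.submatrix _, ?_⟩
  rw [← (hρ.kronecker hY).2]
  exact (swapSlot k).sum_comp (fun x => (ρ ⊗ₖ Y) x x)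

/-- Resetting the first `k` slots one after another. -/
def resetSlots (ρ : Matrix S S ℂ) (n : ℕ) :
    ℕ → Matrix (Fin n → S) (Fin n → S) ℂ →ₗ[ℂ] Matrix (Fin n → S) (Fin n → S) ℂ
  | 0 => LinearMap.id
  | k + 1 => if h : k < n then resetSlot ρ ⟨k, h⟩ ∘ₗ resetSlots ρ n k else resetSlots ρ n k

theorem resetSlots_tensorProduct (ρ : Matrix S S ℂ) (X : Fin n → Matrix S S ℂ) (k : ℕ) :
    resetSlots ρ n k (tensorProduct X) =
      tensorProduct fun i => if i.1 < k then (X i).trace • ρ else X i := by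
  induction k with
  | zero => simp [resetSlots]
  | succ k ih =>
    rw [resetSlots]
    split_ifs with h
    · rw [LinearMap.comp_apply, ih, resetSlot_tensorProduct]
      congr 1
      ext i : 1
      by_cases hik : i = ⟨k, h⟩
      · subst hik
        simp
      · have : i.1 ≠ k := fun h' => hik (Fin.ext h')
        rw [Function.update_of_ne hik]
        have h3 : i.1 < k + 1 ↔ i.1 < k := by omega
        simp only [h3]
    · rw [ih]
      congr 1
      ext i : 1
      have h1 : i.1 < k := by omega
      have h2 : i.1 < k + 1 := by omega
      simp [h1, h2]

theorem tensorProduct_single (a b : Fin n → S) :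
    tensorProduct (fun i => Matrix.single (a i) (b i) (1 : ℂ)) = Matrix.single a b 1 := by
  ext f g
  simp only [tensorProduct, Matrix.of_apply, Matrix.single_apply]
  by_cases h : a = f ∧ b = g
  · obtain ⟨rfl, rfl⟩ := h
    simp
  · rw [if_neg h]
    have : ∃ i, ¬ (a i = f i ∧ b i = g i) := by
      by_contra hcon
      push Not at hcon
      exact h ⟨funext fun i => (hcon i).1, funext fun i => (hcon i).2⟩
    obtain ⟨i, hi⟩ := this
    exact Finset.prod_eq_zero (Finset.mem_univ i) (if_neg hi)

theorem trace_tensorProduct (X : Fin n → Matrix S S ℂ) :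
    (tensorProduct X).trace = ∏ i, (X i).trace := by
  simp only [Matrix.trace, tensorProduct, Matrix.diag_apply, Matrix.of_apply]
  exact (Fintype.prod_sum (fun i s => X i s s)).symm

/-- Once every slot has been reset, no trace of the initial state is left. -/
theorem resetSlots_self (ρ : Matrix S S ℂ) (Y : Matrix (Fin n → S) (Fin n → S) ℂ) :
    resetSlots ρ n n Y = Y.trace • tensorProduct fun _ => ρ := by
  have h1 : ∀ a b : Fin n → S, resetSlots ρ n n (Matrix.single a b 1) =
      (Matrix.single a b (1 : ℂ)).trace • tensorProduct fun _ => ρ := by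
    intro a b
    rw [← tensorProduct_single, resetSlots_tensorProduct, trace_tensorProduct]
    ext f g
    simp [tensorProduct, Finset.prod_mul_distrib]
  conv_lhs => rw [Matrix.matrix_eq_sum_single Y]
  conv_rhs => rw [Matrix.matrix_eq_sum_single Y]
  rw [map_sum, Matrix.trace_sum, Finset.sum_smul]
  refine Finset.sum_congr rfl fun a _ => ?_
  rw [map_sum, Matrix.trace_sum, Finset.sum_smul]
  refine Finset.sum_congr rfl fun b _ => ?_
  have h2 : Matrix.single a b (Y a b) = Y a b • Matrix.single a b (1 : ℂ) := by
    rw [Matrix.smul_single, smul_eq_mul, mul_one]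
  rw [h2, map_smul, h1, Matrix.trace_smul, smul_assoc]

theorem IsState.resetSlots {ρ : Matrix S S ℂ} (hρ : IsState ρ) (k : ℕ)
    {Y : Matrix (Fin n → S) (Fin n → S) ℂ} (hY : IsState Y) :
    IsState (resetSlots ρ n k Y) := by
  induction k with
  | zero => exact hY
  | succ k ih =>
    rw [HeatWitness.resetSlots]
    split_ifs with h
    · exact hρ.resetSlot _ ih
    · exact ih

theorem IsState.tensorProduct {ρ : Matrix S S ℂ} (hρ : IsState ρ) :
    IsState (tensorProduct fun _ : Fin n => ρ) := by
  have := hρ.nonempty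
  -- the product state results from an arbitrary state by resetting every slot
  have f : Fin n → S := Classical.arbitrary _
  have h1 : IsState (Matrix.single f f (1 : ℂ)) := by
    rw [← Matrix.diagonal_single]
    refine ⟨Matrix.posSemidef_diagonal_iff.2 fun i => ?_, by simp [Matrix.trace_diagonal]⟩
    rw [Pi.single_apply]
    split_ifs <;> simp
  have h2 := hρ.resetSlots n h1
  rwa [resetSlots_self, h1.2, one_smul] at h2

end Catalyst

section Clock

variable {S E : Type*} [Fintype S] [DecidableEq S] [Fintype E] [DecidableEq E] {m : ℕ}

/-- The classical part of one clock cycle, read backwards: if the clock shows `j`, the system is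
exchanged with slot `j - 1` and the clock is set back to `j - 1`. -/
def clockEquiv (S E : Type*) (m : ℕ) :
    S × (((Fin (m + 1) → S) × Fin (m + 1)) × E) ≃ S × (((Fin (m + 1) → S) × Fin (m + 1)) × E) where
  toFun x := (x.2.1.1 (x.2.1.2 - 1),
    ((Function.update x.2.1.1 (x.2.1.2 - 1) x.1, x.2.1.2 - 1), x.2.2))
  invFun x := (x.2.1.1 x.2.1.2, ((Function.update x.2.1.1 x.2.1.2 x.1, x.2.1.2 + 1), x.2.2))
  left_inv x := by simp
  right_inv x := by simp

/-- The controlled part of one clock cycle: `V` acts on the slots and the environment when the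
clock shows zero. -/
def clockControl (V : Matrix ((Fin (m + 1) → S) × E) ((Fin (m + 1) → S) × E) ℂ) :
    Fin (m + 1) → Matrix ((Fin (m + 1) → S) × E) ((Fin (m + 1) → S) × E) ℂ :=
  fun j => if j = 0 then V else 1

/-- Moving the clock to the last position of the index, where `Matrix.blockDiagonal` expects it. -/
def clockLast (R K E : Type*) : (R × K) × E ≃ (R × E) × K where
  toFun x := ((x.1.1, x.2), x.1.2)
  invFun x := ((x.1.1, x.2), x.1.2)
  left_inv _ := rfl
  right_inv _ := rfl

theorem clockControl_mem_unitary
    {V : Matrix ((Fin (m + 1) → S) × E) ((Fin (m + 1) → S) × E) ℂ}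
    (hV : V ∈ Matrix.unitaryGroup _ ℂ) (j : Fin (m + 1)) :
    clockControl V j ∈ Matrix.unitaryGroup _ ℂ := by
  rw [clockControl]
  split_ifs
  · exact hV
  · exact one_mem _

theorem traceRight_blockDiagonal {R K : Type*} [Fintype R] [Fintype K] [DecidableEq K]
    (B : K → Matrix (R × E) (R × E) ℂ) :
    traceRight ((Matrix.blockDiagonal B).submatrix (clockLast R K E) (clockLast R K E)) =
      Matrix.blockDiagonal fun j => traceRight (B j) := by
  ext ⟨f, j⟩ ⟨g, l⟩
  simp only [traceRight, Matrix.of_apply, Matrix.submatrix_apply, clockLast, Equiv.coe_fn_mk,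
    Matrix.blockDiagonal_apply]
  split_ifs <;> simp

theorem traceLeft_blockDiagonal {R K : Type*} [Fintype R] [Fintype K] [DecidableEq K]
    (B : K → Matrix (R × E) (R × E) ℂ) :
    traceLeft ((Matrix.blockDiagonal B).submatrix (clockLast R K E) (clockLast R K E)) =
      ∑ j, traceLeft (B j) := by
  ext e e'
  simp only [traceLeft, Matrix.of_apply, Matrix.submatrix_apply, clockLast, Equiv.coe_fn_mk,
    Matrix.blockDiagonal_apply, Matrix.sum_apply, Fintype.sum_prod_type, if_true]
  exact Finset.sum_comm

theorem blockDiagonal_posSemidef {R K : Type*} [Fintype R] [Fintype K] [DecidableEq K]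
    [DecidableEq R] {B : K → Matrix R R ℂ} (hB : ∀ j, (B j).PosSemidef) :
    (Matrix.blockDiagonal B).PosSemidef := by
  have h : Matrix.blockDiagonal B = ∑ j, B j ⊗ₖ Matrix.diagonal (Pi.single j (1 : ℂ)) := by
    ext ⟨f, j⟩ ⟨g, l⟩
    simp only [Matrix.blockDiagonal_apply, Matrix.sum_apply, Matrix.kroneckerMap_apply,
      Matrix.diagonal_apply]
    split_ifs with h
    · subst h
      rw [Finset.sum_eq_single j] <;> simp +contextual [eq_comm]
    · simp
  rw [h]
  refine Matrix.posSemidef_sum _ fun j _ => (hB j).kronecker ?_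
  refine Matrix.posSemidef_diagonal_iff.2 fun i => ?_
  rw [Pi.single_apply]
  split_ifs <;> simp

/-- Seen from the memory, the exchange resets the slot shown by the clock and advances the clock. -/
theorem traceLeft_submatrix_clockEquiv (ρ : Matrix S S ℂ)
    (x : Fin (m + 1) → Matrix (Fin (m + 1) → S) (Fin (m + 1) → S) ℂ) (γ : Matrix E E ℂ) :
    traceLeft ((ρ ⊗ₖ (Matrix.blockDiagonal x ⊗ₖ γ)).submatrix (clockEquiv S E m)
      (clockEquiv S E m)) = (Matrix.blockDiagonal fun j => resetSlot ρ (j - 1) (x (j - 1)) ⊗ₖ γ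
        ).submatrix (clockLast _ _ E) (clockLast _ _ E) := by
  ext ⟨⟨f, j⟩, e⟩ ⟨⟨g, l⟩, e'⟩
  simp only [traceLeft, Matrix.of_apply, Matrix.submatrix_apply, clockLast, Equiv.coe_fn_mk,
    Matrix.blockDiagonal_apply, clockEquiv, Matrix.kroneckerMap_apply, resetSlot,
    LinearMap.coe_mk, AddHom.coe_mk, sub_left_inj]
  split_ifs with h
  · subst h
    rw [Finset.mul_sum, Finset.sum_mul]
    exact Finset.sum_congr rfl fun s _ => by ring
  · simp

/-- The unitary of one clock cycle. -/
def clockUnitary (V : Matrix ((Fin (m + 1) → S) × E) ((Fin (m + 1) → S) × E) ℂ) :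
    Matrix (S × (((Fin (m + 1) → S) × Fin (m + 1)) × E))
      (S × (((Fin (m + 1) → S) × Fin (m + 1)) × E)) ℂ :=
  ((1 : Matrix S S ℂ) ⊗ₖ (Matrix.blockDiagonal (clockControl V)).submatrix
    (clockLast _ _ E) (clockLast _ _ E)) *
      (1 : Matrix (S × (((Fin (m + 1) → S) × Fin (m + 1)) × E)) _ ℂ).submatrix
        (clockEquiv S E m) id

theorem permutation_conj {n : Type*} [Fintype n] [DecidableEq n] (b : n ≃ n) (Z : Matrix n n ℂ) :
    (1 : Matrix n n ℂ).submatrix b id * Z * ((1 : Matrix n n ℂ).submatrix b id)ᴴ =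
      Z.submatrix b b := by
  ext i j
  simp [Matrix.mul_apply, Matrix.one_apply]

theorem controlled_mem_unitary
    {V : Matrix ((Fin (m + 1) → S) × E) ((Fin (m + 1) → S) × E) ℂ}
    (hV : V ∈ Matrix.unitaryGroup _ ℂ) :
    (Matrix.blockDiagonal (clockControl V)).submatrix (clockLast _ _ E) (clockLast _ _ E) ∈
      Matrix.unitaryGroup (((Fin (m + 1) → S) × Fin (m + 1)) × E) ℂ := by
  apply mem_unitary_of_mul
  rw [Matrix.conjTranspose_submatrix, Matrix.submatrix_mul_equiv,
    Matrix.blockDiagonal_conjTranspose, ← Matrix.blockDiagonal_mul]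
  simp only [unitary_mul_conjTranspose (clockControl_mem_unitary hV _)]
  have h1 : (Matrix.blockDiagonal fun _ : Fin (m + 1) =>
      (1 : Matrix ((Fin (m + 1) → S) × E) ((Fin (m + 1) → S) × E) ℂ)) = 1 :=
    Matrix.blockDiagonal_one
  rw [h1, Matrix.submatrix_one_equiv]

theorem clockUnitary_mem_unitary
    {V : Matrix ((Fin (m + 1) → S) × E) ((Fin (m + 1) → S) × E) ℂ}
    (hV : V ∈ Matrix.unitaryGroup _ ℂ) : clockUnitary V ∈ Matrix.unitaryGroup _ ℂ := by
  refine mul_mem (kronecker_mem_unitary (one_mem _) (controlled_mem_unitary hV)) ?_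
  apply mem_unitary_of_mul
  have h := permutation_conj (clockEquiv S E m)
    (1 : Matrix (S × (((Fin (m + 1) → S) × Fin (m + 1)) × E)) _ ℂ)
  rwa [Matrix.mul_one, Matrix.submatrix_one_equiv] at h

/-- The clock has no energy, and the exchange permutes the letters of the system and the slots. -/
theorem clockUnitary_energy
    {V : Matrix ((Fin (m + 1) → S) × E) ((Fin (m + 1) → S) × E) ℂ} (ε : S → ℝ) (hE : E → ℝ)
    (hVE : ∀ i j, V i j ≠ 0 → ∑ k, ε (i.1 k) + hE i.2 = ∑ k, ε (j.1 k) + hE j.2)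
    (i j : S × (((Fin (m + 1) → S) × Fin (m + 1)) × E)) (hij : clockUnitary V i j ≠ 0) :
    ε i.1 + (∑ k, ε (i.2.1.1 k) + hE i.2.2) = ε j.1 + (∑ k, ε (j.2.1.1 k) + hE j.2.2) := by
  rw [clockUnitary, Matrix.mul_apply] at hij
  obtain ⟨l, -, hl⟩ := Finset.exists_ne_zero_of_sum_ne_zero hij
  have h1 := left_ne_zero_of_mul hl
  have h2 := right_ne_zero_of_mul hl
  have h3 : clockEquiv S E m l = j := by
    by_contra h
    exact h2 (by simp [h])
  rw [Matrix.kroneckerMap_apply] at h1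
  have h4 : i.1 = l.1 := by
    by_contra h
    exact left_ne_zero_of_mul h1 (Matrix.one_apply_ne h)
  have h5 := right_ne_zero_of_mul h1
  rw [Matrix.submatrix_apply, Matrix.blockDiagonal_apply] at h5
  have h6 : ∑ k, ε (i.2.1.1 k) + hE i.2.2 = ∑ k, ε (l.2.1.1 k) + hE l.2.2 := by
    split_ifs at h5 with h
    · rw [clockControl] at h5
      split_ifs at h5 with h0
      · exact hVE _ _ h5
      · have h7 : ((clockLast _ _ E) i.2).1 = ((clockLast _ _ E) l.2).1 := by
          by_contra hne
          exact h5 (Matrix.one_apply_ne hne)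
        have h8 := congrArg Prod.fst h7
        have h9 := congrArg Prod.snd h7
        simp only [clockLast, Equiv.coe_fn_mk] at h8 h9
        rw [h8, h9]
    · exact absurd rfl h5
  rw [h6, h4, ← h3]
  simp only [clockEquiv, Equiv.coe_fn_mk]
  set k₀ := l.2.1.2 - 1
  have h10 := Finset.add_sum_erase Finset.univ (fun k => ε (l.2.1.1 k)) (Finset.mem_univ k₀)
  have h11 := Finset.add_sum_erase Finset.univ
    (fun k => ε (Function.update l.2.1.1 k₀ l.1 k)) (Finset.mem_univ k₀)
  have h12 : ∑ k ∈ Finset.univ.erase k₀, ε (Function.update l.2.1.1 k₀ l.1 k) =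
      ∑ k ∈ Finset.univ.erase k₀, ε (l.2.1.1 k) :=
    Finset.sum_congr rfl fun k hk => by rw [Function.update_of_ne (Finset.ne_of_mem_erase hk)]
  rw [h12, Function.update_self] at h11
  linarith

theorem clockUnitary_conj
    (V : Matrix ((Fin (m + 1) → S) × E) ((Fin (m + 1) → S) × E) ℂ) (ρ : Matrix S S ℂ)
    (x : Fin (m + 1) → Matrix (Fin (m + 1) → S) (Fin (m + 1) → S) ℂ) (γ : Matrix E E ℂ) :
    traceLeft (clockUnitary V * (ρ ⊗ₖ (Matrix.blockDiagonal x ⊗ₖ γ)) * (clockUnitary V)ᴴ) =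
      (Matrix.blockDiagonal fun j => clockControl V j *
        (resetSlot ρ (j - 1) (x (j - 1)) ⊗ₖ γ) * (clockControl V j)ᴴ).submatrix
          (clockLast _ _ E) (clockLast _ _ E) := by
  rw [clockUnitary, Matrix.conjTranspose_mul]
  set Q := (Matrix.blockDiagonal (clockControl V)).submatrix (clockLast _ _ E) (clockLast _ _ E)
    with hQ
  set P := (1 : Matrix (S × (((Fin (m + 1) → S) × Fin (m + 1)) × E))
    (S × (((Fin (m + 1) → S) × Fin (m + 1)) × E)) ℂ).submatrix
    (clockEquiv S E m) id
  set Z := ρ ⊗ₖ (Matrix.blockDiagonal x ⊗ₖ γ)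
  rw [show (1 : Matrix S S ℂ) ⊗ₖ Q * P * Z * (Pᴴ * ((1 : Matrix S S ℂ) ⊗ₖ Q)ᴴ) =
    (1 : Matrix S S ℂ) ⊗ₖ Q * (P * Z * Pᴴ) * ((1 : Matrix S S ℂ) ⊗ₖ Q)ᴴ by
      simp only [Matrix.mul_assoc], permutation_conj, Matrix.conjTranspose_kronecker,
    Matrix.conjTranspose_one, traceLeft_mul_mul _ _ _ _ _ (one_mul _),
    traceLeft_submatrix_clockEquiv, hQ, Matrix.conjTranspose_submatrix,
    Matrix.submatrix_mul_equiv, Matrix.submatrix_mul_equiv, Matrix.blockDiagonal_conjTranspose,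
    ← Matrix.blockDiagonal_mul, ← Matrix.blockDiagonal_mul]

theorem diagonal_gibbsProb_isState [Nonempty E] (hE : E → ℝ) (β : ℝ) :
    IsState (Matrix.diagonal (fun e => (gibbsProb hE β e : ℂ))) := by
  rw [← spectralMatrix_one]
  exact spectralMatrix_isState (one_mem _) (gibbsProb_nonneg hE β) (sum_gibbsProb hE β)

/-- A protocol on `m + 1` copies of the system can be run one copy at a time, with a memory that is
returned exactly, and then delivers its heat divided by the number of copies. The memory consists of
`m + 1` slots and a clock; in each cycle the incoming copy is exchanged with the slot the clock
points at, and the collective unitary acts whenever the clock wraps around. The invariant state of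
the memory is the uniform mixture over the clock of the final state of the collective protocol with
the slots passed so far reset to `ρ`. -/
theorem exists_heatProcess_of_collective [Nonempty E] {W : Matrix S S ℂ}
    (hW : W ∈ Matrix.unitaryGroup S ℂ) (ε : S → ℝ) {ρ : Matrix S S ℂ} (hρ : IsState ρ) (β : ℝ)
    (hE : E → ℝ) {V : Matrix ((Fin (m + 1) → S) × E) ((Fin (m + 1) → S) × E) ℂ}
    (hV : V ∈ Matrix.unitaryGroup _ ℂ)
    (hVE : ∀ i j, V i j ≠ 0 → ∑ k, ε (i.1 k) + hE i.2 = ∑ k, ε (j.1 k) + hE j.2) :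
    ∃ P : HeatProcess β (spectralMatrix W ε) (W * ρ * Wᴴ),
      P.heat = ((m : ℝ) + 1)⁻¹ * ∑ e, hE e * ((traceLeft (V *
        (tensorProduct (fun _ => ρ) ⊗ₖ Matrix.diagonal (fun e => (gibbsProb hE β e : ℂ))) *
          Vᴴ) e e).re - gibbsProb hE β e) := by
  set γ : Matrix E E ℂ := Matrix.diagonal (fun e => (gibbsProb hE β e : ℂ)) with hγ
  have hγs : IsState γ := diagonal_gibbsProb_isState hE β
  set η := V * (tensorProduct (fun _ => ρ) ⊗ₖ γ) * Vᴴ with hη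
  have hηs : IsState η := (hρ.tensorProduct.kronecker hγs).conj hV
  set y : ℕ → Matrix (Fin (m + 1) → S) (Fin (m + 1) → S) ℂ :=
    fun k => resetSlots ρ (m + 1) k (traceRight η) with hy
  have hys : ∀ k, IsState (y k) := fun k => hρ.resetSlots k hηs.traceRight
  set c : ℝ := ((m : ℝ) + 1)⁻¹ with hc
  have hc0 : 0 ≤ c := by positivity
  have hcm : ((m : ℝ) + 1) * c = 1 := mul_inv_cancel₀ (by positivity)
  set x : Fin (m + 1) → Matrix (Fin (m + 1) → S) (Fin (m + 1) → S) ℂ :=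
    fun j => c • y j.1 with hx
  -- a reset leads from one clock position to the next, and the last one restores all copies of `ρ`
  have hstep : ∀ j : Fin (m + 1), j ≠ 0 → resetSlot ρ (j - 1) (y (j - 1).1) = y j.1 := by
    intro j hj
    have h1 : (j - 1).1 = j.1 - 1 := by rw [Fin.coe_sub_one, if_neg hj]
    have h0 : j.1 ≠ 0 := fun h => hj (Fin.ext h)
    obtain ⟨k, hk⟩ := Nat.exists_eq_succ_of_ne_zero h0
    have h2 : j - 1 = ⟨k, by omega⟩ := Fin.ext (by rw [h1, hk]; rfl)
    rw [h2, hk]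
    simp only [hy]
    rw [resetSlots, dif_pos (by omega)]
    rfl
  have hlast : resetSlot ρ ((0 : Fin (m + 1)) - 1) (y ((0 : Fin (m + 1)) - 1).1) =
      tensorProduct fun _ => ρ := by
    have h1 : ((0 : Fin (m + 1)) - 1).1 = m := by rw [Fin.coe_sub_one, if_pos rfl]
    have h2 : (0 : Fin (m + 1)) - 1 = ⟨m, by omega⟩ := Fin.ext h1
    have h3 := resetSlots_self ρ (traceRight η)
    rw [hηs.traceRight.2, one_smul, resetSlots, dif_pos (by omega)] at h3
    rw [h2]
    exact h3
  have hωs : IsState (Matrix.blockDiagonal x) := by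
    refine ⟨blockDiagonal_posSemidef fun j => (hys j).1.smul hc0, ?_⟩
    rw [Matrix.trace_blockDiagonal]
    simp only [hx, Matrix.trace_smul, (hys _).2, Finset.sum_const, Finset.card_univ,
      Fintype.card_fin, Complex.real_smul, mul_one, nsmul_eq_mul]
    exact_mod_cast hcm
  have hblock : ∀ j, clockControl V j * (resetSlot ρ (j - 1) (x (j - 1)) ⊗ₖ γ) *
      (clockControl V j)ᴴ = c • if j = 0 then η else y j.1 ⊗ₖ γ := by
    intro j
    have h1 : resetSlot ρ (j - 1) (x (j - 1)) = c • resetSlot ρ (j - 1) (y (j - 1).1) := by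
      rw [hx]
      simp only
      rw [← Complex.coe_smul, map_smul, Complex.coe_smul]
    rw [h1, Matrix.smul_kronecker, Matrix.mul_smul, Matrix.smul_mul]
    congr 1
    by_cases h : j = 0
    · subst h
      rw [hlast, clockControl, if_pos rfl, if_pos rfl]
    · rw [hstep j h, clockControl, if_neg h, if_neg h, Matrix.one_mul, Matrix.conjTranspose_one,
        Matrix.mul_one]
  have hX := clockUnitary_conj V ρ x γ
  simp only [hblock] at hX
  obtain ⟨P, hP⟩ := exists_heatProcess_of_diagonal hW ε ρ β (fun p => ∑ k, ε (p.1 k)) hE hωs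
    (clockUnitary_mem_unitary hV) (clockUnitary_energy ε hE hVE) rfl (by
      rw [hX, traceRight_blockDiagonal]
      congr 1
      ext j : 1
      rw [traceRight_smul, hx]
      simp only
      congr 1
      split_ifs with h
      · subst h
        simp only [hy]
        rfl
      · rw [traceRight_kronecker, hγs.2, one_smul])
  refine ⟨P, hP.trans ?_⟩
  rw [hX, traceLeft_blockDiagonal, Finset.mul_sum]
  refine Finset.sum_congr rfl fun e _ => ?_
  have h1 : ∀ j : Fin (m + 1), (traceLeft (c • if j = 0 then η else y j.1 ⊗ₖ γ) e e).re =
      if j = 0 then c * (traceLeft η e e).re else c * gibbsProb hE β e := by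
    intro j
    rw [traceLeft_smul]
    split_ifs with h
    · simp
    · rw [traceLeft_kronecker, (hys _).2, one_smul]
      simp [hγ]
  rw [Matrix.sum_apply, Complex.re_sum]
  simp only [h1]
  rw [Fin.sum_univ_succ]
  simp only [if_true, Fin.succ_ne_zero, if_false, Finset.sum_const, Finset.card_univ,
    Fintype.card_fin, nsmul_eq_mul]
  linear_combination (hE e * gibbsProb hE β e) * hcm

end Clock

/-! ### The partial swap with a Gibbs state of selected levels -/

section PartialSwap

variable {R G T : Type*} [Fintype R] [DecidableEq R] [Fintype G] [DecidableEq G] [Fintype T]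
  [DecidableEq T]

/-- Weight of the component of `Ψ` with label `t`. The basis of the system is labelled by `c`, where
`none` marks the states that do not take part in the swap. -/
def sectorWeight (Ψ : R → ℂ) (c : R → Option T) (t : T) : ℝ :=
  ∑ f, if c f = some t then Complex.normSq (Ψ f) else 0

/-- The normalized component of `Ψ` with label `t`. -/
noncomputable def sectorVector (Ψ : R → ℂ) (c : R → Option T) (t : T) (f : R) : ℂ :=
  if c f = some t then ((√(sectorWeight Ψ c t) : ℝ) : ℂ)⁻¹ * Ψ f else 0

variable {Ψ : R → ℂ} {c : R → Option T} {g : G → R}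

theorem one_sub_sum_sectorWeight (hΨ : ∑ f, Complex.normSq (Ψ f) = 1) (c : R → Option T) :
    1 - ∑ t, sectorWeight Ψ c t = ∑ f, if c f = none then Complex.normSq (Ψ f) else 0 := by
  rw [← hΨ, sub_eq_iff_eq_add]
  simp only [sectorWeight]
  rw [Finset.sum_comm, ← Finset.sum_add_distrib]
  refine Finset.sum_congr rfl fun f _ => ?_
  rcases hcf : c f with _ | t <;> simp

theorem sqrt_sectorWeight_ne_zero (hp : ∀ t, 0 < sectorWeight Ψ c t) (t : T) :
    ((√(sectorWeight Ψ c t) : ℝ) : ℂ) ≠ 0 := by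
  exact_mod_cast (Real.sqrt_pos.2 (hp t)).ne'

theorem sqrt_mul_sqrt_sectorWeight (hp : ∀ t, 0 < sectorWeight Ψ c t) (t : T) :
    ((√(sectorWeight Ψ c t) : ℝ) : ℂ) * ((√(sectorWeight Ψ c t) : ℝ) : ℂ) =
      (sectorWeight Ψ c t : ℂ) := by
  rw [← Complex.ofReal_mul, Real.mul_self_sqrt (hp t).le]

theorem sum_star_sectorVector_mul (hp : ∀ t, 0 < sectorWeight Ψ c t) (t : T) :
    ∑ f, star (sectorVector Ψ c t f) * Ψ f = ((√(sectorWeight Ψ c t) : ℝ) : ℂ) := by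
  have h1 : ∀ f, star (sectorVector Ψ c t f) * Ψ f = ((√(sectorWeight Ψ c t) : ℝ) : ℂ)⁻¹ *
      ((if c f = some t then Complex.normSq (Ψ f) else 0 : ℝ) : ℂ) := by
    intro f
    rw [sectorVector]
    split_ifs
    · rw [star_mul', Complex.normSq_eq_conj_mul_self, mul_assoc, Complex.star_def, map_inv₀,
        Complex.conj_ofReal]
    · simp
  simp only [h1, ← Finset.mul_sum, ← Complex.ofReal_sum]
  have h2 : ((∑ f, if c f = some t then Complex.normSq (Ψ f) else 0 : ℝ) : ℂ) =
      (sectorWeight Ψ c t : ℂ) := rfl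
  rw [h2, ← sqrt_mul_sqrt_sectorWeight hp, inv_mul_cancel_left₀ (sqrt_sectorWeight_ne_zero hp t)]

theorem sum_star_sectorVector_mul_sectorVector (hp : ∀ t, 0 < sectorWeight Ψ c t) (t s : T) :
    ∑ f, star (sectorVector Ψ c t f) * sectorVector Ψ c s f = if t = s then 1 else 0 := by
  split_ifs with h
  · subst h
    have h1 : ∀ f, star (sectorVector Ψ c t f) * sectorVector Ψ c t f =
        ((√(sectorWeight Ψ c t) : ℝ) : ℂ)⁻¹ * (star (sectorVector Ψ c t f) * Ψ f) := by
      intro f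
      by_cases hf : c f = some t
      · simp only [sectorVector, if_pos hf]
        ring
      · simp [sectorVector, hf]
    simp only [h1, ← Finset.mul_sum, sum_star_sectorVector_mul hp]
    exact inv_mul_cancel₀ (sqrt_sectorWeight_ne_zero hp t)
  · refine Finset.sum_eq_zero fun f _ => ?_
    by_cases hf : c f = some t
    · have : c f ≠ some s := by
        rw [hf]
        simpa using h
      simp [sectorVector, this]
    · simp [sectorVector, hf]

/-- Column `(a, t)` is the difference between the two vectors exchanged by the partial swap: the
component `t` of `Ψ` next to the environment level `a`, and the basis state `a` next to the
environment level `t`. -/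
noncomputable def swapColumns (Ψ : R → ℂ) (c : R → Option T) (g : G → R) :
    Matrix (R × (G ⊕ T)) (G × T) ℂ :=
  Matrix.of fun i k => Sum.elim
    (fun a => if a = k.1 then sectorVector Ψ c k.2 i.1 else 0)
    (fun t => if t = k.2 then (if i.1 = g k.1 then -1 else 0) else 0) i.2

/-- The partial swap: the reflection that exchanges the two vectors of each column. The columns are
orthogonal with squared norm two, which makes up for the factor two of a reflection. -/
noncomputable def partialSwap (Ψ : R → ℂ) (c : R → Option T) (g : G → R) :
    Matrix (R × (G ⊕ T)) (R × (G ⊕ T)) ℂ :=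
  1 - swapColumns Ψ c g * (swapColumns Ψ c g)ᴴ

theorem swapColumns_conjTranspose_mul (hp : ∀ t, 0 < sectorWeight Ψ c t)
    (hg : Function.Injective g) :
    (swapColumns Ψ c g)ᴴ * swapColumns Ψ c g = (2 : ℂ) • 1 := by
  ext ⟨a, t⟩ ⟨b, s⟩
  rw [Matrix.mul_apply, Fintype.sum_prod_type]
  simp only [Matrix.conjTranspose_apply, swapColumns, Matrix.of_apply, Fintype.sum_sum_type,
    Sum.elim_inl, Sum.elim_inr, Finset.sum_add_distrib]
  have h1 : ∀ f : R, ∑ x : G, star (if x = a then sectorVector Ψ c t f else 0) *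
      (if x = b then sectorVector Ψ c s f else 0) =
      if a = b then star (sectorVector Ψ c t f) * sectorVector Ψ c s f else 0 := by
    intro f
    rw [Finset.sum_eq_single a]
    · simp
    · intro x _ hx
      simp [hx]
    · simp
  have h2 : ∀ f : R, ∑ x : T, star (if x = t then (if f = g a then (-1 : ℂ) else 0) else 0) *
      (if x = s then (if f = g b then (-1 : ℂ) else 0) else 0) =
      if t = s ∧ a = b then (if f = g a then 1 else 0) else 0 := by
    intro f
    rw [Finset.sum_eq_single t]
    · by_cases hts : t = s
      · by_cases hab : a = b
        · subst hab
          by_cases hf : f = g a <;> simp [hts, hf]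
        · by_cases hf : f = g a
          · have : f ≠ g b := fun h => hab (hg (hf.symm.trans h))
            simp [hab, this]
          · simp [hab, hf]
      · simp [hts]
    · intro x _ hx
      simp [hx]
    · simp
  simp only [h1, h2]
  by_cases hab : a = b
  · by_cases hts : t = s
    · simp only [hab, hts, if_true, and_self, sum_star_sectorVector_mul_sectorVector hp]
      simp only [Finset.sum_ite_eq', Finset.mem_univ, if_true, Matrix.smul_apply,
        Matrix.one_apply_eq, smul_eq_mul]
      norm_num
    · have h3 := sum_star_sectorVector_mul_sectorVector hp t s
      rw [if_neg hts] at h3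
      simp only [hab, hts, if_true, false_and, if_false, h3]
      simp [hts]
  · simp [hab]

theorem partialSwap_mem_unitary (hp : ∀ t, 0 < sectorWeight Ψ c t)
    (hg : Function.Injective g) : partialSwap Ψ c g ∈ Matrix.unitaryGroup _ ℂ := by
  apply mem_unitary_of_mul
  have h := swapColumns_conjTranspose_mul hp hg
  rw [partialSwap]
  set D := swapColumns Ψ c g
  rw [Matrix.conjTranspose_sub, Matrix.conjTranspose_one, Matrix.conjTranspose_mul,
    Matrix.conjTranspose_conjTranspose, Matrix.sub_mul, Matrix.one_mul, Matrix.mul_sub,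
    Matrix.mul_one, show D * Dᴴ * (D * Dᴴ) = D * (Dᴴ * D) * Dᴴ by simp only [Matrix.mul_assoc], h,
    Matrix.mul_smul, Matrix.mul_one, Matrix.smul_mul, two_smul]
  abel

/-- Column `(a, t)` of `swapColumns` is supported on the energy `eT t + εR (g a)`. -/
theorem partialSwap_energy (εR : R → ℝ) (eT : T → ℝ) (hc : ∀ f t, c f = some t → εR f = eT t)
    (i j : R × (G ⊕ T)) (hij : partialSwap Ψ c g i j ≠ 0) :
    εR i.1 + Sum.elim (fun a => εR (g a)) eT i.2 =
      εR j.1 + Sum.elim (fun a => εR (g a)) eT j.2 := by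
  have key : ∀ i : R × (G ⊕ T), ∀ k : G × T, swapColumns Ψ c g i k ≠ 0 →
      εR i.1 + Sum.elim (fun a => εR (g a)) eT i.2 = eT k.2 + εR (g k.1) := by
    rintro ⟨f, a | t⟩ ⟨b, s⟩ h
    · simp only [swapColumns, Matrix.of_apply, Sum.elim_inl, sectorVector] at h ⊢
      split_ifs at h with h1 h2
      · rw [hc f s h2, h1]
      · exact absurd rfl h
      · exact absurd rfl h
    · simp only [swapColumns, Matrix.of_apply, Sum.elim_inr] at h ⊢
      split_ifs at h with h1 h2
      · rw [h2, h1, add_comm]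
      · exact absurd rfl h
      · exact absurd rfl h
  by_cases h0 : i = j
  · rw [h0]
  · rw [partialSwap, Matrix.sub_apply, Matrix.one_apply_ne h0, zero_sub, neg_ne_zero,
      Matrix.mul_apply] at hij
    obtain ⟨k, -, hk⟩ := Finset.exists_ne_zero_of_sum_ne_zero hij
    have h1 := left_ne_zero_of_mul hk
    have h2 := right_ne_zero_of_mul hk
    rw [Matrix.conjTranspose_apply, star_ne_zero] at h2
    rw [key i k h1, key j k h2]

/-- Final population of the environment level `e` when the initial one is diagonal. -/
theorem traceLeft_conj_apply {E : Type*} [Fintype E] [DecidableEq E]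
    (V : Matrix (R × E) (R × E) ℂ) (Ψ : R → ℂ) (π : E → ℝ) (e : E) :
    (traceLeft (V * (Matrix.vecMulVec Ψ (star Ψ) ⊗ₖ Matrix.diagonal (fun e => (π e : ℂ))) *
      Vᴴ) e e).re = ∑ e₀, π e₀ * ∑ f, Complex.normSq (∑ f', V (f, e) (f', e₀) * Ψ f') := by
  have h1 : ∀ f, (V * (Matrix.vecMulVec Ψ (star Ψ) ⊗ₖ Matrix.diagonal (fun e => (π e : ℂ))) *
      Vᴴ) (f, e) (f, e) =
      ((∑ e₀, π e₀ * Complex.normSq (∑ f', V (f, e) (f', e₀) * Ψ f') : ℝ) : ℂ) := by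
    intro f
    rw [Matrix.mul_assoc, Matrix.mul_apply]
    simp only [Matrix.mul_apply, Matrix.conjTranspose_apply, Fintype.sum_prod_type,
      Matrix.kroneckerMap_apply, Matrix.vecMulVec_apply, Matrix.diagonal_apply, Pi.star_apply]
    simp only [mul_ite, mul_zero, ite_mul, zero_mul, Finset.sum_ite_eq, Finset.mem_univ, if_true]
    rw [Finset.sum_comm, Complex.ofReal_sum]
    refine Finset.sum_congr rfl fun e₀ _ => ?_
    rw [Complex.ofReal_mul, Complex.normSq_eq_conj_mul_self, map_sum, mul_comm (∑ _, _),
      Finset.sum_mul_sum, Finset.mul_sum]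
    refine Finset.sum_congr rfl fun f' _ => ?_
    rw [Finset.mul_sum, Finset.mul_sum]
    refine Finset.sum_congr rfl fun f'' _ => ?_
    simp only [map_mul, Complex.star_def]
    ring
  simp only [traceLeft, Matrix.of_apply, h1, Complex.re_sum, Complex.ofReal_re]
  rw [Finset.sum_comm]
  simp only [← Finset.mul_sum]

theorem partialSwap_mulVec (e e₀ : G ⊕ T) (f : R) :
    ∑ f', partialSwap Ψ c g (f, e) (f', e₀) * Ψ f' =
      (if e = e₀ then Ψ f else 0) - ∑ k, swapColumns Ψ c g (f, e) k *
        ∑ f', star (swapColumns Ψ c g (f', e₀) k) * Ψ f' := by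
  simp only [partialSwap, Matrix.sub_apply, sub_mul, Finset.sum_sub_distrib, Matrix.mul_apply,
    Matrix.conjTranspose_apply, Finset.sum_mul]
  congr 1
  · rw [Finset.sum_eq_single f]
    · simp [Matrix.one_apply]
    · intro f' _ hf'
      simp [hf'.symm]
    · simp
  · rw [Finset.sum_comm]
    simp only [Finset.mul_sum, mul_assoc]

theorem swapColumns_inner_inl (hp : ∀ t, 0 < sectorWeight Ψ c t) (a : G) (k : G × T) :
    ∑ f', star (swapColumns Ψ c g (f', Sum.inl a) k) * Ψ f' =
      if a = k.1 then ((√(sectorWeight Ψ c k.2) : ℝ) : ℂ) else 0 := by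
  simp only [swapColumns, Matrix.of_apply, Sum.elim_inl]
  split_ifs
  · exact sum_star_sectorVector_mul hp k.2
  · simp

theorem swapColumns_inner_inr (t : T) (k : G × T) :
    ∑ f', star (swapColumns Ψ c g (f', Sum.inr t) k) * Ψ f' =
      if t = k.2 then -Ψ (g k.1) else 0 := by
  simp only [swapColumns, Matrix.of_apply, Sum.elim_inr]
  split_ifs
  · rw [Finset.sum_eq_single (g k.1)] <;> simp +contextual
  · simp

/-- An environment in the level `a` stays there on the component of `Ψ` without label. -/
theorem partialSwap_inl_inl (hp : ∀ t, 0 < sectorWeight Ψ c t) (a b : G) (f : R) :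
    ∑ f', partialSwap Ψ c g (f, Sum.inl b) (f', Sum.inl a) * Ψ f' =
      if b = a ∧ c f = none then Ψ f else 0 := by
  rw [partialSwap_mulVec]
  simp only [swapColumns_inner_inl hp, Fintype.sum_prod_type]
  simp only [swapColumns, Matrix.of_apply, Sum.elim_inl, mul_ite, mul_zero, ite_mul, zero_mul]
  have h0 : ∀ t, sectorVector Ψ c t f * ((√(sectorWeight Ψ c t) : ℝ) : ℂ) =
      if c f = some t then Ψ f else 0 := by
    intro t
    rw [sectorVector]
    split_ifs
    · rw [mul_right_comm, inv_mul_cancel₀ (sqrt_sectorWeight_ne_zero hp t), one_mul]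
    · simp
  simp only [h0]
  rw [Finset.sum_eq_single a]
  · by_cases hba : b = a
    · subst hba
      simp only [if_true, true_and]
      rcases hcf : c f with _ | t
      · simp
      · simp
    · simp [hba]
  · intro x _ hx
    simp [hx.symm]
  · simp

/-- The component of `Ψ` with label `t` takes the environment from the level `a` to `t` and leaves the
system in the basis state `g a`. -/
theorem partialSwap_inr_inl (hp : ∀ t, 0 < sectorWeight Ψ c t) (a : G) (t : T) (f : R) :
    ∑ f', partialSwap Ψ c g (f, Sum.inr t) (f', Sum.inl a) * Ψ f' =
      if f = g a then ((√(sectorWeight Ψ c t) : ℝ) : ℂ) else 0 := by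
  rw [partialSwap_mulVec]
  simp only [swapColumns_inner_inl hp, Fintype.sum_prod_type]
  simp only [swapColumns, Matrix.of_apply, Sum.elim_inr]
  rw [Finset.sum_eq_single a, Finset.sum_eq_single t]
  · by_cases h : f = g a <;> simp [h]
  · intro s _ hs
    simp [hs.symm]
  · simp
  · intro x _ hx
    simp [hx.symm]
  · simp

/-- The reverse exchange: an environment in the level `t` absorbs the basis state `g a`. -/
theorem partialSwap_inl_inr (a : G) (t : T) (f : R) :
    ∑ f', partialSwap Ψ c g (f, Sum.inl a) (f', Sum.inr t) * Ψ f' =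
      sectorVector Ψ c t f * Ψ (g a) := by
  rw [partialSwap_mulVec]
  simp only [swapColumns_inner_inr, Fintype.sum_prod_type]
  simp only [swapColumns, Matrix.of_apply, Sum.elim_inl]
  rw [Finset.sum_eq_single a, Finset.sum_eq_single t]
  · simp
  · intro s _ hs
    simp [hs.symm]
  · simp
  · intro x _ hx
    simp [hx.symm]
  · simp

/-- An environment in the level `t` stays there on the basis states that are not selected by `g`. -/
theorem partialSwap_inr_inr (hg : Function.Injective g) (s t : T) (f : R) :
    ∑ f', partialSwap Ψ c g (f, Sum.inr s) (f', Sum.inr t) * Ψ f' =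
      if s = t ∧ f ∉ Set.range g then Ψ f else 0 := by
  rw [partialSwap_mulVec]
  simp only [swapColumns_inner_inr, Fintype.sum_prod_type]
  simp only [swapColumns, Matrix.of_apply, Sum.elim_inr]
  have h0 : ∀ x : G, ∑ y : T, (if s = y then (if f = g x then (-1 : ℂ) else 0) else 0) *
      (if t = y then -Ψ (g x) else 0) = if s = t then (if f = g x then Ψ (g x) else 0) else 0 := by
    intro x
    rw [Finset.sum_eq_single s]
    · by_cases hst : s = t
      · subst hst
        by_cases hf : f = g x <;> simp [hf]
      · simp [hst, Ne.symm hst]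
    · intro y _ hy
      simp [hy.symm]
    · simp
  simp only [h0]
  by_cases hst : s = t
  · subst hst
    by_cases hf : f ∈ Set.range g
    · obtain ⟨b, rfl⟩ := hf
      simp [hg.eq_iff]
    · have : ∀ x, f ≠ g x := fun x h => hf ⟨x, h.symm⟩
      simp [hf, this]
  · simp [hst]

/-- The heat of the partial swap, in terms of the initial populations `π` of the environment, the
weights of the components of `Ψ`, and its weights on the selected levels. -/
theorem heat_partialSwap (hp : ∀ t, 0 < sectorWeight Ψ c t) (hg : Function.Injective g)
    (hΨ : ∑ f, Complex.normSq (Ψ f) = 1) (π : G ⊕ T → ℝ) (εR : R → ℝ) (eT : T → ℝ) :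
    ∑ e, Sum.elim (fun a => εR (g a)) eT e * ((traceLeft (partialSwap Ψ c g *
      (Matrix.vecMulVec Ψ (star Ψ) ⊗ₖ Matrix.diagonal (fun e => (π e : ℂ))) *
        (partialSwap Ψ c g)ᴴ) e e).re - π e) =
    ∑ a, ∑ t, (π (Sum.inl a) * sectorWeight Ψ c t -
      π (Sum.inr t) * Complex.normSq (Ψ (g a))) * (eT t - εR (g a)) := by
  have hnone : ∑ f, Complex.normSq (if c f = none then Ψ f else 0) =
      1 - ∑ t, sectorWeight Ψ c t := by
    rw [one_sub_sum_sectorWeight hΨ]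
    exact Finset.sum_congr rfl fun f _ => by split_ifs <;> simp
  have hout : ∑ f, Complex.normSq (if f ∉ Set.range g then Ψ f else 0) =
      1 - ∑ a, Complex.normSq (Ψ (g a)) := by
    classical
    rw [← hΨ, eq_sub_iff_add_eq]
    have : ∑ a, Complex.normSq (Ψ (g a)) =
        ∑ f, if f ∈ Set.range g then Complex.normSq (Ψ f) else 0 := by
      rw [← Finset.sum_filter]
      have h1 : Finset.univ.filter (fun f => f ∈ Set.range g) = Finset.univ.image g := by
        ext f
        simp
      rw [h1, Finset.sum_image fun x _ y _ h => hg h]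
    rw [this, ← Finset.sum_add_distrib]
    refine Finset.sum_congr rfl fun f _ => ?_
    by_cases h : f ∈ Set.range g <;> simp [h]
  have hunit : ∀ t, ∑ f, Complex.normSq (sectorVector Ψ c t f) = 1 := by
    intro t
    have h := sum_star_sectorVector_mul_sectorVector hp t t
    rw [if_pos rfl] at h
    have h2 : ∀ f, star (sectorVector Ψ c t f) * sectorVector Ψ c t f =
        (Complex.normSq (sectorVector Ψ c t f) : ℂ) :=
      fun f => Complex.normSq_eq_conj_mul_self.symm
    simp only [h2, ← Complex.ofReal_sum] at h
    exact_mod_cast h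
  -- the final populations of the two groups of levels
  have hL : ∀ b, (traceLeft (partialSwap Ψ c g *
      (Matrix.vecMulVec Ψ (star Ψ) ⊗ₖ Matrix.diagonal (fun e => (π e : ℂ))) *
        (partialSwap Ψ c g)ᴴ) (Sum.inl b) (Sum.inl b)).re =
      π (Sum.inl b) * (1 - ∑ t, sectorWeight Ψ c t) +
        ∑ t, π (Sum.inr t) * Complex.normSq (Ψ (g b)) := by
    intro b
    rw [traceLeft_conj_apply, Fintype.sum_sum_type]
    simp only [partialSwap_inl_inl hp, partialSwap_inl_inr, Complex.normSq_mul, ← Finset.sum_mul,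
      hunit, one_mul]
    congr 1
    rw [Finset.sum_eq_single b]
    · simp only [true_and, hnone]
    · intro a _ ha
      simp [ha.symm]
    · simp
  have hR : ∀ s, (traceLeft (partialSwap Ψ c g *
      (Matrix.vecMulVec Ψ (star Ψ) ⊗ₖ Matrix.diagonal (fun e => (π e : ℂ))) *
        (partialSwap Ψ c g)ᴴ) (Sum.inr s) (Sum.inr s)).re =
      ∑ a, π (Sum.inl a) * sectorWeight Ψ c s +
        π (Sum.inr s) * (1 - ∑ a, Complex.normSq (Ψ (g a))) := by
    intro s
    rw [traceLeft_conj_apply, Fintype.sum_sum_type]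
    simp only [partialSwap_inr_inl hp, partialSwap_inr_inr hg]
    congr 1
    · refine Finset.sum_congr rfl fun a _ => ?_
      rw [Finset.sum_eq_single (g a)]
      · rw [if_pos rfl, Complex.normSq_ofReal, Real.mul_self_sqrt (hp s).le]
      · intro f _ hf
        simp [hf]
      · simp
    · rw [Finset.sum_eq_single s]
      · simp only [true_and, hout]
      · intro t _ ht
        simp [ht.symm]
      · simp
  rw [Fintype.sum_sum_type]
  simp only [hL, hR, Sum.elim_inl, Sum.elim_inr]
  have e1 : ∀ a t, (π (Sum.inl a) * sectorWeight Ψ c t -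
      π (Sum.inr t) * Complex.normSq (Ψ (g a))) * (eT t - εR (g a)) =
      (eT t * (π (Sum.inl a) * sectorWeight Ψ c t) -
        eT t * π (Sum.inr t) * Complex.normSq (Ψ (g a))) +
      (εR (g a) * (π (Sum.inr t) * Complex.normSq (Ψ (g a))) -
        εR (g a) * π (Sum.inl a) * sectorWeight Ψ c t) := fun a t => by ring
  simp only [e1, Finset.sum_add_distrib, Finset.sum_sub_distrib]
  rw [Finset.sum_comm (f := fun a t => eT t * (π (Sum.inl a) * sectorWeight Ψ c t)),
    Finset.sum_comm (f := fun a t => eT t * π (Sum.inr t) * Complex.normSq (Ψ (g a)))]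
  simp only [← Finset.mul_sum]
  have e2 : ∀ a, εR (g a) * (π (Sum.inl a) * (1 - ∑ t, sectorWeight Ψ c t) +
      ∑ t, π (Sum.inr t) * Complex.normSq (Ψ (g a)) - π (Sum.inl a)) =
      εR (g a) * ∑ t, π (Sum.inr t) * Complex.normSq (Ψ (g a)) -
        εR (g a) * π (Sum.inl a) * ∑ t, sectorWeight Ψ c t := fun a => by ring
  have e3 : ∀ s, eT s * (∑ a, π (Sum.inl a) * sectorWeight Ψ c s +
      π (Sum.inr s) * (1 - ∑ a, Complex.normSq (Ψ (g a))) - π (Sum.inr s)) =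
      eT s * ∑ a, π (Sum.inl a) * sectorWeight Ψ c s -
        eT s * π (Sum.inr s) * ∑ a, Complex.normSq (Ψ (g a)) := fun s => by ring
  simp only [e2, e3, Finset.sum_sub_distrib]
  ring

end PartialSwap

/-! ### Concentration of the energy of many copies -/

section Concentration

variable {S : Type*} [Fintype S] [DecidableEq S] {n : ℕ}

/-- The product distribution on words of length `n`. -/
def productWeight (p : S → ℝ) (f : Fin n → S) : ℝ := ∏ i, p (f i)

theorem productWeight_nonneg {p : S → ℝ} (hp : ∀ s, 0 ≤ p s) (f : Fin n → S) :
    0 ≤ productWeight p f := Finset.prod_nonneg fun _ _ => hp _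

theorem sum_productWeight {p : S → ℝ} (h1 : ∑ s, p s = 1) :
    ∑ f : Fin n → S, productWeight p f = 1 := by
  have := Fintype.prod_sum (fun (_ : Fin n) s => p s)
  simp only [h1, Finset.prod_const_one] at this
  exact this.symm

theorem sum_productWeight_mul_mul {p X : S → ℝ} (h1 : ∑ s, p s = 1) (hX : ∑ s, p s * X s = 0)
    (i j : Fin n) : ∑ f : Fin n → S, productWeight p f * (X (f i) * X (f j)) =
      if i = j then ∑ s, p s * X s ^ 2 else 0 := by
  have h2 := Fintype.prod_sum (fun (k : Fin n) s =>
    p s * ((if k = i then X s else 1) * (if k = j then X s else 1)))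
  have h3 : ∀ f : Fin n → S, ∏ k, (p (f k) * ((if k = i then X (f k) else 1) *
      (if k = j then X (f k) else 1))) = productWeight p f * (X (f i) * X (f j)) := by
    intro f
    simp only [Finset.prod_mul_distrib, Finset.prod_ite_eq', Finset.mem_univ, if_true, productWeight]
  simp only [h3] at h2
  rw [← h2]
  split_ifs with h
  · subst h
    rw [Finset.prod_eq_single i]
    · simp only [if_true, sq]
    · intro k _ hk
      simpa [hk] using h1
    · simp
  · refine Finset.prod_eq_zero (Finset.mem_univ i) ?_
    simpa [h] using hX

/-- The variance of a sum of independent centred variables. -/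
theorem sum_productWeight_mul_sq {p X : S → ℝ} (h1 : ∑ s, p s = 1) (hX : ∑ s, p s * X s = 0) :
    ∑ f : Fin n → S, productWeight p f * (∑ i, X (f i)) ^ 2 = n * ∑ s, p s * X s ^ 2 := by
  have h2 : ∀ f : Fin n → S, productWeight p f * (∑ i, X (f i)) ^ 2 =
      ∑ i, ∑ j, productWeight p f * (X (f i) * X (f j)) := by
    intro f
    rw [sq, Finset.sum_mul_sum, Finset.mul_sum]
    exact Finset.sum_congr rfl fun i _ => Finset.mul_sum _ _ _
  simp only [h2]
  rw [Finset.sum_comm]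
  have h3 : ∀ i : Fin n, ∑ f : Fin n → S, ∑ j, productWeight p f * (X (f i) * X (f j)) =
      ∑ s, p s * X s ^ 2 := by
    intro i
    rw [Finset.sum_comm]
    simp only [sum_productWeight_mul_mul h1 hX]
    simp
  simp only [h3, Finset.sum_const, Finset.card_univ, Fintype.card_fin, nsmul_eq_mul]

/-- Chebyshev's inequality for the energy per copy. -/
theorem sum_productWeight_deviation_le {p : S → ℝ} (hp : ∀ s, 0 ≤ p s) (h1 : ∑ s, p s = 1)
    (ε : S → ℝ) {δ : ℝ} (hδ : 0 < δ) (hn : 0 < n) :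
    ∑ f : Fin n → S, (if |∑ i, ε (f i) - n * ∑ s, p s * ε s| ≤ n * δ then 0
      else productWeight p f) ≤ (∑ s, p s * (ε s - ∑ s, p s * ε s) ^ 2) / δ ^ 2 / n := by
  set μ := ∑ s, p s * ε s with hμ
  set X : S → ℝ := fun s => ε s - μ with hXdef
  have hX : ∑ s, p s * X s = 0 := by
    simp only [hXdef, mul_sub, Finset.sum_sub_distrib, ← Finset.sum_mul, h1, one_mul]
    rw [← hμ, sub_self]
  have hn' : (0 : ℝ) < n := by exact_mod_cast hn
  have h2 : ∀ f : Fin n → S, ∑ i, X (f i) = ∑ i, ε (f i) - n * μ := by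
    intro f
    simp [hXdef, Finset.sum_sub_distrib]
  have h3 := sum_productWeight_mul_sq (n := n) h1 hX
  have h4 : ∀ f : Fin n → S, (if |∑ i, ε (f i) - n * μ| ≤ n * δ then 0
      else productWeight p f) ≤ (n * δ)⁻¹ ^ 2 * (productWeight p f * (∑ i, X (f i)) ^ 2) := by
    intro f
    rw [h2]
    split_ifs with h
    · exact mul_nonneg (sq_nonneg _) (mul_nonneg (productWeight_nonneg hp f) (sq_nonneg _))
    · push Not at h
      have h5 : (n * δ) ^ 2 ≤ (∑ i, ε (f i) - n * μ) ^ 2 := by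
        rw [← sq_abs (∑ i, ε (f i) - n * μ)]
        exact pow_le_pow_left₀ (by positivity) h.le 2
      calc productWeight p f = (n * δ)⁻¹ ^ 2 * (productWeight p f * (n * δ) ^ 2) := by
            field_simp
        _ ≤ _ := by
            have := productWeight_nonneg hp f
            gcongr
  calc _ ≤ ∑ f : Fin n → S, (n * δ)⁻¹ ^ 2 * (productWeight p f * (∑ i, X (f i)) ^ 2) :=
        Finset.sum_le_sum fun f _ => h4 f
    _ = (n * δ)⁻¹ ^ 2 * (n * ∑ s, p s * X s ^ 2) := by rw [← Finset.mul_sum, h3]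
    _ = _ := by
        simp only [hXdef]
        field_simp

/-- The number of occurrences of each letter in a word. -/
def letterCount (f : Fin n → S) (s : S) : Fin (n + 1) :=
  ⟨(Finset.univ.filter fun i => f i = s).card, by
    have := (Finset.univ.filter fun i => f i = s).card_le_univ
    rw [Fintype.card_fin] at this
    omega⟩

theorem sum_letterCount_mul (ε : S → ℝ) (f : Fin n → S) :
    ∑ s, ((letterCount f s : ℕ) : ℝ) * ε s = ∑ i, ε (f i) := by
  rw [← Finset.sum_fiberwise (s := Finset.univ) (g := f)]
  refine Finset.sum_congr rfl fun s _ => ?_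
  rw [Finset.sum_congr rfl fun i hi => by rw [(Finset.mem_filter.1 hi).2], Finset.sum_const,
    nsmul_eq_mul]
  rfl

theorem productWeight_gibbsProb [Nonempty S] (ε : S → ℝ) (y : ℝ) (f : Fin n → S) :
    productWeight (gibbsProb ε y) f =
      Real.exp (-y * ∑ i, ε (f i)) / partition ε y ^ n := by
  simp only [productWeight, gibbsProb, Finset.prod_div_distrib, ← Real.exp_sum,
    ← Finset.mul_sum]
  simp

end Concentration

/-! ### The heat of a swap between typical levels -/

section Estimate

/-- If all transition energies lie within `2δ` of `D`, the heat of the partial swap is close to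
`D` as soon as the environment populates the levels `T` rarely and most of the weight of the system
state is selected. -/
theorem abs_heat_sub_le {G T : Type*} [Fintype G] [Fintype T] {πG : G → ℝ} {πT : T → ℝ}
    {p : T → ℝ} {P : G → ℝ} {d : G → T → ℝ} {D δ : ℝ} (hδ : 0 ≤ δ) (hπG : ∀ a, 0 ≤ πG a)
    (hπT : ∀ t, 0 ≤ πT t) (hπ : ∑ a, πG a + ∑ t, πT t = 1) (hp : ∀ t, 0 ≤ p t)
    (hp1 : ∑ t, p t ≤ 1) (hP : ∀ a, 0 ≤ P a) (hP1 : ∑ a, P a ≤ 1)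
    (hd : ∀ a t, |d a t - D| ≤ 2 * δ) :
    |∑ a, ∑ t, (πG a * p t - πT t * P a) * d a t - D| ≤
      2 * δ + (1 - ∑ t, p t) * |D| + (∑ t, πT t) * (2 * |D| + 2 * δ) := by
  set x := ∑ a, πG a with hx
  set y := ∑ t, πT t with hy
  set p0 := ∑ t, p t with hp0
  set P0 := ∑ a, P a with hP0
  have hx0 : 0 ≤ x := Finset.sum_nonneg fun a _ => hπG a
  have hy0 : 0 ≤ y := Finset.sum_nonneg fun a _ => hπT a
  have hp00 : 0 ≤ p0 := Finset.sum_nonneg fun a _ => hp a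
  have hP00 : 0 ≤ P0 := Finset.sum_nonneg fun a _ => hP a
  have e1 : ∑ a, ∑ t, (πG a * p t - πT t * P a) * d a t =
      ∑ a, ∑ t, (πG a * p t - πT t * P a) * (d a t - D) + (x * p0 - y * P0) * D := by
    have : ∀ a t, (πG a * p t - πT t * P a) * d a t =
      (πG a * p t - πT t * P a) * (d a t - D) + (πG a * p t * D - P a * πT t * D) :=
      fun a t => by ring
    simp only [this, Finset.sum_add_distrib, Finset.sum_sub_distrib]
    congr 1
    rw [hx, hy, hp0, hP0, mul_comm (∑ t, πT t), Finset.sum_mul_sum, Finset.sum_mul_sum, sub_mul,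
      Finset.sum_mul, Finset.sum_mul]
    simp only [Finset.sum_mul]
  have e2 : |∑ a, ∑ t, (πG a * p t - πT t * P a) * (d a t - D)| ≤ (x * p0 + y * P0) * (2 * δ) := by
    calc _ ≤ ∑ a, ∑ t, (πG a * p t + P a * πT t) * (2 * δ) := by
          refine (Finset.abs_sum_le_sum_abs _ _).trans (Finset.sum_le_sum fun a _ => ?_)
          refine (Finset.abs_sum_le_sum_abs _ _).trans (Finset.sum_le_sum fun t _ => ?_)
          rw [abs_mul]
          refine mul_le_mul ?_ (hd a t) (abs_nonneg _) ?_
          · have h1 := mul_nonneg (hπG a) (hp t)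
            have h2 := mul_nonneg (hP a) (hπT t)
            rw [abs_le]
            constructor <;> linarith
          · have h1 := mul_nonneg (hπG a) (hp t)
            have h2 := mul_nonneg (hP a) (hπT t)
            linarith
      _ = _ := by
          simp only [← Finset.sum_mul, Finset.sum_add_distrib, ← Finset.mul_sum]
          ring
  rw [e1]
  have e3 : ∑ a, ∑ t, (πG a * p t - πT t * P a) * (d a t - D) + (x * p0 - y * P0) * D - D =
      ∑ a, ∑ t, (πG a * p t - πT t * P a) * (d a t - D) + (x * p0 - y * P0 - 1) * D := by ring
  rw [e3]
  refine (abs_add_le _ _).trans ?_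
  rw [abs_mul]
  have h1 : x * p0 ≤ 1 := mul_le_one₀ (by linarith) hp00 hp1
  have h2 : y * P0 ≤ y := mul_le_of_le_one_right hy0 hP1
  have h3 : 0 ≤ y * P0 := mul_nonneg hy0 hP00
  have h4 : 1 - p0 - y ≤ 1 - p0 := by linarith
  have h5 : |x * p0 - y * P0 - 1| ≤ (1 - p0) + 2 * y := by
    have h6 : x * p0 ≥ p0 - y := by
      have : x = 1 - y := by linarith
      rw [this]
      nlinarith
    rw [abs_le]
    constructor <;> linarith
  have h7 := mul_le_mul_of_nonneg_right h5 (abs_nonneg D)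
  have h8 : (x * p0 + y * P0) * (2 * δ) ≤ (1 + y) * (2 * δ) :=
    mul_le_mul_of_nonneg_right (by linarith) (by linarith)
  nlinarith

end Estimate

/-! ### Pure states reach every Gibbs energy compatible with their free energy -/

section Achievability

variable {S : Type*} [Fintype S] [DecidableEq S]

theorem tensorProduct_vecMulVec {n : ℕ} (φ : S → ℂ) :
    tensorProduct (fun _ : Fin n => Matrix.vecMulVec φ (star φ)) =
      Matrix.vecMulVec (fun f : Fin n → S => ∏ i, φ (f i))
        (star fun f : Fin n → S => ∏ i, φ (f i)) := by
  ext f g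
  simp [tensorProduct, Matrix.vecMulVec_apply, Finset.prod_mul_distrib]

theorem normSq_prod {n : ℕ} (φ : S → ℂ) (f : Fin n → S) :
    Complex.normSq (∏ i, φ (f i)) = productWeight (fun s => Complex.normSq (φ s)) f :=
  map_prod Complex.normSq _ _

/-- The protocol on `m + 1` copies of the pure state `φ`. The environment has one level for each word
whose energy is typical for the Gibbs state at `y`, and one for each typical letter count of `φ`.
Atypical words have weight at most `v₀ / (m + 1)` under `φ` and `v₁ / (m + 1)` under the Gibbs state,
by Chebyshev's inequality, and `κ` is the rate at which the thermal population of the second group of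
levels decays; `hhalf` ensures that at least half of the Gibbs weight is typical. -/
theorem exists_heatProcess_le {W : Matrix S S ℂ} (hW : W ∈ Matrix.unitaryGroup S ℂ) (ε : S → ℝ)
    {φ : S → ℂ} (hφ : ∑ s, Complex.normSq (φ s) = 1) {β : ℝ} (hβ : 0 < β) (y : ℝ) {δ : ℝ}
    (hδ : 0 < δ) (m : ℕ) {μ₀ μ₁ v₀ v₁ κ : ℝ} (hμ₀ : μ₀ = ∑ s, Complex.normSq (φ s) * ε s)
    (hμ₁ : μ₁ = ∑ s, gibbsProb ε y s * ε s)
    (hv₀ : v₀ = (∑ s, Complex.normSq (φ s) * (ε s - μ₀) ^ 2) / δ ^ 2)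
    (hv₁ : v₁ = (∑ s, gibbsProb ε y s * (ε s - μ₁) ^ 2) / δ ^ 2)
    (hκ : κ = β * (μ₀ - δ) + Real.log (partition ε y) + (y - β) * μ₁ - |y - β| * δ)
    (hhalf : v₁ / ((m + 1 : ℕ) : ℝ) ≤ 1 / 2) :
    ∃ P : HeatProcess β (spectralMatrix W ε) (W * Matrix.vecMulVec φ (star φ) * Wᴴ),
      |P.heat - (μ₀ - μ₁)| ≤ 2 * δ + v₀ / ((m + 1 : ℕ) : ℝ) * |μ₀ - μ₁| +
        2 * ((m + 2 : ℕ) : ℝ) ^ Fintype.card S * Real.exp (-((m + 1 : ℕ) : ℝ) * κ) *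
          (2 * |μ₀ - μ₁| + 2 * δ) := by
  classical
  have hS : Nonempty S := by
    by_contra h
    rw [not_nonempty_iff] at h
    simp at hφ
  set n : ℕ := m + 1 with hn
  have hn0 : 0 < n := Nat.succ_pos m
  have hn0' : (0 : ℝ) < n := by exact_mod_cast hn0
  set Ψ : (Fin n → S) → ℂ := fun f => ∏ i, φ (f i) with hΨ
  set p : S → ℝ := fun s => Complex.normSq (φ s) with hp
  have hp0 : ∀ s, 0 ≤ p s := fun s => Complex.normSq_nonneg _
  have hΨp : ∀ f, Complex.normSq (Ψ f) = productWeight p f := normSq_prod φ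
  have hΨ1 : ∑ f, Complex.normSq (Ψ f) = 1 := by
    simp only [hΨp]
    exact sum_productWeight hφ
  set εR : (Fin n → S) → ℝ := fun f => ∑ i, ε (f i) with hεR
  set eL : (S → Fin (n + 1)) → ℝ := fun t => ∑ s, ((t s : ℕ) : ℝ) * ε s with heL
  have heLR : ∀ f, eL (letterCount f) = εR f := sum_letterCount_mul ε
  set w : (S → Fin (n + 1)) → ℝ :=
    fun t => ∑ f, if letterCount f = t then Complex.normSq (Ψ f) else 0 with hw
  let G := {f : Fin n → S // |εR f - n * μ₁| ≤ n * δ}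
  let T := {t : S → Fin (n + 1) // 0 < w t ∧ |eL t - n * μ₀| ≤ n * δ}
  let g : G → (Fin n → S) := Subtype.val
  have hg : Function.Injective g := Subtype.val_injective
  let eT : T → ℝ := fun t => eL t.1
  -- words are labelled by their letter count; all words with the same label have the same energy
  let c : (Fin n → S) → Option T := fun f =>
    if h : 0 < w (letterCount f) ∧ |eL (letterCount f) - n * μ₀| ≤ n * δ
    then some ⟨letterCount f, h⟩ else none
  have hc : ∀ f t, c f = some t ↔ letterCount f = t.1 := by
    intro f t
    constructor
    · intro h
      simp only [c] at h
      split_ifs at h with h1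
      exact congrArg Subtype.val (Option.some.inj h)
    · intro h
      have h1 := t.2
      rw [← h] at h1
      simp only [c]
      rw [dif_pos h1]
      exact congrArg some (Subtype.ext h)
  have hsw : ∀ t : T, sectorWeight Ψ c t = w t.1 := by
    intro t
    simp only [sectorWeight, hc, hw]
  have hsp : ∀ t : T, 0 < sectorWeight Ψ c t := fun t => by
    rw [hsw]
    exact t.2.1
  have hcE : ∀ f t, c f = some t → εR f = eT t := by
    intro f t h
    rw [← heLR, (hc f t).1 h]
  -- the words without label carry little weight
  have hmiss : 1 - ∑ t, sectorWeight Ψ c t ≤ v₀ / n := by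
    rw [one_sub_sum_sectorWeight hΨ1, hv₀]
    refine le_trans ?_ (hμ₀ ▸ sum_productWeight_deviation_le hp0 hφ ε hδ hn0)
    refine Finset.sum_le_sum fun f _ => ?_
    have hwf := productWeight_nonneg hp0 f
    rw [hΨp]
    by_cases hcf : c f = none
    · rw [if_pos hcf]
      split_ifs with hdev
      · simp only [c] at hcf
        split_ifs at hcf with h1
        have h2 : ¬ 0 < w (letterCount f) := fun h => h1 ⟨h, by rw [heLR]; exact hdev⟩
        have h3 : Complex.normSq (Ψ f) ≤ w (letterCount f) := by
          rw [hw]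
          have := Finset.single_le_sum (f := fun f' =>
            if letterCount f' = letterCount f then Complex.normSq (Ψ f') else 0)
            (fun f' _ => by split_ifs <;> simp [Complex.normSq_nonneg]) (Finset.mem_univ f)
          simpa using this
        rw [hΨp] at h3
        linarith
      · exact le_rfl
    · rw [if_neg hcf]
      split_ifs
      · exact le_rfl
      · exact hwf
  have hGw : 1 / 2 ≤ ∑ a : G, productWeight (gibbsProb ε y) a.1 := by
    have h1 := hμ₁ ▸ sum_productWeight_deviation_le (gibbsProb_nonneg ε y) (sum_gibbsProb ε y) ε
      hδ hn0
    have h2 := sum_productWeight (n := n) (sum_gibbsProb ε y)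
    have h3 : ∑ a : G, productWeight (gibbsProb ε y) a.1 =
        ∑ f : Fin n → S, if |εR f - n * μ₁| ≤ n * δ then productWeight (gibbsProb ε y) f else 0 := by
      rw [← Finset.sum_filter]
      exact (Finset.sum_subtype _ (by simp) _).symm
    have h4 : ∑ a : G, productWeight (gibbsProb ε y) a.1 + ∑ f : Fin n → S,
        (if |εR f - n * μ₁| ≤ n * δ then 0 else productWeight (gibbsProb ε y) f) = 1 := by
      rw [h3, ← Finset.sum_add_distrib, ← h2]
      refine Finset.sum_congr rfl fun f _ => ?_
      split_ifs <;> simp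
    rw [← hv₁] at h1
    linarith
  have hGne : Nonempty G := by
    by_contra h
    rw [not_nonempty_iff] at h
    rw [Finset.univ_eq_empty, Finset.sum_empty] at hGw
    norm_num at hGw
  have hne : Nonempty (G ⊕ T) := ⟨Sum.inl hGne.some⟩
  let hE : G ⊕ T → ℝ := Sum.elim (fun a => εR (g a)) eT
  have hZpos := partition_pos ε y
  -- comparison of the partition sums of the two groups of environment levels
  have hZG : 1 / 2 * Real.exp (n * (Real.log (partition ε y) + (y - β) * μ₁ - |y - β| * δ)) ≤
      ∑ a : G, Real.exp (-β * εR (g a)) := by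
    have h1 : ∀ a : G, Real.exp (n * (Real.log (partition ε y) + (y - β) * μ₁ - |y - β| * δ)) *
        productWeight (gibbsProb ε y) a.1 ≤ Real.exp (-β * εR (g a)) := by
      intro a
      have h2 : Real.exp (n * Real.log (partition ε y)) = partition ε y ^ n := by
        rw [mul_comm, Real.exp_mul, Real.exp_log hZpos, Real.rpow_natCast]
      have h3 : (y - β) * (εR a.1 - n * μ₁) ≥ -(|y - β| * (n * δ)) := by
        have h4 := abs_mul (y - β) (εR a.1 - n * μ₁)
        have h5 := mul_le_mul_of_nonneg_left a.2 (abs_nonneg (y - β))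
        have h6 := neg_abs_le ((y - β) * (εR a.1 - n * μ₁))
        linarith
      rw [productWeight_gibbsProb, ← h2, ← Real.exp_sub, ← Real.exp_add]
      refine Real.exp_le_exp.2 ?_
      change _ + (-y * εR a.1 - _) ≤ -β * εR a.1
      nlinarith
    calc _ ≤ Real.exp (n * (Real.log (partition ε y) + (y - β) * μ₁ - |y - β| * δ)) *
          ∑ a : G, productWeight (gibbsProb ε y) a.1 := by
          rw [mul_comm]
          exact mul_le_mul_of_nonneg_left hGw (Real.exp_pos _).le
      _ ≤ _ := by
          rw [Finset.mul_sum]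
          exact Finset.sum_le_sum fun a _ => h1 a
  have hZT : ∑ t : T, Real.exp (-β * eT t) ≤
      ((m + 2 : ℕ) : ℝ) ^ Fintype.card S * Real.exp (-(n * (β * (μ₀ - δ)))) := by
    have h1 : ∀ t : T, Real.exp (-β * eT t) ≤ Real.exp (-(n * (β * (μ₀ - δ)))) := by
      intro t
      refine Real.exp_le_exp.2 ?_
      have h2 := (abs_le.1 t.2.2).1
      have h3 : n * (μ₀ - δ) ≤ eT t := by
        change n * (μ₀ - δ) ≤ eL t.1
        linarith
      nlinarith [mul_le_mul_of_nonneg_left h3 hβ.le]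
    refine (Finset.sum_le_sum fun t _ => h1 t).trans ?_
    rw [Finset.sum_const, nsmul_eq_mul]
    refine mul_le_mul_of_nonneg_right ?_ (Real.exp_pos _).le
    have h2 := Fintype.card_subtype_le (fun t : S → Fin (n + 1) =>
      0 < w t ∧ |eL t - n * μ₀| ≤ n * δ)
    rw [Fintype.card_pi, Finset.prod_const, Fintype.card_fin, Finset.card_univ] at h2
    have h3 : (Finset.univ : Finset T).card ≤ (m + 2) ^ Fintype.card S := h2
    exact_mod_cast h3
  -- the levels of the second group are rarely populated
  have hπT : ∑ t : T, gibbsProb hE β (Sum.inr t) ≤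
      2 * ((m + 2 : ℕ) : ℝ) ^ Fintype.card S * Real.exp (-(n : ℝ) * κ) := by
    have hZGpos : 0 < 1 / 2 *
      Real.exp (n * (Real.log (partition ε y) + (y - β) * μ₁ - |y - β| * δ)) := by positivity
    have h1 : ∑ a : G, Real.exp (-β * εR (g a)) ≤ partition hE β := by
      rw [partition, Fintype.sum_sum_type]
      exact le_add_of_nonneg_right (Finset.sum_nonneg fun _ _ => (Real.exp_pos _).le)
    simp only [gibbsProb, ← Finset.sum_div]
    rw [div_le_iff₀ (partition_pos hE β)]
    refine hZT.trans ?_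
    have h2 := hZG.trans h1
    calc ((m + 2 : ℕ) : ℝ) ^ Fintype.card S * Real.exp (-(n * (β * (μ₀ - δ))))
        = 2 * ((m + 2 : ℕ) : ℝ) ^ Fintype.card S * Real.exp (-(n : ℝ) * κ) * (1 / 2 *
          Real.exp (n * (Real.log (partition ε y) + (y - β) * μ₁ - |y - β| * δ))) := by
          have : Real.exp (-(n * (β * (μ₀ - δ)))) = Real.exp (-(n : ℝ) * κ) *
              Real.exp (n * (Real.log (partition ε y) + (y - β) * μ₁ - |y - β| * δ)) := by
            rw [← Real.exp_add, hκ]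
            ring_nf
          rw [this]
          ring
      _ ≤ _ := mul_le_mul_of_nonneg_left h2 (by positivity)
  obtain ⟨P, hP⟩ := exists_heatProcess_of_collective (m := m) hW ε (vecMulVec_isState hφ) β hE
    (partialSwap_mem_unitary hsp hg) (partialSwap_energy εR eT hcE)
  refine ⟨P, ?_⟩
  have hheat : P.heat = ∑ a : G, ∑ t : T, (gibbsProb hE β (Sum.inl a) * sectorWeight Ψ c t -
      gibbsProb hE β (Sum.inr t) * Complex.normSq (Ψ (g a))) * ((eT t - εR (g a)) / n) := by
    rw [hP, tensorProduct_vecMulVec]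
    have h1 := heat_partialSwap hsp hg hΨ1 (gibbsProb hE β) εR eT
    have h2 : ((m : ℝ) + 1)⁻¹ = (n : ℝ)⁻¹ := by
      rw [hn]
      push_cast
      rfl
    rw [h2]
    refine (congrArg (fun x => (n : ℝ)⁻¹ * x) h1).trans ?_
    simp only [Finset.mul_sum]
    refine Finset.sum_congr rfl fun a _ => Finset.sum_congr rfl fun t _ => ?_
    ring
  rw [hheat]
  -- every transition takes place between typical energies
  have hd : ∀ (a : G) (t : T), |(eT t - εR (g a)) / n - (μ₀ - μ₁)| ≤ 2 * δ := by
    intro a t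
    have h1 : (eT t - εR (g a)) / n - (μ₀ - μ₁) =
        ((eL t.1 - n * μ₀) - (εR a.1 - n * μ₁)) / n := by
      field_simp
      simp only [eT, g]
      ring
    rw [h1, abs_div, abs_of_pos hn0', div_le_iff₀ hn0']
    have h2 := abs_sub (eL t.1 - n * μ₀) (εR a.1 - n * μ₁)
    have h3 := t.2.2
    have h4 := a.2
    linarith
  have hsum : ∑ a : G, gibbsProb hE β (Sum.inl a) + ∑ t : T, gibbsProb hE β (Sum.inr t) = 1 := by
    rw [← Fintype.sum_sum_type, sum_gibbsProb]
  have hP1 : ∑ a : G, Complex.normSq (Ψ (g a)) ≤ 1 := by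
    rw [← hΨ1]
    calc _ = ∑ f ∈ Finset.univ.image g, Complex.normSq (Ψ f) :=
          (Finset.sum_image fun x _ y _ h => hg h).symm
      _ ≤ _ := Finset.sum_le_sum_of_subset_of_nonneg (Finset.subset_univ _)
          fun f _ _ => Complex.normSq_nonneg _
  have hp1 : ∑ t, sectorWeight Ψ c t ≤ 1 := by
    have h1 := one_sub_sum_sectorWeight hΨ1 c
    have h2 : 0 ≤ ∑ f, if c f = none then Complex.normSq (Ψ f) else 0 :=
      Finset.sum_nonneg fun f _ => by split_ifs <;> simp [Complex.normSq_nonneg]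
    linarith
  refine (abs_heat_sub_le hδ.le (fun a => gibbsProb_nonneg hE β _)
    (fun t => gibbsProb_nonneg hE β _) hsum (fun t => (hsp t).le) hp1
    (fun a => Complex.normSq_nonneg _) hP1 hd).trans ?_
  have h1 := mul_le_mul_of_nonneg_right hmiss (abs_nonneg (μ₀ - μ₁))
  have h2 := mul_le_mul_of_nonneg_right hπT
    (show 0 ≤ 2 * |μ₀ - μ₁| + 2 * δ by positivity)
  linarith

theorem tendsto_pow_mul_exp_neg (d : ℕ) {κ : ℝ} (hκ : 0 < κ) :
    Filter.Tendsto (fun m : ℕ => ((m + 2 : ℕ) : ℝ) ^ d * Real.exp (-((m + 1 : ℕ) : ℝ) * κ))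
      Filter.atTop (nhds 0) := by
  have h1 : |Real.exp (-κ)| < 1 := by
    rw [abs_of_pos (Real.exp_pos _), Real.exp_lt_one_iff]
    linarith
  have h2 := ((Filter.tendsto_add_atTop_iff_nat 2).2
    (tendsto_pow_const_mul_const_pow_of_abs_lt_one d h1)).mul_const (Real.exp κ)
  rw [zero_mul] at h2
  refine h2.congr fun m => ?_
  rw [mul_assoc, ← Real.exp_nat_mul, ← Real.exp_add]
  congr 2
  push_cast
  ring

/-- A pure state can be driven, with a memory returned to its initial state, to essentially the
energy of any Gibbs state of smaller free energy. -/
theorem exists_heatProcess_near {H ρ : Matrix S S ℂ} (hH : H.IsHermitian) (hp : IsPure ρ) {β : ℝ}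
    (hβ : 0 < β) {y : ℝ} (hy : freeEnergy β H (gibbs H y) < freeEnergy β H ρ) {η : ℝ}
    (hη : 0 < η) :
    ∃ P : HeatProcess β H ρ, |P.heat - (energy H ρ - energy H (gibbs H y))| < η := by
  have hS0 := hp.entropy_eq_zero
  obtain ⟨W, hW, ε, rfl⟩ := exists_spectralMatrix hH
  obtain ⟨ψ, hψ, rfl⟩ := hp
  set φ : S → ℂ := Wᴴ *ᵥ ψ with hφdef
  have hstar : star φ = star ψ ᵥ* W := by
    rw [hφdef, Matrix.star_mulVec, Matrix.conjTranspose_conjTranspose]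
  have hWφ : W *ᵥ φ = ψ := by
    rw [hφdef, Matrix.mulVec_mulVec, unitary_mul_conjTranspose hW, Matrix.one_mulVec]
  have hφ : ∑ s, Complex.normSq (φ s) = 1 := by
    have : star φ ⬝ᵥ φ = 1 := by
      rw [hstar, ← Matrix.dotProduct_mulVec, hWφ, hψ]
    rw [star_dotProduct_self] at this
    exact_mod_cast this
  have hρ : W * Matrix.vecMulVec φ (star φ) * Wᴴ = Matrix.vecMulVec ψ (star ψ) := by
    rw [Matrix.mul_vecMulVec, Matrix.vecMulVec_mul, hWφ, ← Matrix.star_mulVec, hWφ]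
  rw [freeEnergy, freeEnergy, hS0, zero_div, sub_zero] at hy
  rw [← hρ] at hy ⊢
  have hN : Nonempty S := by
    by_contra h
    rw [not_nonempty_iff] at h
    simp at hφ
  set μ₀ := ∑ s, Complex.normSq (φ s) * ε s with hμ₀
  set μ₁ := ∑ s, gibbsProb ε y s * ε s with hμ₁
  have hE0 : energy (spectralMatrix W ε) (W * Matrix.vecMulVec φ (star φ) * Wᴴ) = μ₀ := by
    rw [energy_spectralMatrix, show Wᴴ * (W * Matrix.vecMulVec φ (star φ) * Wᴴ) * W =
      (Wᴴ * W) * Matrix.vecMulVec φ (star φ) * (Wᴴ * W) by simp only [Matrix.mul_assoc],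
      unitary_conjTranspose_mul hW, one_mul, mul_one]
    refine Finset.sum_congr rfl fun s _ => ?_
    rw [Matrix.vecMulVec_apply, Pi.star_apply, mul_comm (ε s)]
    congr 1
    rw [← starRingEnd_apply, Complex.mul_conj, Complex.ofReal_re]
  have hE1 : energy (spectralMatrix W ε) (gibbs (spectralMatrix W ε) y) = μ₁ := by
    rw [energy_gibbs_spectralMatrix ε y hW]
    exact Finset.sum_congr rfl fun s _ => mul_comm _ _
  rw [entropy_gibbs_spectralMatrix ε y hW, sum_negMulLog_gibbsProb,
    ← energy_gibbs_spectralMatrix ε y hW, hE0, hE1] at hy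
  rw [hE0, hE1]
  set L := Real.log (partition ε y) with hL
  -- the decay rate for `δ = 0` is the free energy difference in units of the temperature
  set κ₀ := β * μ₀ + L + (y - β) * μ₁ with hκ₀
  have hκ₀pos : 0 < κ₀ := by
    have h1 : β * (μ₁ - (y * μ₁ + L) / β) < β * μ₀ := mul_lt_mul_of_pos_left hy hβ
    rw [mul_sub, mul_div_cancel₀ _ hβ.ne'] at h1
    rw [hκ₀]
    linarith
  have hc : 0 < β + |y - β| := by positivity
  set δ := min (η / 4) (κ₀ / (2 * (β + |y - β|))) with hδdef
  have hδ : 0 < δ := lt_min (by positivity) (by positivity)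
  have hδη : δ ≤ η / 4 := min_le_left _ _
  have hδκ : δ * (β + |y - β|) ≤ κ₀ / 2 := by
    calc δ * (β + |y - β|) ≤ κ₀ / (2 * (β + |y - β|)) * (β + |y - β|) :=
          mul_le_mul_of_nonneg_right (min_le_right _ _) hc.le
      _ = κ₀ / 2 := by field_simp
  set κ := β * (μ₀ - δ) + L + (y - β) * μ₁ - |y - β| * δ with hκ
  have hκpos : 0 < κ := by
    rw [hκ]
    rw [hκ₀] at hδκ hκ₀pos
    linarith
  set v₀ := (∑ s, Complex.normSq (φ s) * (ε s - μ₀) ^ 2) / δ ^ 2 with hv₀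
  set v₁ := (∑ s, gibbsProb ε y s * (ε s - μ₁) ^ 2) / δ ^ 2 with hv₁
  have hinv : ∀ v : ℝ, Filter.Tendsto (fun m : ℕ => v / ((m + 1 : ℕ) : ℝ)) Filter.atTop
      (nhds 0) := fun v =>
    (Filter.tendsto_add_atTop_iff_nat 1).2 (tendsto_const_div_atTop_nhds_zero_nat v)
  have hlim : Filter.Tendsto (fun m : ℕ => 2 * δ + v₀ / ((m + 1 : ℕ) : ℝ) * |μ₀ - μ₁| +
      2 * ((m + 2 : ℕ) : ℝ) ^ Fintype.card S * Real.exp (-((m + 1 : ℕ) : ℝ) * κ) *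
        (2 * |μ₀ - μ₁| + 2 * δ)) Filter.atTop (nhds (2 * δ)) := by
    have h1 := (hinv v₀).mul_const |μ₀ - μ₁|
    have h2 := ((tendsto_pow_mul_exp_neg (Fintype.card S) hκpos).const_mul 2).mul_const
      (2 * |μ₀ - μ₁| + 2 * δ)
    have h3 := (h1.const_add (2 * δ)).add h2
    simpa only [zero_mul, mul_zero, add_zero, mul_assoc] using h3
  obtain ⟨m, hm, hmv⟩ := ((hlim.eventually_lt_const (by linarith : 2 * δ < η)).and
    ((hinv v₁).eventually_le_const one_half_pos)).exists
  obtain ⟨P, hP⟩ := exists_heatProcess_le hW ε hφ hβ y hδ m hμ₀ hμ₁ hv₀ hv₁ hκ hmv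
  exact ⟨P, hP.trans_lt hm⟩

end Achievability

/-! ### Strict monotonicity of the energy of Gibbs states -/

section Monotonicity

variable {n : Type*} [Fintype n] [DecidableEq n] {H : Matrix n n ℂ}

/-- Two Gibbs distributions `p`, `q` at `x ≠ y` satisfy
`∑ (p - q) (log p - log q) = (x - y) (E_q - E_p)`, so that equal energies force `p = q` and hence a
Hamiltonian with a single level. -/
theorem gibbs_eq_of_energy_gibbs_eq (hH : H.IsHermitian) {x y : ℝ} (hxy : x ≠ y)
    (h : energy H (gibbs H x) = energy H (gibbs H y)) (z w : ℝ) : gibbs H z = gibbs H w := by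
  obtain ⟨W, hW, e, rfl⟩ := exists_spectralMatrix hH
  rcases isEmpty_or_nonempty n with hn | hn
  · exact Subsingleton.elim _ _
  rw [energy_gibbs_spectralMatrix e x hW, energy_gibbs_spectralMatrix e y hW] at h
  set p := gibbsProb e x with hp
  set q := gibbsProb e y with hq
  have hlog : ∀ i, Real.log (p i) - Real.log (q i) =
      (y - x) * e i + (Real.log (partition e y) - Real.log (partition e x)) := fun i => by
    rw [hp, hq, log_gibbsProb, log_gibbsProb]
    ring
  have hterm : ∀ i, 0 ≤ (p i - q i) * (Real.log (p i) - Real.log (q i)) := fun i => by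
    rcases le_total (p i) (q i) with h1 | h1
    · exact mul_nonneg_of_nonpos_of_nonpos (sub_nonpos.2 h1)
        (sub_nonpos.2 (Real.log_le_log (gibbsProb_pos e x i) h1))
    · exact mul_nonneg (sub_nonneg.2 h1)
        (sub_nonneg.2 (Real.log_le_log (gibbsProb_pos e y i) h1))
  have hsum : ∑ i, (p i - q i) * (Real.log (p i) - Real.log (q i)) = 0 := by
    have h1 : ∀ i, (p i - q i) * (Real.log (p i) - Real.log (q i)) =
        (y - x) * (e i * p i) - (y - x) * (e i * q i) +
        (Real.log (partition e y) - Real.log (partition e x)) * (p i - q i) := fun i => by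
      rw [hlog]
      ring
    have hp1 : ∑ i, p i = 1 := sum_gibbsProb e x
    have hq1 : ∑ i, q i = 1 := sum_gibbsProb e y
    rw [Finset.sum_congr rfl fun i _ => h1 i]
    simp only [Finset.sum_add_distrib, Finset.sum_sub_distrib, ← Finset.mul_sum, h, hp1, hq1,
      sub_self, mul_zero, add_zero]
  have hlevel : ∀ i, e i =
      (Real.log (partition e y) - Real.log (partition e x)) / (x - y) := fun i => by
    have h1 := (Finset.sum_eq_zero_iff_of_nonneg fun i _ => hterm i).1 hsum i (Finset.mem_univ i)
    have h2 : Real.log (p i) - Real.log (q i) = 0 := by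
      rcases mul_eq_zero.1 h1 with h3 | h3
      · rw [sub_eq_zero.1 h3, sub_self]
      · exact h3
    rw [hlog] at h2
    rw [eq_div_iff (sub_ne_zero.2 hxy)]
    linarith
  obtain ⟨c, rfl⟩ : ∃ c, e = fun _ => c := ⟨_, funext hlevel⟩
  rw [gibbs_spectralMatrix _ z hW, gibbs_spectralMatrix _ w hW]
  congr 1
  funext i
  simp only [gibbsProb, partition, Finset.sum_const, nsmul_eq_mul]
  rw [div_mul_cancel_right₀ (Real.exp_pos _).ne', div_mul_cancel_right₀ (Real.exp_pos _).ne']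

theorem energy_gibbs_lt (hH : H.IsHermitian) {x y : ℝ} (hxy : x < y) {z w : ℝ}
    (hzw : gibbs H z ≠ gibbs H w) : energy H (gibbs H y) < energy H (gibbs H x) := by
  rcases isEmpty_or_nonempty n with hn | hn
  · exact absurd (Subsingleton.elim _ _) hzw
  refine lt_of_le_of_ne ?_ fun h => hzw (gibbs_eq_of_energy_gibbs_eq hH hxy.ne h.symm z w)
  have h1 := gibbs_variational x hH (gibbs_isState y hH)
  have h2 := gibbs_variational y hH (gibbs_isState x hH)
  refine le_of_mul_le_mul_left ?_ (sub_pos.2 hxy)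
  linarith

end Monotonicity

/-! ### Detection of pure entangled states -/

section Detection

variable {A B : Type*} [Fintype A] [DecidableEq A] [Fintype B] [DecidableEq B]
  {HA : Matrix A A ℂ} {HB : Matrix B B ℂ} {β : ℝ} {ρ : Matrix (A × B) (A × B) ℂ}

theorem freeEnergyStar_lt_freeEnergy (hβ : 0 < β) (hρ : IsState ρ) (hp : IsPure ρ)
    (hs : ¬ Separable ρ) : freeEnergyStar β HA HB ρ < freeEnergy β (totalH HA HB) ρ := by
  rw [freeEnergyStar_eq, freeEnergy, hp.entropy_eq_zero, zero_div]
  have : 0 < β⁻¹ * maxLocalEntropy ρ :=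
    mul_pos (inv_pos.2 hβ) (lt_max_of_lt_left (entropy_traceRight_pos hρ hp hs))
  linarith

theorem gibbs_ne_of_zeroFun_eq_zero (hHA : HA.IsHermitian) (hHB : HB.IsHermitian) (hβ : 0 < β)
    (hρ : IsState ρ) (hp : IsPure ρ) (hs : ¬ Separable ρ) {x : ℝ}
    (hx : zeroFun β (totalH HA HB) x (freeEnergyStar β HA HB ρ) = 0) :
    gibbs (totalH HA HB) x ≠ gibbs (totalH HA HB) β := by
  intro h
  rw [zeroFun, h] at hx
  have h1 := freeEnergy_gibbs_add_le hHA hHB hβ hρ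
  have h2 : 0 < β⁻¹ * min (entropy (traceRight ρ)) (entropy (traceLeft ρ)) :=
    mul_pos (inv_pos.2 hβ)
      (lt_min (entropy_traceRight_pos hρ hp hs) (entropy_traceLeft_pos hρ hp hs))
  linarith

/-- The free energy of `ρ` exceeds that of the Gibbs state at `x` strictly, hence also that of the
Gibbs states slightly beyond `x`, which are strictly more energetic. -/
theorem exists_heat_lt_heatBound (hHA : HA.IsHermitian) (hHB : HB.IsHermitian) (hβ : 0 < β)
    (hρ : IsState ρ) (hp : IsPure ρ) (hs : ¬ Separable ρ) {x : ℝ}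
    (hx : zeroFun β (totalH HA HB) x (freeEnergyStar β HA HB ρ) = 0) :
    ∃ P : HeatProcess β (totalH HA HB) ρ, P.heat < heatBound β HA HB ρ x := by
  have := hρ.nonempty
  have hH := totalH_isHermitian hHA hHB
  have hx' := freeEnergyStar_lt_freeEnergy (HA := HA) (HB := HB) hβ hρ hp hs
  rw [sub_eq_zero.1 hx] at hx'
  obtain ⟨y, hy, hyx⟩ := ((((continuous_freeEnergy_gibbs hH β).tendsto x).mono_left
    nhdsWithin_le_nhds).eventually_lt_const hx' |>.and self_mem_nhdsWithin :
      ∀ᶠ y in nhdsWithin x (Set.Iio x), _ ∧ y ∈ Set.Iio x).exists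
  have hlt := energy_gibbs_lt hH (Set.mem_Iio.1 hyx)
    (gibbs_ne_of_zeroFun_eq_zero hHA hHB hβ hρ hp hs hx)
  obtain ⟨P, hP⟩ := exists_heatProcess_near hH hp hβ hy (sub_pos.2 hlt)
  refine ⟨P, ?_⟩
  rw [heatBound_eq hx]
  have := (abs_lt.1 hP).2
  linarith

theorem exists_heatBound_lt_heat (hHA : HA.IsHermitian) (hHB : HB.IsHermitian) (hβ : 0 < β)
    (hρ : IsState ρ) (hp : IsPure ρ) (hs : ¬ Separable ρ) {x : ℝ}
    (hx : zeroFun β (totalH HA HB) x (freeEnergyStar β HA HB ρ) = 0) :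
    ∃ P : HeatProcess β (totalH HA HB) ρ, heatBound β HA HB ρ x < P.heat := by
  have := hρ.nonempty
  have hH := totalH_isHermitian hHA hHB
  have hx' := freeEnergyStar_lt_freeEnergy (HA := HA) (HB := HB) hβ hρ hp hs
  rw [sub_eq_zero.1 hx] at hx'
  obtain ⟨y, hy, hyx⟩ := ((((continuous_freeEnergy_gibbs hH β).tendsto x).mono_left
    nhdsWithin_le_nhds).eventually_lt_const hx' |>.and self_mem_nhdsWithin :
      ∀ᶠ y in nhdsWithin x (Set.Ioi x), _ ∧ y ∈ Set.Ioi x).exists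
  have hlt := energy_gibbs_lt hH (Set.mem_Ioi.1 hyx)
    (gibbs_ne_of_zeroFun_eq_zero hHA hHB hβ hρ hp hs hx)
  obtain ⟨P, hP⟩ := exists_heatProcess_near hH hp hβ hy (sub_pos.2 hlt)
  refine ⟨P, ?_⟩
  rw [heatBound_eq hx]
  have := (abs_lt.1 hP).1
  linarith

theorem exists_isColdTemp_of_degeneracy_eq_one (hHA : HA.IsHermitian) (hHB : HB.IsHermitian)
    (hβ : 0 < β) (hρ : IsState ρ) (hp : IsPure ρ) (hs : ¬ Separable ρ)
    (hg : degeneracy (totalH HA HB) (maxEnergy (totalH HA HB)) = 1) :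
    ∃ x, IsColdTemp β HA HB ρ x := by
  refine exists_isColdTemp hHA hHB hβ hρ ?_
  have h1 := freeEnergyStar_lt_freeEnergy (HA := HA) (HB := HB) hβ hρ hp hs
  rw [freeEnergy, hp.entropy_eq_zero, zero_div, sub_zero] at h1
  rw [hg, Nat.cast_one, Real.log_one, mul_zero, sub_zero]
  exact h1.trans_le (energy_mem_Icc (totalH_isHermitian hHA hHB) hρ).2

end Detection

end HeatWitness

theorem mainTheorem3 {A B : Type*} [Fintype A] [DecidableEq A] [Fintype B] [DecidableEq B]
    (HA : Matrix A A ℂ) (HB : Matrix B B ℂ) (hHA : HA.IsHermitian) (hHB : HB.IsHermitian)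
    (β : ℝ) (hβ : 0 < β)
    (ρ : Matrix (A × B) (A × B) ℂ) (hρ : HeatWitness.IsState ρ) :
    -- separable states: conditional entropies, free energy, heat exchange
    (HeatWitness.Separable ρ →
      0 ≤ HeatWitness.condEntropyAB ρ ∧ 0 ≤ HeatWitness.condEntropyBA ρ ∧
      HeatWitness.freeEnergy β (HeatWitness.totalH HA HB) ρ ≤
        HeatWitness.freeEnergyStar β HA HB ρ ∧
      ∀ P : HeatWitness.HeatProcess β (HeatWitness.totalH HA HB) ρ,
        (∀ x, HeatWitness.IsColdTemp β HA HB ρ x →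
          HeatWitness.heatBound β HA HB ρ x ≤ P.heat) ∧
        (∀ x, HeatWitness.IsHotTemp β HA HB ρ x →
          P.heat ≤ HeatWitness.heatBound β HA HB ρ x)) ∧
    -- the bound on the free energy is tight
    (∀ σ : Matrix A A ℂ, HeatWitness.IsState σ →
      ∃ τ : Matrix (A × B) (A × B) ℂ, HeatWitness.Separable τ ∧
        HeatWitness.traceRight τ = σ ∧
        HeatWitness.freeEnergy β (HeatWitness.totalH HA HB) τ =
          HeatWitness.freeEnergyStar β HA HB τ) ∧
    -- existence of the inverse temperatures, and the bounds on heat that replace them otherwise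
    (HeatWitness.freeEnergyStar β HA HB ρ <
        HeatWitness.maxEnergy (HeatWitness.totalH HA HB) -
          β⁻¹ * Real.log (HeatWitness.degeneracy (HeatWitness.totalH HA HB)
            (HeatWitness.maxEnergy (HeatWitness.totalH HA HB))) →
      ∃ x, HeatWitness.IsColdTemp β HA HB ρ x) ∧
    (HeatWitness.freeEnergyStar β HA HB ρ <
        HeatWitness.minEnergy (HeatWitness.totalH HA HB) -
          β⁻¹ * Real.log (HeatWitness.degeneracy (HeatWitness.totalH HA HB)
            (HeatWitness.minEnergy (HeatWitness.totalH HA HB))) →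
      ∃ x, HeatWitness.IsHotTemp β HA HB ρ x) ∧
    (∀ P : HeatWitness.HeatProcess β (HeatWitness.totalH HA HB) ρ,
      HeatWitness.energy (HeatWitness.totalH HA HB) ρ -
          HeatWitness.maxEnergy (HeatWitness.totalH HA HB) ≤ P.heat ∧
      P.heat ≤ HeatWitness.energy (HeatWitness.totalH HA HB) ρ -
          HeatWitness.minEnergy (HeatWitness.totalH HA HB)) ∧
    -- a violation of either bound certifies entanglement
    (∀ (P : HeatWitness.HeatProcess β (HeatWitness.totalH HA HB) ρ) (x : ℝ),
      ((HeatWitness.IsColdTemp β HA HB ρ x ∧ P.heat < HeatWitness.heatBound β HA HB ρ x) ∨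
        (HeatWitness.IsHotTemp β HA HB ρ x ∧ HeatWitness.heatBound β HA HB ρ x < P.heat)) →
      ¬ HeatWitness.Separable ρ) ∧
    -- pure entangled states are detected by actual processes
    (HeatWitness.IsPure ρ → ¬ HeatWitness.Separable ρ →
      HeatWitness.condEntropyAB ρ < 0 ∧ HeatWitness.condEntropyBA ρ < 0 ∧
      HeatWitness.freeEnergyStar β HA HB ρ <
        HeatWitness.freeEnergy β (HeatWitness.totalH HA HB) ρ ∧
      (∀ x, HeatWitness.IsColdTemp β HA HB ρ x →
        ∃ P : HeatWitness.HeatProcess β (HeatWitness.totalH HA HB) ρ,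
          P.heat < HeatWitness.heatBound β HA HB ρ x) ∧
      (∀ x, HeatWitness.IsHotTemp β HA HB ρ x →
        ∃ P : HeatWitness.HeatProcess β (HeatWitness.totalH HA HB) ρ,
          HeatWitness.heatBound β HA HB ρ x < P.heat) ∧
      (HeatWitness.degeneracy (HeatWitness.totalH HA HB)
          (HeatWitness.maxEnergy (HeatWitness.totalH HA HB)) = 1 →
        ∃ x, HeatWitness.IsColdTemp β HA HB ρ x ∧
          ∃ P : HeatWitness.HeatProcess β (HeatWitness.totalH HA HB) ρ,
            P.heat < HeatWitness.heatBound β HA HB ρ x)) := by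

  have hH := HeatWitness.totalH_isHermitian hHA hHB
  refine ⟨fun hs => ⟨?_, ?_, hs.freeEnergy_le hβ hρ, fun P => ⟨fun x hx => ?_, fun x hx => ?_⟩⟩,
    fun σ hσ => ?_, HeatWitness.exists_isColdTemp hHA hHB hβ hρ,
    HeatWitness.exists_isHotTemp hHA hHB hβ hρ, fun P => ?_, fun P x h hs => ?_,
    fun hp hs => ⟨?_, ?_, HeatWitness.freeEnergyStar_lt_freeEnergy hβ hρ hp hs,
      fun x hx => HeatWitness.exists_heat_lt_heatBound hHA hHB hβ hρ hp hs hx.2,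
      fun x hx => HeatWitness.exists_heatBound_lt_heat hHA hHB hβ hρ hp hs hx.2, fun hg => ?_⟩⟩
  · exact sub_nonneg.2 (hs.entropy_traceLeft_le hρ)
  · exact sub_nonneg.2 (hs.entropy_traceRight_le hρ)
  · exact HeatWitness.heatBound_le_heat hHA hHB hβ hρ hs P hx
  · exact HeatWitness.heat_le_heatBound hHA hHB hβ hρ hs P hx
  · obtain ⟨-, b⟩ := hρ.nonempty.some
    exact HeatWitness.exists_separable_freeEnergy_eq HA HB β b hσ
  · have h := HeatWitness.energy_mem_Icc hH (P.final_isState hρ).traceRight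
    rw [P.heat_eq hρ]
    exact ⟨sub_le_sub_left h.2 _, sub_le_sub_left h.1 _⟩
  · rcases h with ⟨hx, h⟩ | ⟨hx, h⟩
    · exact h.not_ge (HeatWitness.heatBound_le_heat hHA hHB hβ hρ hs P hx)
    · exact h.not_ge (HeatWitness.heat_le_heatBound hHA hHB hβ hρ hs P hx)
  · rw [HeatWitness.condEntropyAB, hp.entropy_eq_zero, zero_sub]
    exact neg_neg_of_pos (HeatWitness.entropy_traceLeft_pos hρ hp hs)
  · rw [HeatWitness.condEntropyBA, hp.entropy_eq_zero, zero_sub]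
    exact neg_neg_of_pos (HeatWitness.entropy_traceRight_pos hρ hp hs)
  · obtain ⟨x, hx⟩ :=
      HeatWitness.exists_isColdTemp_of_degeneracy_eq_one hHA hHB hβ hρ hp hs hg
    exact ⟨x, hx, HeatWitness.exists_heat_lt_heatBound hHA hHB hβ hρ hp hs hx.2⟩
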